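/- For an integer $\Delta\ge 1$ put $n=\Delta^2$ and let $[\Delta]^2$ be the pixel grid with the $\ell_1$ distance. For $x,y\in\mathbb{R}_{\ge 0}^{[\Delta]^2}$ with $\|x\|_1=\|y\|_1$ let $$\mathrm{EMD}^*(x,y)=\min_{\gamma}\sum_{i,j\in[\Delta]^2}\gamma(i,j)\,\|i-j\|_1,$$ the minimum being over all $\gamma\ge 0$ with $\sum_l\gamma(i,l)=x_i$ and $\sum_l\gamma(l,j)=y_j$ for all $i,j$. For $w\in\mathbb{R}^{[\Delta]^2}$ let $$\|w\|_{EMD}=\min\{\mathrm{EMD}^*(x,y)+2\Delta\|z\|_1 \;:\; x-y+z=w,\ \|x\|_1=\|y\|_1,\ x,y\ge 0\}.$$ Computations are carried out on a real RAM: its registers and arrays hold either real numbers, with unit-cost exact arithmetic and comparisons, or words of $O(\log n)$ bits, with unit-cost word arithmetic, comparisons and indirect addressing; reals cannot be rounded to words. **Theorem.** There are absolute constants $C>0$ and $c\in\mathbb{N}$ and one fixed real RAM program such that for all integers $\Delta$ and $k$ with $1\le k<n/2$, $n=\Delta^2$, and all real $0<\epsilon\le 1$, there are a real $m\times n$ matrix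 $A$ with $$m\le C\,\epsilon^{-2}\,k\,\log^2(n/k)$$ and a table of at most $C\,n\log^c n$ words of at most $C\log n$ bits each (both depending only on $\Delta,k,\epsilon$) with the following property. For every $x\in\mathbb{R}_{\ge 0}^{[\Delta]^2}$, the program, given the measurement vector $Ax$ and the table, halts after at most $C\,n\log^c n$ steps and returns a vector $x^*\in\mathbb{R}^{[\Delta]^2}$ with $$\|x-x^*\|_{EMD}\le \epsilon\min_{x'\ k\text{-sparse}}\|x-x'\|_{EMD},$$ where $x'\in\mathbb{R}^{[\Delta]^2}$ is $k$-sparse if it has at most $k$ non-zero coordinates. -/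

import Mathlib

/-! ### The Earth-Mover norm on images -/

/-- The pixel grid `[Δ]²`. -/
abbrev Pixel (Δ : ℕ) : Type := Fin Δ × Fin Δ

/-- The `ℓ₁` distance between two pixels. -/
def pixelDist {Δ : ℕ} (p q : Pixel Δ) : ℝ :=
  |((p.1 : ℕ) : ℝ) - ((q.1 : ℕ) : ℝ)| + |((p.2 : ℕ) : ℝ) - ((q.2 : ℕ) : ℝ)|

/-- The `ℓ₁` norm of an image. -/
def l1Norm {Δ : ℕ} (x : Pixel Δ → ℝ) : ℝ := ∑ p, |x p|

/-- `γ` is a flow from `x` to `y`: a non-negative function with marginals `x` and `y`. -/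
structure IsFlow {Δ : ℕ} (x y : Pixel Δ → ℝ) (γ : Pixel Δ → Pixel Δ → ℝ) : Prop where
  nonneg : ∀ p q, 0 ≤ γ p q
  out_eq : ∀ p, ∑ q, γ p q = x p
  in_eq : ∀ q, ∑ p, γ p q = y q

/-- The cost of a flow. -/
def flowCost {Δ : ℕ} (γ : Pixel Δ → Pixel Δ → ℝ) : ℝ :=
  ∑ p, ∑ q, γ p q * pixelDist p q

/-- `EMD*(x, y)`, the minimal cost of a flow from `x` to `y`; it is used only for non-negative
`x`, `y` of equal `ℓ₁` norm, where flows exist. -/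
noncomputable def emdStar {Δ : ℕ} (x y : Pixel Δ → ℝ) : ℝ :=
  sInf {r : ℝ | ∃ γ : Pixel Δ → Pixel Δ → ℝ, IsFlow x y γ ∧ r = flowCost γ}

/-- The norm `‖w‖_EMD`: the minimum of `EMD*(x, y) + D ‖z‖₁`, `D = 2Δ`, over all decompositions
`w = x - y + z` with `x, y ≥ 0` of equal `ℓ₁` norm. -/
noncomputable def emdNorm {Δ : ℕ} (w : Pixel Δ → ℝ) : ℝ :=
  sInf {r : ℝ | ∃ x y z : Pixel Δ → ℝ,
    x - y + z = w ∧ l1Norm x = l1Norm y ∧ (∀ p, 0 ≤ x p) ∧ (∀ p, 0 ≤ y p) ∧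
      r = emdStar x y + (2 * (Δ : ℝ)) * l1Norm z}

/-- `x` has at most `k` non-zero coordinates. -/
def IsSparse {Δ : ℕ} (k : ℕ) (x : Pixel Δ → ℝ) : Prop :=
  {p : Pixel Δ | x p ≠ 0}.ncard ≤ k

/-! ### A real RAM with a step count

The machine has registers and arrays of two kinds: `b`-bit words (the only values usable as
addresses) and real numbers. Programs are finite and structured; every elementary operation, and
every evaluation of the condition of a conditional or of a loop, costs one step. There is no
rounding of reals to words. -/

/-- The arithmetic operations on words. -/
inductive WordOp where
  | add
  | sub
  | mul
  | div

/-- The operations on words of `b` bits: the results are reduced modulo `2 ^ b`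
(subtraction is truncated at `0`, division rounds down). -/
def WordOp.eval (b : ℕ) : WordOp → ℕ → ℕ → ℕ
  | .add, u, v => (u + v) % 2 ^ b
  | .sub, u, v => (u - v) % 2 ^ b
  | .mul, u, v => (u * v) % 2 ^ b
  | .div, u, v => (u / v) % 2 ^ b

/-- The arithmetic operations on reals. -/
inductive RealOp where
  | add
  | sub
  | mul
  | div

/-- The operations on reals, carried out exactly. -/
noncomputable def RealOp.eval : RealOp → ℝ → ℝ → ℝ
  | .add, u, v => u + v
  | .sub, u, v => u - v
  | .mul, u, v => u * v
  | .div, u, v => u / v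

/-- The contents of the machine: registers and arrays, both numbered by natural numbers. -/
structure Store where
  /-- word registers -/
  wreg : ℕ → ℕ
  /-- real registers -/
  rreg : ℕ → ℝ
  /-- word arrays: `warr a i` is the entry `i` of the array `a` -/
  warr : ℕ → ℕ → ℕ
  /-- real arrays: `rarr a i` is the entry `i` of the array `a` -/
  rarr : ℕ → ℕ → ℝ

namespace Store

/-- Assignment to a word register. -/
def setW (s : Store) (d v : ℕ) : Store :=
  { s with wreg := Function.update s.wreg d v }

/-- Assignment to a real register. -/
def setR (s : Store) (d : ℕ) (v : ℝ) : Store :=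
  { s with rreg := Function.update s.rreg d v }

/-- Assignment to an entry of a word array. -/
def setWArr (s : Store) (a i v : ℕ) : Store :=
  { s with warr := Function.update s.warr a (Function.update (s.warr a) i v) }

/-- Assignment to an entry of a real array. -/
def setRArr (s : Store) (a i : ℕ) (v : ℝ) : Store :=
  { s with rarr := Function.update s.rarr a (Function.update (s.rarr a) i v) }

/-- The store at the start of a computation: the real array `0` holds the vector `y`, the word
array `0` holds the list `table`, and everything else is zero. -/
def start {m : ℕ} (y : Fin m → ℝ) (table : List ℕ) : Store where
  wreg := fun _ => 0
  rreg := fun _ => 0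
  warr := fun a i => if a = 0 then table.getD i 0 else 0
  rarr := fun a i => if h : a = 0 ∧ i < m then y ⟨i, h.2⟩ else 0

/-- The image that is read off at the end of a computation: the real array `1`, row by row. -/
def image (Δ : ℕ) (s : Store) : Pixel Δ → ℝ :=
  fun p => s.rarr 1 ((p.1 : ℕ) * Δ + (p.2 : ℕ))

end Store

/-- Programs. Registers and arrays are named by fixed numbers; the entry of an array that is read
or written is the one whose index stands in a given word register. -/
inductive Prog where
  /-- do nothing -/
  | skip
  /-- `wreg d := v` -/
  | wconst (d v : ℕ)
  /-- `wreg d := wreg u (op) wreg v` -/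
  | wop (op : WordOp) (d u v : ℕ)
  /-- `wreg d := warr a (wreg i)` -/
  | wload (d a i : ℕ)
  /-- `warr a (wreg i) := wreg u` -/
  | wstore (a i u : ℕ)
  /-- `rreg d := wreg u` -/
  | rofw (d u : ℕ)
  /-- `rreg d := rreg u (op) rreg v` -/
  | rop (op : RealOp) (d u v : ℕ)
  /-- `rreg d := rarr a (wreg i)` -/
  | rload (d a i : ℕ)
  /-- `rarr a (wreg i) := rreg u` -/
  | rstore (a i u : ℕ)
  /-- first `P`, then `Q` -/
  | seq (P Q : Prog)
  /-- if `wreg u < wreg v` then `P` else `Q` -/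
  | ifW (u v : ℕ) (P Q : Prog)
  /-- if `rreg u < rreg v` then `P` else `Q` -/
  | ifR (u v : ℕ) (P Q : Prog)
  /-- while `wreg u < wreg v` do `P` -/
  | whileW (u v : ℕ) (P : Prog)

/-- `Prog.Runs b P s T s'`: with words of `b` bits, the program `P`, started in the store `s`,
halts after exactly `T` steps in the store `s'`. -/
inductive Prog.Runs (b : ℕ) : Prog → Store → ℕ → Store → Prop where
  | skip (s : Store) : Runs b .skip s 1 s
  | wconst (s : Store) (d v : ℕ) : Runs b (.wconst d v) s 1 (s.setW d (v % 2 ^ b))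
  | wop (s : Store) (op : WordOp) (d u v : ℕ) :
      Runs b (.wop op d u v) s 1 (s.setW d (op.eval b (s.wreg u) (s.wreg v)))
  | wload (s : Store) (d a i : ℕ) :
      Runs b (.wload d a i) s 1 (s.setW d (s.warr a (s.wreg i)))
  | wstore (s : Store) (a i u : ℕ) :
      Runs b (.wstore a i u) s 1 (s.setWArr a (s.wreg i) (s.wreg u))
  | rofw (s : Store) (d u : ℕ) : Runs b (.rofw d u) s 1 (s.setR d (s.wreg u : ℝ))
  | rop (s : Store) (op : RealOp) (d u v : ℕ) :
      Runs b (.rop op d u v) s 1 (s.setR d (op.eval (s.rreg u) (s.rreg v)))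
  | rload (s : Store) (d a i : ℕ) :
      Runs b (.rload d a i) s 1 (s.setR d (s.rarr a (s.wreg i)))
  | rstore (s : Store) (a i u : ℕ) :
      Runs b (.rstore a i u) s 1 (s.setRArr a (s.wreg i) (s.rreg u))
  | seq {P Q : Prog} {s₁ s₂ s₃ : Store} {T₁ T₂ : ℕ} :
      Runs b P s₁ T₁ s₂ → Runs b Q s₂ T₂ s₃ → Runs b (.seq P Q) s₁ (T₁ + T₂) s₃
  | ifW_true {P Q : Prog} {u v : ℕ} {s s' : Store} {T : ℕ} :
      s.wreg u < s.wreg v → Runs b P s T s' → Runs b (.ifW u v P Q) s (T + 1) s'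
  | ifW_false {P Q : Prog} {u v : ℕ} {s s' : Store} {T : ℕ} :
      ¬ s.wreg u < s.wreg v → Runs b Q s T s' → Runs b (.ifW u v P Q) s (T + 1) s'
  | ifR_true {P Q : Prog} {u v : ℕ} {s s' : Store} {T : ℕ} :
      s.rreg u < s.rreg v → Runs b P s T s' → Runs b (.ifR u v P Q) s (T + 1) s'
  | ifR_false {P Q : Prog} {u v : ℕ} {s s' : Store} {T : ℕ} :
      ¬ s.rreg u < s.rreg v → Runs b Q s T s' → Runs b (.ifR u v P Q) s (T + 1) s'
  | while_done {P : Prog} {u v : ℕ} {s : Store} :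
      ¬ s.wreg u < s.wreg v → Runs b (.whileW u v P) s 1 s
  | while_step {P : Prog} {u v : ℕ} {s₁ s₂ s₃ : Store} {T₁ T₂ : ℕ} :
      s₁.wreg u < s₁.wreg v → Runs b P s₁ T₁ s₂ → Runs b (.whileW u v P) s₂ T₂ s₃ →
        Runs b (.whileW u v P) s₁ (T₁ + T₂ + 1) s₃

/-- The machine is deterministic: the start determines the number of steps and the result. -/
theorem Prog.Runs.det {b : ℕ} {P : Prog} {s s₁ s₂ : Store} {T₁ T₂ : ℕ}
    (h₁ : Prog.Runs b P s T₁ s₁) (h₂ : Prog.Runs b P s T₂ s₂) : T₁ = T₂ ∧ s₁ = s₂ := by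
  induction h₁ generalizing T₂ s₂ with
  | seq _ _ ih₁ ih₂ =>
    cases h₂ with
    | seq h h' =>
      obtain ⟨rfl, rfl⟩ := ih₁ h
      obtain ⟨rfl, rfl⟩ := ih₂ h'
      exact ⟨rfl, rfl⟩
  | ifW_true hc _ ih =>
    cases h₂ with
    | ifW_true _ h => obtain ⟨rfl, rfl⟩ := ih h; exact ⟨rfl, rfl⟩
    | ifW_false hn _ => exact absurd hc hn
  | ifW_false hc _ ih =>
    cases h₂ with
    | ifW_true hn _ => exact absurd hn hc
    | ifW_false _ h => obtain ⟨rfl, rfl⟩ := ih h; exact ⟨rfl, rfl⟩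
  | ifR_true hc _ ih =>
    cases h₂ with
    | ifR_true _ h => obtain ⟨rfl, rfl⟩ := ih h; exact ⟨rfl, rfl⟩
    | ifR_false hn _ => exact absurd hc hn
  | ifR_false hc _ ih =>
    cases h₂ with
    | ifR_true hn _ => exact absurd hn hc
    | ifR_false _ h => obtain ⟨rfl, rfl⟩ := ih h; exact ⟨rfl, rfl⟩
  | while_done hc =>
    cases h₂ with
    | while_done _ => exact ⟨rfl, rfl⟩
    | while_step hn _ _ => exact absurd hn hc
  | while_step hc _ _ ih₁ ih₂ =>
    cases h₂ with
    | while_done hn => exact absurd hc hn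
    | while_step _ h h' =>
      obtain ⟨rfl, rfl⟩ := ih₁ h
      obtain ⟨rfl, rfl⟩ := ih₂ h'
      exact ⟨rfl, rfl⟩
  | _ => cases h₂; exact ⟨rfl, rfl⟩

/-! ### Deterministic EMD/EMD recovery -/

/-- The `m × Δ²` matrix `A`, decoded by the program `P` with `b`-bit words and the stored list
`table`, is a deterministic EMD/EMD recovery scheme for sparsity `k` with approximation factor
`C`, in time at most `τ`: for every non-negative image `x`, given `A x`, the program halts within
`τ` steps and returns `x⋆` with `‖x - x⋆‖_EMD ≤ C ‖x - x'‖_EMD` for all `k`-sparse `x'`. -/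
def IsEMDRecoveryScheme {Δ m : ℕ} (A : Matrix (Fin m) (Pixel Δ) ℝ) (P : Prog) (b : ℕ)
    (table : List ℕ) (k : ℕ) (C τ : ℝ) : Prop :=
  ∀ x : Pixel Δ → ℝ, (∀ p, 0 ≤ x p) →
    ∃ (T : ℕ) (s : Store),
      Prog.Runs b P (Store.start (A.mulVec x) table) T s ∧ (T : ℝ) ≤ τ ∧
        ∀ x' : Pixel Δ → ℝ, IsSparse k x' →
          emdNorm (x - s.image Δ) ≤ C * emdNorm (x - x')

/-! Geometry. An image is determined by the masses of its dyadic cells: putting the mass of every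
cell at its corner and taking it away from the corner of its parent telescopes to the image
(`decode_mass`). An error in the mass of a cell thus costs at most twice the side of the cell in
`emdNorm` (`emdNorm_sub_decode_le`), and it suffices to recover, in ℓ₁ norm, the vector of masses
weighted by side lengths.

If `S` contains the support of `x'`, the distance to `S` is a 1-Lipschitz dual function and shows
`‖x - x'‖_EMD ≥ ∑ x p · d(p, S)` (`sum_mul_distTo_le_emdNorm`). Cells at distance at least `R` sides
from `S` carry weighted mass at most `2/R` times this sum, since the sides of the far cells over one
pixel form a geometric series (`sum_mass_compl_near_le`). So the weighted vector is nearly supported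
on the near cells. There are `K = O(k R² log(n/k))` of them, because the first `log₄ k` levels have
only `O(k)` cells in all. Taking `R` of order `1/ε` absorbs the constant of ℓ₁ recovery, and `O(K
log(N/K))` measurements in dimension `N = O(n)` give the stated bound.

Sparse recovery (`exists_sparse_recovery`). A union bound yields hash families that are almost
injective on all small sets (`exists_isExpanding`). In one round every coordinate of the residual is
estimated by the median of its buckets, and the `s a` largest estimates are subtracted. This halves
the head and multiplies the tail by at most `1 + 5/a` (`IsExpanding.round_step`). With `s = K/2^j`
and `a` of order `(j+1)²`, the product of these factors stays bounded, the measurements of all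
rounds sum to `O(K log(N/K))`, and after about `log₂ K` rounds the head is empty.

Computation. Medians and thresholds come from a sorting network, so decoding is a straight-line
computation whose `n polylog n` gates compare and subtract. The table lists the gates and one fixed
interpreter executes them (`Computes.exists_table`); the hash functions never have to be constructed
by the program. -/

/-! ### Odd-even merge sort on lattices -/

/-- Batcher's odd-even merge of the two halves of the first `2 ^ (k + 1)` entries. -/
def oddEvenMerge {α : Type*} [Lattice α] : ℕ → (ℕ → α) → ℕ → α
  | 0, a => fun i => if i = 0 then a 0 ⊓ a 1 else a 0 ⊔ a 1
  | k + 1, a => fun p =>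
      if p = 0 then oddEvenMerge k (fun i => a (2 * i)) 0
      else if p = 2 ^ (k + 2) - 1 then oddEvenMerge k (fun i => a (2 * i + 1)) (2 ^ (k + 1) - 1)
      else if p % 2 = 1 then
        oddEvenMerge k (fun i => a (2 * i + 1)) (p / 2) ⊓
          oddEvenMerge k (fun i => a (2 * i)) (p / 2 + 1)
      else
        oddEvenMerge k (fun i => a (2 * i + 1)) (p / 2 - 1) ⊔
          oddEvenMerge k (fun i => a (2 * i)) (p / 2)

/-- Odd-even merge sort of the first `2 ^ k` entries. -/
def oddEvenSort {α : Type*} [Lattice α] : ℕ → (ℕ → α) → ℕ → α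
  | 0, a => a
  | k + 1, a => oddEvenMerge k (fun i =>
      if i < 2 ^ k then oddEvenSort k a i else oddEvenSort k (fun j => a (2 ^ k + j)) (i - 2 ^ k))

/-- The network uses only `⊓` and `⊔`, so it commutes with lattice homomorphisms. This is the source
of the zero-one principle: correctness for truth values implies correctness for reals. -/
theorem map_oddEvenMerge {α β : Type*} [Lattice α] [Lattice β] (f : LatticeHom α β) (k : ℕ)
    (a : ℕ → α) (p : ℕ) : f (oddEvenMerge k a p) = oddEvenMerge k (fun i => f (a i)) p := by
  induction k generalizing a p with
  | zero => simp only [oddEvenMerge]; split_ifs <;> simp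
  | succ k ih => simp only [oddEvenMerge]; split_ifs <;> simp [ih]

theorem map_oddEvenSort {α β : Type*} [Lattice α] [Lattice β] (f : LatticeHom α β) (k : ℕ)
    (a : ℕ → α) (p : ℕ) : f (oddEvenSort k a p) = oddEvenSort k (fun i => f (a i)) p := by
  induction k generalizing a p with
  | zero => rfl
  | succ k ih =>
    simp only [oddEvenSort, map_oddEvenMerge]
    congr 1
    funext i
    split_ifs <;> simp [ih]

/-- Merging two sorted sequences of truth values. -/
theorem oddEvenMerge_bool (k : ℕ) (a : ℕ → Bool) (c d : ℕ) (hc : c ≤ 2 ^ k) (hd : d ≤ 2 ^ k)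
    (h₁ : ∀ i < 2 ^ k, a i = decide (c ≤ i)) (h₂ : ∀ i < 2 ^ k, a (2 ^ k + i) = decide (d ≤ i)) :
    ∀ p < 2 ^ (k + 1), oddEvenMerge k a p = decide (c + d ≤ p) := by
  induction k generalizing a c d with
  | zero =>
    intro p hp
    have e₁ := h₁ 0 (by norm_num)
    have e₂ := h₂ 0 (by norm_num)
    simp only [pow_zero, add_zero] at e₁ e₂
    simp only [oddEvenMerge, e₁, e₂]
    norm_num at hp hc hd
    interval_cases p <;> interval_cases c <;> interval_cases d <;> simp
  | succ k ih =>
    intro p hp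
    have hpow : 2 ^ (k + 1) = 2 * 2 ^ k := by ring
    have hpow2 : 2 ^ (k + 2) = 4 * 2 ^ k := by ring
    have hpos : 0 < 2 ^ k := by positivity
    -- Of `c` leading `false` entries, `⌈c/2⌉` have even and `⌊c/2⌋` odd index. The merged even and
    -- odd halves therefore differ by at most two in their number of `false` entries, which the last
    -- layer of comparisons repairs.
    have hE := ih (fun i => a (2 * i)) ((c + 1) / 2) ((d + 1) / 2) (by omega) (by omega)
      (fun i hi => by
        rw [h₁ _ (by omega)]; congr 1; simp only [eq_iff_iff]; omega)
      (fun i hi => by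
        rw [show 2 * (2 ^ k + i) = 2 ^ (k + 1) + 2 * i by ring, h₂ _ (by omega)]
        congr 1; simp only [eq_iff_iff]; omega)
    have hO := ih (fun i => a (2 * i + 1)) (c / 2) (d / 2) (by omega) (by omega)
      (fun i hi => by
        rw [h₁ _ (by omega)]; congr 1; simp only [eq_iff_iff]; omega)
      (fun i hi => by
        rw [show 2 * (2 ^ k + i) + 1 = 2 ^ (k + 1) + (2 * i + 1) by ring, h₂ _ (by omega)]
        congr 1; simp only [eq_iff_iff]; omega)
    rw [show k + 1 + 1 = k + 2 from rfl] at hp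
    have hinf : ∀ a b : Bool, a ⊓ b = (a && b) := by decide
    have hsup : ∀ a b : Bool, a ⊔ b = (a || b) := by decide
    simp only [oddEvenMerge]
    split_ifs with hp0 hp1 hp2
    · rw [hE _ (by omega)]; congr 1; simp only [eq_iff_iff]; omega
    · rw [hO _ (by omega)]; congr 1; simp only [eq_iff_iff]; omega
    · rw [hE _ (by omega), hO _ (by omega), hinf, ← Bool.decide_and]
      congr 1; simp only [eq_iff_iff]; omega
    · rw [hE _ (by omega), hO _ (by omega), hsup, ← Bool.decide_or]
      congr 1; simp only [eq_iff_iff]; omega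

/-- A sorted `Bool` sequence is determined by its number of `false` entries, so the induction only
tracks this count, which adds up under merging. -/
theorem oddEvenSort_bool (k : ℕ) (a : ℕ → Bool) :
    ∀ p < 2 ^ k, oddEvenSort k a p =
      decide (((Finset.range (2 ^ k)).filter fun i => a i = false).card ≤ p) := by
  induction k generalizing a with
  | zero =>
    intro p hp
    obtain rfl : p = 0 := by simpa using hp
    simp only [oddEvenSort, pow_zero, Finset.range_one, Finset.filter_singleton]
    cases h : a 0 <;> simp
  | succ k ih =>
    intro p hp
    simp only [oddEvenSort]
    have hcard : ∀ a : ℕ → Bool,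
        ((Finset.range (2 ^ k)).filter fun i => a i = false).card ≤ 2 ^ k := fun a =>
      (Finset.card_filter_le _ _).trans (by simp)
    rw [oddEvenMerge_bool k _ _ _ (hcard a) (hcard fun j => a (2 ^ k + j))
      (fun i hi => by simp only [hi, if_true]; exact ih a i hi)
      (fun i hi => by simpa using ih (fun j => a (2 ^ k + j)) i hi) p hp]
    congr 2
    rw [pow_succ, mul_two, Finset.range_add, Finset.filter_union, Finset.card_union_of_disjoint,
      Finset.filter_map, Finset.card_map]
    · rfl
    · refine Finset.disjoint_filter_filter ?_
      rw [Finset.disjoint_left]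
      intro i hi hi'
      simp only [Finset.mem_range, Finset.mem_map, addLeftEmbedding_apply] at hi hi'
      omega

/-- The order statistics of a family of real functions, computed pointwise by merge sort. -/
theorem lt_oddEvenSort_iff {X : Type*} (k : ℕ) (u : ℕ → X → ℝ) (x : X) (θ : ℝ) {p : ℕ}
    (hp : p < 2 ^ k) :
    θ < oddEvenSort k u p x ↔ ((Finset.range (2 ^ k)).filter fun i => u i x ≤ θ).card ≤ p := by
  -- The test `θ < φ x` respects `⊓` and `⊔`, which transfers the count of `false` entries to a
  -- count of values at most `θ`.
  let f : LatticeHom (X → ℝ) Bool :=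
    { toFun := fun φ => decide (θ < φ x)
      map_sup' := fun a b => by simp [Bool.decide_or]
      map_inf' := fun a b => by simp [Bool.decide_and] }
  have h := map_oddEvenSort f k u p
  rw [oddEvenSort_bool k _ p hp] at h
  have h' : decide (θ < oddEvenSort k u p x) = _ := h
  rw [decide_eq_decide] at h'
  rw [h']
  have : ∀ i, f (u i) = false ↔ u i x ≤ θ := fun i => by
    change decide _ = false ↔ _
    simp
  simp only [this]

/-! ### Straight-line computations -/

/-- A gate of a straight-line computation with real-valued intermediate results. -/
noncomputable def gateFun {X : Type*} (f g l h k : X → ℝ) : X → ℝ :=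
  fun x => if f x < g x then l x else h x - k x

/-- `Reach A T B`: starting from the functions in `A`, exactly `T` gates yield the set `B`. -/
inductive Reach {X : Type*} (A : Set (X → ℝ)) : ℕ → Set (X → ℝ) → Prop
  | refl : Reach A 0 A
  | gate {T : ℕ} {B : Set (X → ℝ)} {f g l h k : X → ℝ} : Reach A T B → f ∈ B → g ∈ B → l ∈ B →
      h ∈ B → k ∈ B → Reach A (T + 1) (insert (gateFun f g l h k) B)

/-- The functions in `B` can be computed from those in `A` by at most `T` gates. -/
def Computes {X : Type*} (A : Set (X → ℝ)) (T : ℕ) (B : Set (X → ℝ)) : Prop :=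
  ∃ T' ≤ T, ∃ C, Reach A T' C ∧ B ⊆ C

namespace Reach

variable {X : Type*} {A B C D : Set (X → ℝ)} {T T' : ℕ}

theorem subset (h : Reach A T B) : A ⊆ B := by
  induction h with
  | refl => exact subset_rfl
  | gate _ _ _ _ _ _ ih => exact ih.trans (Set.subset_insert _ _)

theorem mono (h : Reach A T B) (hA : A ⊆ D) : Reach D T (D ∪ B) := by
  induction h with
  | refl => rw [Set.union_eq_left.2 hA]; exact refl
  | gate _ h1 h2 h3 h4 h5 ih =>
    rw [Set.union_insert]
    exact ih.gate (Or.inr h1) (Or.inr h2) (Or.inr h3) (Or.inr h4) (Or.inr h5)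

theorem trans (h : Reach A T B) (h' : Reach B T' C) : Reach A (T + T') C := by
  induction h' with
  | refl => exact h
  | gate _ h1 h2 h3 h4 h5 ih => exact ih.gate h1 h2 h3 h4 h5

end Reach

namespace Computes

variable {X : Type*} {A B C D : Set (X → ℝ)} {T T' : ℕ}

theorem of_subset (h : B ⊆ A) : Computes A 0 B := ⟨0, le_rfl, A, .refl, h⟩

theorem mono_time (h : Computes A T B) (hT : T ≤ T') : Computes A T' B := by
  obtain ⟨S, hS, C, h, hB⟩ := h
  exact ⟨S, hS.trans hT, C, h, hB⟩

theorem mono_right (h : Computes A T B) (hC : C ⊆ B) : Computes A T C := by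
  obtain ⟨S, hS, D, h, hB⟩ := h
  exact ⟨S, hS, D, h, hC.trans hB⟩

theorem mono_left (h : Computes A T B) (hD : A ⊆ D) : Computes D T B := by
  obtain ⟨S, hS, C, h, hB⟩ := h
  exact ⟨S, hS, _, h.mono hD, hB.trans Set.subset_union_right⟩

theorem union_left (h : Computes A T B) : Computes A T (A ∪ B) := by
  obtain ⟨S, hS, C, h, hB⟩ := h
  exact ⟨S, hS, C, h, Set.union_subset h.subset hB⟩

/-- `Reach` sets only grow, so the second gate sequence still runs when started from everything the
first one has produced. -/
theorem trans (h : Computes A T B) (h' : Computes (A ∪ B) T' C) :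
    Computes A (T + T') (B ∪ C) := by
  obtain ⟨S, hS, D, h, hB⟩ := h
  obtain ⟨S', hS', D', h', hC⟩ := h'
  refine ⟨S + S', by omega, _, h.trans (h'.mono (Set.union_subset h.subset hB)), ?_⟩
  exact Set.union_subset (hB.trans Set.subset_union_left) (hC.trans Set.subset_union_right)

theorem union (h : Computes A T B) (h' : Computes A T' C) : Computes A (T + T') (B ∪ C) :=
  h.trans (h'.mono_left Set.subset_union_left)

theorem biUnion {ι : Type*} (s : Finset ι) {τ : ι → ℕ} {B : ι → Set (X → ℝ)}
    (h : ∀ i ∈ s, Computes A (τ i) (B i)) : Computes A (∑ i ∈ s, τ i) (⋃ i ∈ s, B i) := by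
  classical
  induction s using Finset.induction_on with
  | empty => simpa using of_subset (A := A) (Set.empty_subset A)
  | insert i s hi ih =>
    rw [Finset.sum_insert hi, Finset.set_biUnion_insert]
    exact (h i (Finset.mem_insert_self _ _)).union
      (ih fun j hj => h j (Finset.mem_insert_of_mem hj))

/-- Computing a finite family, one member after the other. -/
theorem family {ι : Type*} (s : Finset ι) {τ : ι → ℕ} {f : ι → X → ℝ}
    (h : ∀ i ∈ s, Computes A (τ i) {f i}) : Computes A (∑ i ∈ s, τ i) (f '' s) := by
  refine (biUnion s h).mono_right ?_
  rintro _ ⟨i, hi, rfl⟩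
  exact Set.mem_biUnion (Finset.mem_coe.1 hi) rfl

theorem gate {f g l h k : X → ℝ} (hf : f ∈ A) (hg : g ∈ A) (hl : l ∈ A) (hh : h ∈ A)
    (hk : k ∈ A) : Computes A 1 {gateFun f g l h k} :=
  ⟨1, le_rfl, _, Reach.refl.gate hf hg hl hh hk, by simp⟩

/-- A function is never smaller than itself, so the gate takes its second branch. -/
theorem sub {f g : X → ℝ} (hf : f ∈ A) (hg : g ∈ A) : Computes A 1 {f - g} := by
  convert gate hf hf hf hf hg using 2
  funext x; simp [gateFun]

theorem ite (h0 : (0 : X → ℝ) ∈ A) {f g l h : X → ℝ} (hf : f ∈ A) (hg : g ∈ A) (hl : l ∈ A)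
    (hh : h ∈ A) : Computes A 1 {fun x => if f x < g x then l x else h x} := by
  convert gate hf hg hl hh h0 using 2
  funext x; simp [gateFun]

theorem neg (h0 : (0 : X → ℝ) ∈ A) {f : X → ℝ} (hf : f ∈ A) : Computes A 1 {-f} := by
  simpa using sub h0 hf

theorem add (h0 : (0 : X → ℝ) ∈ A) {f g : X → ℝ} (hf : f ∈ A) (hg : g ∈ A) :
    Computes A 2 {f + g} := by
  refine ((neg h0 hg).trans (sub (f := f) (g := -g) (Or.inl hf) (Or.inr rfl))).mono_right ?_
  simp

theorem inf (h0 : (0 : X → ℝ) ∈ A) {f g : X → ℝ} (hf : f ∈ A) (hg : g ∈ A) :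
    Computes A 1 {f ⊓ g} := by
  convert ite h0 hf hg hf hg using 2
  funext x
  simp only [Pi.inf_apply]
  split_ifs with h
  · exact inf_eq_left.2 h.le
  · exact inf_eq_right.2 (not_lt.1 h)

theorem sup (h0 : (0 : X → ℝ) ∈ A) {f g : X → ℝ} (hf : f ∈ A) (hg : g ∈ A) :
    Computes A 1 {f ⊔ g} := by
  convert ite h0 hf hg hg hf using 2
  funext x
  simp only [Pi.sup_apply]
  split_ifs with h
  · exact sup_eq_right.2 h.le
  · exact sup_eq_left.2 (not_lt.1 h)

theorem abs (h0 : (0 : X → ℝ) ∈ A) {f : X → ℝ} (hf : f ∈ A) :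
    Computes A 2 {fun x => |f x|} := by
  refine ((neg h0 hf).trans (sup (f := f) (g := -f) (Or.inl h0) (Or.inl hf)
    (Or.inr rfl))).mono_right ?_
  rintro _ rfl
  right
  rfl

theorem sum (h0 : (0 : X → ℝ) ∈ A) {ι : Type*} (s : Finset ι) {f : ι → X → ℝ}
    (hf : ∀ i ∈ s, f i ∈ A) : Computes A (2 * s.card) {fun x => ∑ i ∈ s, f i x} := by
  classical
  induction s using Finset.induction_on with
  | empty => exact of_subset (by simpa [← Pi.zero_def] using h0)
  | insert i s hi ih =>
    rw [Finset.card_insert_of_notMem hi]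
    refine ((ih fun j hj => hf j (Finset.mem_insert_of_mem hj)).trans
      (add (Or.inl h0) (f := f i) (Or.inl (hf i (Finset.mem_insert_self _ _)))
        (Or.inr rfl))).mono_right ?_
    rintro _ rfl
    right
    rw [Set.mem_singleton_iff]
    funext x
    simp [Finset.sum_insert hi]

/-- Two merges of half the size and at most one gate per output: `2 (k+1) 2^(k+2) + 2^(k+2) ≤ (k+2)
2^(k+3)`. The minimum and the maximum of a comparator are separate gates. -/
theorem oddEvenMerge (h0 : (0 : X → ℝ) ∈ A) (k : ℕ) {u : ℕ → X → ℝ}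
    (hu : ∀ i < 2 ^ (k + 1), u i ∈ A) :
    Computes A ((k + 1) * 2 ^ (k + 2)) (oddEvenMerge k u '' Set.Iio (2 ^ (k + 1))) := by
  induction k generalizing u with
  | zero =>
    have h1 := hu 0 (by norm_num)
    have h2 := hu 1 (by norm_num)
    refine (((inf h0 h1 h2).union (sup h0 h1 h2)).mono_time (by norm_num)).mono_right ?_
    rintro _ ⟨i, -, rfl⟩
    by_cases hi : i = 0 <;> simp [_root_.oddEvenMerge, hi]
  | succ k ih =>
    have hpos : 0 < 2 ^ k := by positivity
    have e1 : 2 ^ (k + 1) = 2 * 2 ^ k := by ring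
    have e2 : 2 ^ (k + 1 + 1) = 4 * 2 ^ k := by ring
    have e3 : 2 ^ (k + 1 + 2) = 8 * 2 ^ k := by ring
    have e4 : 2 ^ (k + 2) = 4 * 2 ^ k := by ring
    have hE := ih (u := fun i => u (2 * i)) fun i hi => hu _ (by omega)
    have hO := ih (u := fun i => u (2 * i + 1)) fun i hi => hu _ (by omega)
    have hEO := hE.union hO
    set B := _root_.oddEvenMerge k (fun i => u (2 * i)) '' Set.Iio (2 ^ (k + 1)) ∪
      _root_.oddEvenMerge k (fun i => u (2 * i + 1)) '' Set.Iio (2 ^ (k + 1)) with hB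
    have hEm : ∀ i < 2 ^ (k + 1), _root_.oddEvenMerge k (fun i => u (2 * i)) i ∈ A ∪ B :=
      fun i hi => Or.inr (Or.inl ⟨i, hi, rfl⟩)
    have hOm : ∀ i < 2 ^ (k + 1), _root_.oddEvenMerge k (fun i => u (2 * i + 1)) i ∈ A ∪ B :=
      fun i hi => Or.inr (Or.inr ⟨i, hi, rfl⟩)
    have hF := family (A := A ∪ B) (Finset.range (2 ^ (k + 1 + 1))) (τ := fun _ => 1)
      (f := _root_.oddEvenMerge (k + 1) u) (fun p hp => by
        rw [Finset.mem_range] at hp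
        have h0' : (0 : X → ℝ) ∈ A ∪ B := Or.inl h0
        simp only [_root_.oddEvenMerge]
        split_ifs with hp0 hp1 hp2
        · exact (of_subset (by simpa using hEm 0 (by omega))).mono_time (by norm_num)
        · exact (of_subset (by simpa using hOm _ (by omega))).mono_time (by norm_num)
        · exact inf h0' (hOm _ (by omega)) (hEm _ (by omega))
        · exact sup h0' (hOm _ (by omega)) (hEm _ (by omega)))
    refine ((hEO.trans hF).mono_time ?_).mono_right ?_
    · simp only [Finset.sum_const, Finset.card_range, smul_eq_mul]
      rw [e2, e3]
      nlinarith
    · rintro _ ⟨p, hp, rfl⟩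
      exact Or.inr ⟨p, by simpa using hp, rfl⟩

/-- The bound solves the recursion with room: `2 k² 2^(k+1) + (k+1) 2^(k+2) ≤ (k+1)² 2^(k+2)`. -/
theorem oddEvenSort (h0 : (0 : X → ℝ) ∈ A) (k : ℕ) {u : ℕ → X → ℝ}
    (hu : ∀ i < 2 ^ k, u i ∈ A) :
    Computes A (k ^ 2 * 2 ^ (k + 1)) (oddEvenSort k u '' Set.Iio (2 ^ k)) := by
  induction k generalizing u with
  | zero =>
    refine (of_subset ?_).mono_time (Nat.zero_le _)
    rintro _ ⟨p, hp, rfl⟩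
    exact hu p hp
  | succ k ih =>
    have e1 : 2 ^ (k + 1) = 2 * 2 ^ k := by ring
    have hE := ih (u := u) fun i hi => hu _ (by omega)
    have hO := ih (u := fun i => u (2 ^ k + i)) fun i hi => hu _ (by omega)
    have hEO := hE.union hO
    refine ((hEO.trans (oddEvenMerge (Or.inl h0) k (u := fun i =>
      if i < 2 ^ k then _root_.oddEvenSort k u i
      else _root_.oddEvenSort k (fun j => u (2 ^ k + j)) (i - 2 ^ k)) ?_)).mono_time ?_).mono_right
      Set.subset_union_right
    · intro i hi
      split_ifs with h
      · exact Or.inr (Or.inl ⟨i, h, rfl⟩)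
      · exact Or.inr (Or.inr ⟨i - 2 ^ k, Set.mem_Iio.2 (by omega), rfl⟩)
    · have : 2 ^ (k + 1 + 1) = 4 * 2 ^ k := by ring
      rw [this, e1]
      nlinarith [Nat.zero_le (k * 2 ^ k)]

end Computes

/-! ### A fixed program that evaluates stored straight-line computations -/

/-- An instruction: five operand addresses and an output address. -/
structure Instr where
  /-- left side of the comparison -/
  f : ℕ
  /-- right side of the comparison -/
  g : ℕ
  /-- value if the comparison succeeds -/
  l : ℕ
  /-- minuend if the comparison fails -/
  h : ℕ
  /-- subtrahend if the comparison fails -/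
  k : ℕ
  /-- position in the output array -/
  o : ℕ

namespace Instr

/-- The value computed by an instruction. -/
noncomputable def val (I : Instr) (μ : ℕ → ℝ) : ℝ :=
  if μ I.f < μ I.g then μ I.l else μ I.h - μ I.k

/-- The words that encode an instruction. -/
def words (I : Instr) : List ℕ := [I.f, I.g, I.l, I.h, I.k, I.o]

/-- The effect of a list of instructions on the memory, written from the address `p` on. -/
noncomputable def exec : List Instr → ℕ → (ℕ → ℝ) → ℕ → ℝ
  | [], _, μ => μ
  | I :: c, p, μ => exec c (p + 1) (Function.update μ p (I.val μ))

/-- The effect of a list of instructions on the output array. -/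
noncomputable def out : List Instr → ℕ → (ℕ → ℝ) → (ℕ → ℝ) → ℕ → ℝ
  | [], _, _, ν => ν
  | I :: c, p, μ, ν => out c (p + 1) (Function.update μ p (I.val μ)) (Function.update ν I.o (I.val μ))

end Instr

namespace Prog

/-- Read the next operand from memory. -/
def fetch (r : ℕ) : Prog := .seq (.wload 4 0 0) (.seq (.wop .add 0 0 3) (.rload r 0 4))

/-- Execute the next instruction. -/
def interpBody : Prog :=
  .seq (fetch 1) (.seq (fetch 2) (.seq (fetch 3) (.seq (fetch 4) (.seq (fetch 5)
    (.seq (.wload 5 0 0) (.seq (.wop .add 0 0 3)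
      -- Real register 7 is never written and stays zero, so the addition copies register 3.
      (.seq (.ifR 1 2 (.rop .add 6 3 7) (.rop .sub 6 4 5))
        (.seq (.rstore 0 1 6) (.seq (.rstore 1 5 6) (.wop .add 1 1 3))))))))))

/-- The interpreter: the table holds the first and the last address to be written, followed by
the instructions. -/
def interp : Prog :=
  .seq (.wconst 3 1) (.seq (.wload 1 0 0) (.seq (.wop .add 0 0 3) (.seq (.wload 2 0 0)
    (.seq (.wop .add 0 0 3) (.whileW 1 2 interpBody)))))

theorem runs_fetch {b : ℕ} (r : ℕ) {s : Store} {a : ℕ} (h3 : s.wreg 3 = 1)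
    (hb : s.wreg 0 + 1 < 2 ^ b) (ha : s.warr 0 (s.wreg 0) = a) :
    ∃ s', Runs b (fetch r) s 3 s' ∧ s'.wreg 0 = s.wreg 0 + 1 ∧
      (∀ i, i ≠ 0 → i ≠ 4 → s'.wreg i = s.wreg i) ∧ s'.rreg r = s.rarr 0 a ∧
      (∀ i, i ≠ r → s'.rreg i = s.rreg i) ∧ s'.warr = s.warr ∧ s'.rarr = s.rarr := by
  refine ⟨_, Runs.seq (T₂ := 2) (Runs.wload (b := b) s 4 0 0)
    (Runs.seq (Runs.wop _ .add 0 0 3) (Runs.rload _ r 0 4)), ?_, ?_, ?_, ?_, rfl, rfl⟩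
  · simp [Store.setW, Store.setR, WordOp.eval, h3, Nat.mod_eq_of_lt hb]
  · intro i h0 h4
    simp [Store.setW, Store.setR, h0, h4]
  · simp [Store.setW, Store.setR, ha]
  · intro i hi
    simp [Store.setW, Store.setR, hi]

/-- Word registers: 0 points into the table, 1 is the next memory address to be written, 2 the last
such address (exclusive), 3 the constant one, 4 and 5 an operand and an output address. Real
registers 1 to 5 hold the operands, 6 the result, 7 zero. The 22 steps are five fetches of 3 steps
and 7 further ones. -/
theorem runs_interpBody {b : ℕ} {s : Store} {I : Instr} (h3 : s.wreg 3 = 1) (h7 : s.rreg 7 = 0)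
    (hb : s.wreg 0 + 6 < 2 ^ b) (hb1 : s.wreg 1 + 1 < 2 ^ b)
    (hI : ∀ i < 6, s.warr 0 (s.wreg 0 + i) = I.words.getD i 0) :
    ∃ s', Runs b interpBody s 22 s' ∧ s'.wreg 0 = s.wreg 0 + 6 ∧ s'.wreg 1 = s.wreg 1 + 1 ∧
      s'.wreg 2 = s.wreg 2 ∧ s'.wreg 3 = 1 ∧ s'.rreg 7 = 0 ∧ s'.warr = s.warr ∧
      s'.rarr 0 = Function.update (s.rarr 0) (s.wreg 1) (I.val (s.rarr 0)) ∧
      s'.rarr 1 = Function.update (s.rarr 1) I.o (I.val (s.rarr 0)) := by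
  have i0 := hI 0 (by norm_num)
  have i1 := hI 1 (by norm_num)
  have i2 := hI 2 (by norm_num)
  have i3 := hI 3 (by norm_num)
  have i4 := hI 4 (by norm_num)
  have i5 := hI 5 (by norm_num)
  simp only [Instr.words, List.getD_cons_zero, List.getD_cons_succ, add_zero] at i0 i1 i2 i3 i4 i5
  obtain ⟨s₁, r₁, p₁, w₁, v₁, q₁, a₁, b₁⟩ := runs_fetch (b := b) 1 h3 (by omega) i0
  obtain ⟨s₂, r₂, p₂, w₂, v₂, q₂, a₂, b₂⟩ := runs_fetch (b := b) (s := s₁) (a := I.g) 2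
    (by rw [w₁ 3 (by norm_num) (by norm_num), h3]) (by omega) (by rw [a₁, p₁, ← i1])
  rw [p₁] at p₂
  rw [b₁] at v₂ b₂
  rw [a₁] at a₂
  obtain ⟨s₃, r₃, p₃, w₃, v₃, q₃, a₃, b₃⟩ := runs_fetch (b := b) (s := s₂) (a := I.l) 3
    (by rw [w₂ 3 (by norm_num) (by norm_num), w₁ 3 (by norm_num) (by norm_num), h3]) (by omega)
    (by rw [a₂, p₂, ← i2])
  rw [p₂] at p₃
  rw [b₂] at v₃ b₃
  rw [a₂] at a₃
  obtain ⟨s₄, r₄, p₄, w₄, v₄, q₄, a₄, b₄⟩ := runs_fetch (b := b) (s := s₃) (a := I.h) 4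
    (by rw [w₃ 3 (by norm_num) (by norm_num), w₂ 3 (by norm_num) (by norm_num),
      w₁ 3 (by norm_num) (by norm_num), h3]) (by omega) (by rw [a₃, p₃, ← i3])
  rw [p₃] at p₄
  rw [b₃] at v₄ b₄
  rw [a₃] at a₄
  obtain ⟨s₅, r₅, p₅, w₅, v₅, q₅, a₅, b₅⟩ := runs_fetch (b := b) (s := s₄) (a := I.k) 5
    (by rw [w₄ 3 (by norm_num) (by norm_num), w₃ 3 (by norm_num) (by norm_num),
      w₂ 3 (by norm_num) (by norm_num), w₁ 3 (by norm_num) (by norm_num), h3]) (by omega)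
    (by rw [a₄, p₄, ← i4])
  rw [p₄] at p₅
  rw [b₄] at v₅ b₅
  rw [a₄] at a₅
  have hw : ∀ i, i ≠ 0 → i ≠ 4 → s₅.wreg i = s.wreg i := fun i h0 h4 => by
    rw [w₅ i h0 h4, w₄ i h0 h4, w₃ i h0 h4, w₂ i h0 h4, w₁ i h0 h4]
  have g1 : s₅.rreg 1 = s.rarr 0 I.f := by
    rw [q₅ 1 (by norm_num), q₄ 1 (by norm_num), q₃ 1 (by norm_num), q₂ 1 (by norm_num), v₁]
  have g2 : s₅.rreg 2 = s.rarr 0 I.g := by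
    rw [q₅ 2 (by norm_num), q₄ 2 (by norm_num), q₃ 2 (by norm_num), v₂]
  have g3 : s₅.rreg 3 = s.rarr 0 I.l := by rw [q₅ 3 (by norm_num), q₄ 3 (by norm_num), v₃]
  have g4 : s₅.rreg 4 = s.rarr 0 I.h := by rw [q₅ 4 (by norm_num), v₄]
  have g7 : s₅.rreg 7 = 0 := by
    rw [q₅ 7 (by norm_num), q₄ 7 (by norm_num), q₃ 7 (by norm_num), q₂ 7 (by norm_num),
      q₁ 7 (by norm_num), h7]
  have t1 := hw 1 (by norm_num) (by norm_num)
  have t2 := hw 2 (by norm_num) (by norm_num)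
  have t3 := (hw 3 (by norm_num) (by norm_num)).trans h3
  have m1 : (s.wreg 0 + 1 + 1 + 1 + 1 + 1 + 1) % 2 ^ b = s.wreg 0 + 6 :=
    Nat.mod_eq_of_lt (by omega)
  have m2 : (s.wreg 1 + 1) % 2 ^ b = s.wreg 1 + 1 := Nat.mod_eq_of_lt (by omega)
  let s₆ := (s₅.setW 5 (s₅.warr 0 (s₅.wreg 0)))
  let s₇ := s₆.setW 0 (WordOp.eval b .add (s₆.wreg 0) (s₆.wreg 3))
  have hif : Runs b (.ifR 1 2 (.rop .add 6 3 7) (.rop .sub 6 4 5)) s₇ 2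
      (s₇.setR 6 (I.val (s.rarr 0))) := by
    by_cases hlt : s.rarr 0 I.f < s.rarr 0 I.g
    · convert Runs.ifR_true (b := b) (s := s₇) (u := 1) (v := 2) (Q := .rop .sub 6 4 5) ?_
        (.rop s₇ .add 6 3 7) using 1
      · simp [Instr.val, hlt, s₇, s₆, Store.setW, RealOp.eval, g3, g7]
      · simpa [s₇, s₆, Store.setW, g1, g2] using hlt
    · convert Runs.ifR_false (b := b) (s := s₇) (u := 1) (v := 2) (P := .rop .add 6 3 7) ?_
        (.rop s₇ .sub 6 4 5) using 1
      · simp [Instr.val, hlt, s₇, s₆, Store.setW, RealOp.eval, g4, v₅]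
      · simpa [s₇, s₆, Store.setW, g1, g2] using hlt
  have i5' : s.warr 0 (s.wreg 0 + 1 + 1 + 1 + 1 + 1) = I.o := i5
  refine ⟨_, .seq (T₂ := 19) r₁ (.seq (T₂ := 16) r₂ (.seq (T₂ := 13) r₃ (.seq (T₂ := 10) r₄
    (.seq (T₂ := 7) r₅ (.seq (T₂ := 6) (.wload _ _ _ _) (.seq (T₂ := 5) (.wop _ _ _ _ _)
    (.seq (T₂ := 3) hif (.seq (T₂ := 2) (.rstore _ _ _ _) (.seq (.rstore _ _ _ _)
    (.wop _ _ _ _ _)))))))))), ?_⟩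
  simp [s₇, s₆, Store.setW, Store.setR, Store.setRArr, WordOp.eval, p₅, t1, t2, t3, m1, m2, g7,
    a₅, b₅, i5']

/-- The words of a list of instructions are found at the expected places. -/
theorem getD_flatMap_words (c : List Instr) (I : Instr) (c' : List Instr) (i : ℕ) (hi : i < 6)
    (u v : ℕ) :
    (u :: v :: (c ++ I :: c').flatMap Instr.words).getD (2 + 6 * c.length + i) 0 =
      I.words.getD i 0 := by
  have hl : (c.flatMap Instr.words).length = 6 * c.length := by
    induction c with
    | nil => rfl
    | cons J c ih => simp [Instr.words, ih]; ring
  rw [show 2 + 6 * c.length + i = (6 * c.length + i) + 1 + 1 by ring, List.getD_cons_succ,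
    List.getD_cons_succ, List.flatMap_append, List.getD_append_right _ _ _ _ (by omega), hl,
    Nat.add_sub_cancel_left, List.flatMap_cons, List.getD_append]
  simpa [Instr.words] using hi

/-- Loop invariant once `c₁` has been executed: the table pointer has passed two header words and
six words per instruction, the write address has advanced by one per instruction. A pass costs 22
steps and one test. -/
theorem runs_interp_loop {b p e : ℕ} (code : List Instr) (hb : 2 + 6 * code.length < 2 ^ b)
    (he : e = p + code.length) (hbe : e < 2 ^ b) (c₂ : List Instr) :
    ∀ (c₁ : List Instr) (s : Store), code = c₁ ++ c₂ → s.wreg 0 = 2 + 6 * c₁.length →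
      s.wreg 1 = p + c₁.length → s.wreg 2 = e → s.wreg 3 = 1 → s.rreg 7 = 0 →
      s.warr 0 = (fun i => (p :: e :: code.flatMap Instr.words).getD i 0) →
      ∃ s', Runs b (.whileW 1 2 interpBody) s (23 * c₂.length + 1) s' ∧
        s'.rarr 1 = Instr.out c₂ (p + c₁.length) (s.rarr 0) (s.rarr 1) := by
  induction c₂ with
  | nil =>
    intro c₁ s hc h0 h1 h2 h3 h7 hw
    have hd : ¬ s.wreg 1 < s.wreg 2 := by rw [h1, h2, he, hc]; simp
    exact ⟨s, by simpa using Runs.while_done hd, rfl⟩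
  | cons I c ih =>
    intro c₁ s hc h0 h1 h2 h3 h7 hw
    have hlen : code.length = c₁.length + c.length + 1 := by rw [hc]; simp; ring
    obtain ⟨s', hr, k0, k1, k2, k3, k7, kw, ka, kb⟩ := runs_interpBody (b := b) (I := I) h3 h7
      (by omega) (by omega) (fun i hi => by
        rw [hw, h0, hc]; exact getD_flatMap_words _ _ _ _ hi _ _)
    obtain ⟨s'', hr', hout⟩ := ih (c₁ ++ [I]) s' (by simp [hc]) (by rw [k0, h0]; simp; ring)
      (by rw [k1, h1]; simp; ring) (k2.trans h2) k3 k7 (by rw [kw, hw])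
    refine ⟨s'', ?_, ?_⟩
    · have := Runs.while_step (by rw [h1, h2]; omega) hr hr'
      convert this using 1
      simp; ring
    · rw [hout, ka, kb, h1]
      simp [Instr.out, add_assoc]

/-- The overhead of 6 steps consists of five initial ones, which load the constant and the header,
and the final failing loop test. -/
theorem runs_interp {b m p : ℕ} (y : Fin m → ℝ) (code : List Instr)
    (hb : 2 + 6 * code.length < 2 ^ b) (hbe : p + code.length < 2 ^ b) :
    ∃ s', Runs b interp (Store.start y (p :: (p + code.length) :: code.flatMap Instr.words))
        (23 * code.length + 6) s' ∧
      s'.rarr 1 = Instr.out code p (fun i => if h : i < m then y ⟨i, h⟩ else 0) 0 := by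
  have hb2 : 2 < 2 ^ b := by omega
  have e1 : 1 % 2 ^ b = 1 := Nat.mod_eq_of_lt (by omega)
  have e2 : 2 % 2 ^ b = 2 := Nat.mod_eq_of_lt (by omega)
  set s := Store.start y (p :: (p + code.length) :: code.flatMap Instr.words) with hs
  let s₁ : Store :=
    { wreg := fun i => if i = 0 then 2 else if i = 1 then p else if i = 2 then p + code.length
        else if i = 3 then 1 else 0
      rreg := s.rreg, warr := s.warr, rarr := s.rarr }
  obtain ⟨s', hr, ho⟩ := runs_interp_loop (p := p) code hb rfl hbe code [] s₁ rfl rfl rfl rfl rfl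
    rfl (by simp [s₁, hs, Store.start])
  refine ⟨s', ?_, ?_⟩
  · have key := Runs.seq (Runs.wconst (b := b) s 3 1) (Runs.seq (Runs.wload _ 1 0 0)
      (Runs.seq (Runs.wop _ .add 0 0 3) (Runs.seq (Runs.wload _ 2 0 0)
        (Runs.seq (Runs.wop _ .add 0 0 3) (s₃ := s') (P := .wop .add 0 0 3)
          (Q := .whileW 1 2 interpBody) (T₂ := 23 * code.length + 1) ?_))))
    · rw [interp, show 23 * code.length + 6 = 1 + (1 + (1 + (1 + (1 + (23 * code.length + 1)))))
        by ring]
      exact key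
    · convert hr using 1
      simp only [Store.setW, s₁, hs, Store.start, WordOp.eval]
      congr 1
      funext i
      by_cases i0 : i = 0
      · subst i0; simp [e1, e2]
      by_cases i1 : i = 1
      · subst i1; simp
      by_cases i2 : i = 2
      · subst i2; simp [e1]
      by_cases i3 : i = 3
      · subst i3; simp [e1]
      simp [i0, i1, i2, i3]
  · rw [ho]
    simp [s₁, hs, Store.start]
    rfl

end Prog

/-! ### Encoding straight-line computations as instruction lists -/

namespace Instr

theorem exec_append (c c' : List Instr) (p : ℕ) (μ : ℕ → ℝ) :
    exec (c ++ c') p μ = exec c' (p + c.length) (exec c p μ) := by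
  induction c generalizing p μ with
  | nil => rfl
  | cons I c ih => simp only [List.cons_append, exec, ih, List.length_cons]; congr 1; ring

theorem out_append (c c' : List Instr) (p : ℕ) (μ ν : ℕ → ℝ) :
    out (c ++ c') p μ ν = out c' (p + c.length) (exec c p μ) (out c p μ ν) := by
  induction c generalizing p μ ν with
  | nil => rfl
  | cons I c ih => simp only [List.cons_append, exec, out, ih, List.length_cons]; congr 1; ring

/-- Only fresh consecutive addresses are written, so inputs and earlier results are never lost. -/
theorem exec_of_lt (c : List Instr) {p a : ℕ} (μ : ℕ → ℝ) (h : a < p) : exec c p μ a = μ a := by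
  induction c generalizing p μ with
  | nil => rfl
  | cons I c ih => rw [exec, ih _ (by omega), Function.update_of_ne (by omega)]

/-- The instructions that copy the memory at the addresses `addr j`, `j < n`, to the output. -/
def copy (z : ℕ) (addr : ℕ → ℕ) (n : ℕ) : List Instr :=
  (List.range n).map fun j => ⟨z, z, z, addr j, z, j⟩

/-- The comparison of the zero cell with itself fails, so a copy instruction yields `μ (addr j) -
0`. -/
theorem out_copy {z p : ℕ} (addr : ℕ → ℕ) (n : ℕ) (μ ν : ℕ → ℝ) (hz : z < p) (hμ : μ z = 0)
    (ha : ∀ j < n, addr j < p) : ∀ j < n, out (copy z addr n) p μ ν j = μ (addr j) := by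
  induction n with
  | zero => intro j hj; omega
  | succ n ih =>
    intro j hj
    rw [copy, List.range_succ, List.map_append, out_append, List.map_singleton, out, out]
    by_cases hjn : j = n
    · subst hjn
      rw [Function.update_self]
      simp [val, exec_of_lt _ _ hz, exec_of_lt _ _ (ha j hj), hμ]
    · rw [Function.update_of_ne hjn]
      exact ih (fun j hj => ha j (by omega)) j (by omega)

end Instr

/-- The initial memory of a straight-line computation. -/
noncomputable def inputMem {X : Type*} {m : ℕ} (b : Fin m → X → ℝ) (x : X) : ℕ → ℝ :=
  fun i => if h : i < m then b ⟨i, h⟩ x else 0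

/-- Straight-line computations can be encoded by lists of instructions. -/
theorem Reach.exists_code {X : Type*} {m : ℕ} (b : Fin m → X → ℝ) (o : ℕ) {T : ℕ}
    {B : Set (X → ℝ)} (h : Reach (insert 0 (Set.range b)) T B) :
    ∃ c : List Instr, c.length = T ∧
      (∀ I ∈ c, ∀ w ∈ I.words, w < m + 1 + T + o) ∧
      ∀ f ∈ B, ∃ a < m + 1 + T, ∀ x, Instr.exec c (m + 1) (inputMem b x) a = f x := by
  induction h with
  | refl =>
    refine ⟨[], rfl, by simp, ?_⟩
    rintro f (rfl | ⟨i, rfl⟩)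
    -- The address `m` behind the inputs holds zero and is never written, as writing starts at `m +
    -- 1`.
    · exact ⟨m, by omega, fun x => by simp [Instr.exec, inputMem]⟩
    · exact ⟨i, by omega, fun x => by simp [Instr.exec, inputMem]⟩
  | @gate T B f g l h k _ hf hg hl hh hk ih =>
    obtain ⟨c, hc, hw, ha⟩ := ih
    obtain ⟨af, haf, ef⟩ := ha f hf
    obtain ⟨ag, hag, eg⟩ := ha g hg
    obtain ⟨al, hal, el⟩ := ha l hl
    obtain ⟨ah, hah, eh⟩ := ha h hh
    obtain ⟨ak, hak, ek⟩ := ha k hk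
    refine ⟨c ++ [⟨af, ag, al, ah, ak, o⟩], by simp [hc], ?_, ?_⟩
    · intro I hI w hwI
      rcases List.mem_append.1 hI with hI | hI
      · have := hw I hI w hwI; omega
      · obtain rfl := List.mem_singleton.1 hI
        simp only [Instr.words, List.mem_cons, List.not_mem_nil, or_false] at hwI
        omega
    · have key : ∀ x, Instr.exec (c ++ [⟨af, ag, al, ah, ak, o⟩]) (m + 1) (inputMem b x) =
          Function.update (Instr.exec c (m + 1) (inputMem b x)) (m + 1 + T)
            (gateFun f g l h k x) := fun x => by
        rw [Instr.exec_append, hc, Instr.exec, Instr.exec]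
        simp [Instr.val, ef, eg, el, eh, ek, gateFun]
      rintro φ (rfl | hφ)
      · exact ⟨m + 1 + T, by omega, fun x => by rw [key, Function.update_self]⟩
      · obtain ⟨a, ha, e⟩ := ha φ hφ
        exact ⟨a, by omega, fun x => by rw [key, Function.update_of_ne (by omega), e]⟩

/-- Every straight-line computation is carried out by the interpreter, given a suitable table. -/
theorem Computes.exists_table {X : Type*} {m n T w : ℕ} {b : Fin m → X → ℝ} {F : ℕ → X → ℝ}
    (h : Computes (insert 0 (Set.range b)) T (F '' Set.Iio n))
    (hw : m + 6 * (T + n) + 2 < 2 ^ w) :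
    ∃ table : List ℕ, table.length ≤ 6 * (T + n) + 2 ∧ (∀ a ∈ table, a < 2 ^ w) ∧
      ∀ x, ∃ (S : ℕ) (s : Store), S ≤ 23 * (T + n) + 6 ∧
        Prog.Runs w Prog.interp (Store.start (fun i => b i x) table) S s ∧
          ∀ i < n, s.rarr 1 i = F i x := by
  obtain ⟨S, hS, C, hr, hC⟩ := h
  -- Every gate also writes to the output array; the dummy position `n` lies outside the part that
  -- is read off.
  obtain ⟨c, hc, hcw, ha⟩ := hr.exists_code b n
  have ha' : ∀ j, ∃ a, j < n → a < m + 1 + S ∧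
      ∀ x, Instr.exec c (m + 1) (inputMem b x) a = F j x := fun j => by
    by_cases hj : j < n
    · obtain ⟨a, h1, h2⟩ := ha (F j) (hC ⟨j, hj, rfl⟩)
      exact ⟨a, fun _ => ⟨h1, h2⟩⟩
    · exact ⟨0, fun h => absurd h hj⟩
  choose addr haddr using ha'
  set code := c ++ Instr.copy m addr n with hcode
  have hlen : code.length = S + n := by simp [hcode, hc, Instr.copy]
  refine ⟨(m + 1) :: (m + 1 + code.length) :: code.flatMap Instr.words, ?_, ?_, ?_⟩
  · have : (code.flatMap Instr.words).length = 6 * code.length := by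
      induction code with
      | nil => rfl
      | cons J c ih => simp [Instr.words]; ring
    simp only [List.length_cons, this, hlen]
    omega
  · intro a hmem
    simp only [List.mem_cons, List.mem_flatMap, hlen] at hmem
    rcases hmem with rfl | rfl | ⟨I, hI, hmem⟩
    · omega
    · omega
    · rw [hcode, List.mem_append] at hI
      rcases hI with hI | hI
      · have := hcw I hI a hmem; omega
      · simp only [Instr.copy, List.mem_map, List.mem_range] at hI
        obtain ⟨j, hj, rfl⟩ := hI
        have := (haddr j hj).1
        simp only [Instr.words, List.mem_cons, List.not_mem_nil, or_false] at hmem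
        omega
  · intro x
    obtain ⟨s, hs, ho⟩ := Prog.runs_interp (b := w) (p := m + 1) (fun i => b i x) code
      (by omega) (by omega)
    refine ⟨_, s, by omega, hs, fun i hi => ?_⟩
    have h0 : Instr.exec c (m + 1) (inputMem b x) m = 0 := by
      rw [Instr.exec_of_lt _ _ (by omega)]
      simp [inputMem]
    rw [ho, hcode, Instr.out_append]
    exact (Instr.out_copy addr n _ _ (by omega) h0
      (fun j hj => by have := (haddr j hj).1; omega) i hi).trans ((haddr i hi).2 x)

/-! ### Expanding hash families -/

open Finset in
/-- In a finite family, the members that share their value with another one are few if there are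
many values. -/
theorem card_filter_collide_le {α β : Type*} [DecidableEq α] [DecidableEq β] (E : Finset α)
    (f : α → β) :
    #{e ∈ E | ∃ e' ∈ E, e' ≠ e ∧ f e' = f e} + 2 * #(E.image f) ≤ 2 * #E := by
  have h1 : #E = ∑ b ∈ E.image f, #{e ∈ E | f e = b} := card_eq_sum_card_image f E
  have h2 : #{e ∈ E | ∃ e' ∈ E, e' ≠ e ∧ f e' = f e} =
      ∑ b ∈ E.image f, #{e ∈ {e ∈ E | ∃ e' ∈ E, e' ≠ e ∧ f e' = f e} | f e = b} :=
    card_eq_sum_card_fiberwise fun e he => mem_image_of_mem _ (mem_filter.1 he).1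
  have h3 : #(E.image f) = ∑ b ∈ E.image f, 1 := by simp
  rw [h1, h2, h3, mul_sum, mul_sum, ← sum_add_distrib]
  -- A fibre of size 1 contributes `0 + 2`, a fibre of size `s ≥ 2` at most `s + 2 ≤ 2 s`.
  refine sum_le_sum fun b hb => ?_
  have hle : #{e ∈ {e ∈ E | ∃ e' ∈ E, e' ≠ e ∧ f e' = f e} | f e = b} ≤ #{e ∈ E | f e = b} :=
    card_le_card fun e he => by simp only [mem_filter] at he ⊢; exact ⟨he.1.1, he.2⟩
  obtain ⟨e₀, he₀, rfl⟩ := mem_image.1 hb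
  have hpos : 0 < #{e ∈ E | f e = f e₀} := card_pos.2 ⟨e₀, mem_filter.2 ⟨he₀, rfl⟩⟩
  by_cases hone : #{e ∈ E | f e = f e₀} = 1
  · obtain ⟨a, ha⟩ := card_eq_one.1 hone
    have hempty : #{e ∈ {e ∈ E | ∃ e' ∈ E, e' ≠ e ∧ f e' = f e} | f e = f e₀} = 0 := by
      rw [card_eq_zero, eq_empty_iff_forall_notMem]
      intro e he
      simp only [mem_filter] at he
      obtain ⟨⟨heE, e', he'E, hne, hfe⟩, he⟩ := he
      have m1 : e ∈ ({a} : Finset α) := ha ▸ mem_filter.2 ⟨heE, he⟩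
      have m2 : e' ∈ ({a} : Finset α) := ha ▸ mem_filter.2 ⟨he'E, hfe.trans he⟩
      rw [mem_singleton] at m1 m2
      exact hne (m2.trans m1.symm)
    omega
  · omega

section Expander

open Finset

variable {V β : Type*} [DecidableEq β] {d : ℕ}

/-- The buckets that meet the set `Q`. -/
def nbr (h : Fin d → V → β) (Q : Finset V) : Finset (Fin d × β) :=
  (univ ×ˢ Q).image fun e => (e.1, h e.1 e.2)

/-- Sets of size at most `q` lose at most `g` buckets per element. -/
def IsExpanding (h : Fin d → V → β) (g q : ℕ) : Prop :=
  ∀ Q : Finset V, #Q ≤ q → d * #Q ≤ #(nbr h Q) + g * #Q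

theorem mem_nbr {h : Fin d → V → β} {Q : Finset V} {e : Fin d × β} :
    e ∈ nbr h Q ↔ ∃ v ∈ Q, h e.1 v = e.2 := by
  obtain ⟨l, b⟩ := e
  simp only [nbr, mem_image, mem_product, mem_univ, true_and, Prod.mk.injEq, Prod.exists]
  constructor
  · rintro ⟨l', v, hv, rfl, rfl⟩; exact ⟨v, hv, rfl⟩
  · rintro ⟨v, hv, rfl⟩; exact ⟨l, v, hv, rfl, rfl⟩

theorem card_nbr_le (h : Fin d → V → β) (Q : Finset V) : #(nbr h Q) ≤ d * #Q := by
  refine card_image_le.trans ?_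
  simp

/-- Every set extends to one of at most twice its size that shares few buckets with any element
outside. -/
theorem IsExpanding.exists_closure [Fintype V] {h : Fin d → V → β} {g q : ℕ} (hexp : IsExpanding h g q)
    (hg : 0 < g) (Q : Finset V) (hQ : 2 * #Q + 1 ≤ q) :
    ∃ Q', Q ⊆ Q' ∧ #Q' ≤ 2 * #Q ∧ ∀ v ∉ Q', #{l | (l, h l v) ∈ nbr h Q'} ≤ 2 * g := by
  classical
  -- The last condition says that passing from `Q` to `Q'` has lost at least `2g` buckets per added
  -- element. Expansion allows a loss of only `g` per element, so `#Q' ≤ 2 #Q`; and a maximal `Q'`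
  -- leaves no element outside that shares more than `2g` buckets with it.
  let P : Finset V → Prop := fun Q' => Q ⊆ Q' ∧ #Q' ≤ q ∧
    #(nbr h Q') + 2 * g * #Q' ≤ d * #Q' + 2 * g * #Q
  have hPQ : P Q := ⟨Subset.rfl, by omega, by have := card_nbr_le h Q; omega⟩
  obtain ⟨Q', hQ', hmax⟩ := exists_max_image (univ.filter P) card ⟨Q, by simpa using hPQ⟩
  obtain ⟨hsub, hq, hP⟩ := (mem_filter.1 hQ').2
  have h2 : #Q' ≤ 2 * #Q := by
    have := hexp Q' hq
    have h3 : g * #Q' ≤ g * (2 * #Q) := by linarith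
    exact Nat.le_of_mul_le_mul_left h3 hg
  refine ⟨Q', hsub, h2, fun v hv => ?_⟩
  by_contra! hlt
  have hins : #(insert v Q') = #Q' + 1 := card_insert_of_notMem hv
  have hnP : ¬ P (insert v Q') := fun hP' => by
    have := hmax _ (mem_filter.2 ⟨mem_univ _, hP'⟩)
    omega
  apply hnP
  refine ⟨hsub.trans (subset_insert _ _), by omega, ?_⟩
  have hnew : #(nbr h (insert v Q')) ≤ #(nbr h Q') + #{l | (l, h l v) ∉ nbr h Q'} := by
    have : nbr h (insert v Q') ⊆ nbr h Q' ∪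
        ({l | (l, h l v) ∉ nbr h Q'} : Finset (Fin d)).image fun l => (l, h l v) := by
      rintro ⟨l, b⟩ he
      obtain ⟨w, hw, hb⟩ := mem_nbr.1 he
      simp only at hb
      subst hb
      by_cases hmem : (l, h l w) ∈ nbr h Q'
      · exact mem_union_left _ hmem
      · rcases mem_insert.1 hw with rfl | hw
        · exact mem_union_right _ (mem_image.2 ⟨l, by simpa using hmem, rfl⟩)
        · exact absurd (mem_nbr.2 ⟨w, hw, rfl⟩) hmem
    exact (card_le_card this).trans ((card_union_le _ _).trans
      (Nat.add_le_add_left card_image_le _))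
  have hsplit := card_filter_add_card_filter_not (s := (univ : Finset (Fin d)))
    (fun l => (l, h l v) ∈ nbr h Q')
  rw [card_univ, Fintype.card_fin] at hsplit
  rw [hins]
  nlinarith

/-- The content of a bucket. -/
noncomputable def bucket [Fintype V] (h : Fin d → V → β) (r : V → ℝ) (l : Fin d) (b : β) : ℝ :=
  ∑ v with h l v = b, r v

/-- Few elements of a small set `Q` have many buckets that deviate by more than `η` from their
values, if the mass outside of `S ⊆ Q` is small. -/
theorem IsExpanding.card_bad_le [Fintype V] [DecidableEq V] {h : Fin d → V → β} {g q D Z : ℕ} (hexp : IsExpanding h g q)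
    (hg : 0 < g) (hd : d = g * D) {S Q : Finset V} (hSQ : S ⊆ Q) (hQ : 2 * #Q + 1 ≤ q)
    (r : V → ℝ) {η : ℝ} (hη : 0 ≤ η) (hZ : ∑ v ∈ Sᶜ, |r v| ≤ η * Z) :
    D * #{v ∈ Q | d ≤ 2 * #{l | η < |bucket h r l (h l v) - r v|}} ≤ 4 * (2 * #Q + Z) := by
  -- A bucket of `v ∈ Q'` deviates for one of two reasons. Either another element of `Q'` collides
  -- with `v` (the set `F₁`, small by expansion), or mass from outside `Q'` exceeds `η`; that is
  -- rare because an outside element meets at most `2g` buckets of `Q'`.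
  obtain ⟨Q', hsub, hcard, hout⟩ := hexp.exists_closure hg Q hQ
  set E : Finset (Fin d × V) := univ ×ˢ Q' with hE
  set F : Finset (Fin d × V) := {e ∈ E | η < |bucket h r e.1 (h e.1 e.2) - r e.2|} with hF
  set φ : Fin d × V → Fin d × β := fun e => (e.1, h e.1 e.2) with hφ
  set F₁ : Finset (Fin d × V) := {e ∈ E | ∃ e' ∈ E, e' ≠ e ∧ φ e' = φ e} with hF₁
  have hEcard : #E = d * #Q' := by simp [hE]
  have hF₁card : #F₁ ≤ 2 * g * #Q' := by
    have h1 := card_filter_collide_le E φ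
    have h2 : d * #Q' ≤ #(E.image φ) + g * #Q' := hexp Q' (by omega)
    rw [hEcard] at h1
    have : #F₁ + 2 * #(E.image φ) ≤ 2 * (d * #Q') := h1
    linarith
  let mass : Fin d × β → ℝ := fun e => ∑ v ∈ Q'ᶜ with h e.1 v = e.2, |r v|
  have hmass0 : ∀ e, 0 ≤ mass e := fun e => sum_nonneg fun _ _ => abs_nonneg _
  have hmass : ∑ e ∈ nbr h Q', mass e ≤ η * (2 * g * Z : ℕ) := by
    have h1 : ∑ e ∈ nbr h Q', mass e =
        ∑ v ∈ Q'ᶜ, #{l | (l, h l v) ∈ nbr h Q'} * |r v| := by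
      simp only [mass, sum_filter]
      rw [sum_comm]
      refine sum_congr rfl fun v _ => ?_
      rw [← sum_filter, sum_const, nsmul_eq_mul]
      congr 2
      symm
      refine card_bij (fun l _ => (l, h l v)) (fun l hl => ?_) (fun l _ l' _ heq => ?_)
        (fun e he => ?_)
      · simpa using hl
      · exact (Prod.mk.inj heq).1
      · obtain ⟨l, b⟩ := e
        simp only [mem_filter] at he
        refine ⟨l, ?_, ?_⟩
        · simp [he.2, he.1]
        · simp [he.2]
    rw [h1]
    calc ∑ v ∈ Q'ᶜ, (#{l | (l, h l v) ∈ nbr h Q'} : ℝ) * |r v|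
        ≤ ∑ v ∈ Q'ᶜ, (2 * g : ℕ) * |r v| := by
          refine sum_le_sum fun v hv => mul_le_mul_of_nonneg_right ?_ (abs_nonneg _)
          exact_mod_cast hout v (mem_compl.1 hv)
      _ = (2 * g : ℕ) * ∑ v ∈ Q'ᶜ, |r v| := (mul_sum _ _ _).symm
      _ ≤ (2 * g : ℕ) * ∑ v ∈ Sᶜ, |r v| := by
          refine mul_le_mul_of_nonneg_left ?_ (Nat.cast_nonneg _)
          exact sum_le_sum_of_subset_of_nonneg (compl_subset_compl.2 (hSQ.trans hsub))
            fun _ _ _ => abs_nonneg _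
      _ ≤ (2 * g : ℕ) * (η * Z) := mul_le_mul_of_nonneg_left hZ (Nat.cast_nonneg _)
      _ = η * (2 * g * Z : ℕ) := by push_cast; ring
  -- Markov's inequality for the outside mass.
  have hheavy : #{e ∈ nbr h Q' | η < mass e} ≤ 2 * g * Z := by
    by_contra! hlt
    have hne : ({e ∈ nbr h Q' | η < mass e} : Finset _).Nonempty := card_pos.1 (by omega)
    have h1 : #{e ∈ nbr h Q' | η < mass e} * η < ∑ e ∈ nbr h Q' with η < mass e, mass e := by
      rw [← nsmul_eq_mul, ← sum_const]
      exact sum_lt_sum_of_nonempty hne fun e he => (mem_filter.1 he).2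
    have h2 : ∑ e ∈ nbr h Q' with η < mass e, mass e ≤ ∑ e ∈ nbr h Q', mass e :=
      sum_le_sum_of_subset_of_nonneg (filter_subset _ _) fun e _ _ => hmass0 e
    have h3 : ((2 * g * Z : ℕ) : ℝ) ≤ #{e ∈ nbr h Q' | η < mass e} := by exact_mod_cast hlt.le
    nlinarith
  have hnc : ∀ e ∈ F \ F₁, φ e ∈ ({e ∈ nbr h Q' | η < mass e} : Finset _) := by
    rintro ⟨l, v⟩ he
    obtain ⟨heF, heF₁⟩ := mem_sdiff.1 he
    obtain ⟨heE, hη'⟩ := mem_filter.1 heF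
    have hv : v ∈ Q' := (mem_product.1 heE).2
    have hnocol : ∀ v' ∈ Q', h l v' = h l v → v' = v := fun v' hv' heq => by
      by_contra hne
      exact heF₁ (mem_filter.2 ⟨heE, (l, v'), by simpa [hE] using hv',
        fun hc => hne (Prod.mk.inj hc).2, by simp [hφ, heq]⟩)
    refine mem_filter.2 ⟨mem_nbr.2 ⟨v, hv, rfl⟩, lt_of_lt_of_le hη' ?_⟩
    have : bucket h r l (h l v) - r v = ∑ w ∈ Q'ᶜ with h l w = h l v, r w := by
      rw [bucket, ← add_sum_erase _ _ (show v ∈ ({w | h l w = h l v} : Finset V) by simp),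
        add_sub_cancel_left]
      refine sum_congr ?_ fun _ _ => rfl
      ext w
      simp only [mem_erase, mem_filter, mem_univ, true_and, mem_compl]
      constructor
      · rintro ⟨hne, heq⟩
        exact ⟨fun hw => hne (hnocol w hw heq), heq⟩
      · rintro ⟨hw, heq⟩
        exact ⟨fun hc => hw (hc ▸ hv), heq⟩
    simp only [this]
    exact abs_sum_le_sum_abs _ _
  have hinj : #(F \ F₁) ≤ #{e ∈ nbr h Q' | η < mass e} := by
    refine card_le_card_of_injOn φ hnc ?_
    intro e he e' he' heq
    by_contra hne
    have heE : e ∈ E := (mem_filter.1 (mem_sdiff.1 he).1).1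
    have heE' : e' ∈ E := (mem_filter.1 (mem_sdiff.1 he').1).1
    exact (mem_sdiff.1 he).2 (mem_filter.2 ⟨heE, e', heE', fun hc => hne hc.symm, heq.symm⟩)
  have hFcard : #F ≤ 2 * g * #Q' + 2 * g * Z := by
    have h1 : #F ≤ #(F \ F₁) + #F₁ := by
      have := card_le_card (show F ⊆ (F \ F₁) ∪ F₁ by
        intro e he
        by_cases h1 : e ∈ F₁
        · exact mem_union_right _ h1
        · exact mem_union_left _ (mem_sdiff.2 ⟨he, h1⟩))
      exact this.trans (card_union_le _ _)
    omega
  set bad : Finset V := {v ∈ Q | d ≤ 2 * #{l | η < |bucket h r l (h l v) - r v|}} with hbad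
  -- A bad element accounts for at least `d/2` pairs in `F`.
  have hcount : #bad * d ≤ 2 * #F := by
    have h1 : #F = ∑ v ∈ Q', #{l | η < |bucket h r l (h l v) - r v|} := by
      rw [hF, card_filter, hE, sum_product_right]
      refine sum_congr rfl fun v _ => ?_
      rw [card_filter]
    rw [h1, mul_sum, ← smul_eq_mul, ← sum_const]
    calc ∑ v ∈ bad, d ≤ ∑ v ∈ bad, 2 * #{l | η < |bucket h r l (h l v) - r v|} :=
          sum_le_sum fun v hv => (mem_filter.1 hv).2
      _ ≤ _ := sum_le_sum_of_subset ((filter_subset _ _).trans hsub)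
  have hfin : g * (D * #bad) ≤ g * (4 * (2 * #Q + Z)) := by
    have : #bad * (g * D) ≤ 2 * (2 * g * #Q' + 2 * g * Z) := by
      rw [← hd]; omega
    nlinarith
  exact Nat.le_of_mul_le_mul_left hfin hg

end Expander

/-! ### One decoding round: medians, threshold, update -/

section Round

open Finset

/-- One round of decoding: estimates that are correct wherever most buckets are, and a threshold
`τ` that is an order statistic of the estimates, halve the size of the head at the price of a
small increase of the tail. -/
theorem IsExpanding.round_step {V β : Type*} [Fintype V] [DecidableEq V] [DecidableEq β]
    {d g q s a : ℕ} {h : Fin d → V → β} (hexp : IsExpanding h g q) (hg : 0 < g)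
    (hd : d = g * (16 * a ^ 2)) (ha : 4 ≤ a) (hs : 0 < s) (hq : 4 * s * a + 1 ≤ q)
    (r est : V → ℝ) (τ : ℝ)
    (hest : ∀ v η, 2 * #{l | η < |bucket h r l (h l v) - r v|} < d → |est v - r v| ≤ η)
    (hτ₁ : #{v | τ < |est v|} ≤ s * a) (hτ₂ : s * a ≤ #{v | τ ≤ |est v|})
    (S : Finset V) (hS : #S ≤ s) :
    ∃ S' : Finset V, 2 * #S' ≤ s ∧
      ∑ v ∈ S'ᶜ, |r v - if τ < |est v| then est v else 0| ≤ (1 + 5 / a) * ∑ v ∈ Sᶜ, |r v| := by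
  set Z : ℝ := ∑ v ∈ Sᶜ, |r v| with hZdef
  have hZ0 : 0 ≤ Z := sum_nonneg fun _ _ => abs_nonneg _
  have hsR : (0 : ℝ) < s := by exact_mod_cast hs
  have haR : (4 : ℝ) ≤ a := by exact_mod_cast ha
  have haR0 : (0 : ℝ) < a := by linarith
  -- At this precision `s a` kept entries err by `Z/a` in total, while the tail amounts to only `s
  -- a²` units of `η`, which the factor `16 a²` in `card_bad_le` outweighs.
  set η : ℝ := Z / (s * a ^ 2) with hη
  have hη0 : 0 ≤ η := by positivity
  have hηZ : Z ≤ η * (s * a ^ 2 : ℕ) := by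
    push_cast
    rw [hη, div_mul_cancel₀ _ (by positivity)]
  -- Ties at the threshold are broken by some set of exactly `s a` entries between the strict and
  -- the non-strict upper level set.
  obtain ⟨T', hTT', hT'U, hT'⟩ := exists_subsuperset_card_eq
    (show ({v | τ < |est v|} : Finset V) ⊆ ({v | τ ≤ |est v|} : Finset V) from
      fun v hv => by simp only [mem_filter, mem_univ, true_and] at hv ⊢; exact hv.le) hτ₁ hτ₂
  set Q := S ∪ T' with hQ
  have hQcard : #Q ≤ s + s * a := (card_union_le _ _).trans (by omega)
  have hsa : s * 4 ≤ s * a := Nat.mul_le_mul_left s ha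
  have hbound := hexp.card_bad_le hg hd (S := S) (Q := Q) subset_union_left (by nlinarith) r hη0 hηZ
  set bad : Finset V := {v ∈ Q | d ≤ 2 * #{l | η < |bucket h r l (h l v) - r v|}} with hbad
  -- For `a ≥ 4`, `4 (2 (s + s a) + s a²) ≤ 8 s a²`.
  have hbadcard : 2 * #bad ≤ s := by
    have h1 : 8 * a ^ 2 * (2 * #bad) ≤ 8 * a ^ 2 * s := by nlinarith [mul_le_mul hsa ha]
    exact Nat.le_of_mul_le_mul_left h1 (by positivity)
  have hgood : ∀ v ∈ Q, v ∉ bad → |est v - r v| ≤ η := fun v hv hb => by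
    refine hest v η ?_
    by_contra! hc
    exact hb (mem_filter.2 ⟨hv, hc⟩)
  -- Otherwise at least half of `T'` lies outside `S` and the bad set, with true values above `2 Z /
  -- (s a)`; together they would exceed the tail `Z`.
  have hτle : τ ≤ η + 2 * Z / (s * a) := by
    by_contra! hlt
    have hpos : 0 < τ - η := by
      have : 0 ≤ 2 * Z / (s * a) := by positivity
      linarith
    have hcard : s * a ≤ 2 * #(T' \ (S ∪ bad)) := by
      have h1 : #T' - #(S ∪ bad) ≤ #(T' \ (S ∪ bad)) := le_card_sdiff _ _
      have h2 := card_union_le S bad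
      omega
    have hsum : #(T' \ (S ∪ bad)) * (τ - η) ≤ Z := by
      rw [← nsmul_eq_mul, ← sum_const]
      calc ∑ v ∈ T' \ (S ∪ bad), (τ - η) ≤ ∑ v ∈ T' \ (S ∪ bad), |r v| := by
            refine sum_le_sum fun v hv => ?_
            simp only [mem_sdiff, mem_union, not_or] at hv
            have h1 := hgood v (mem_union_right _ hv.1) hv.2.2
            have h2 : τ ≤ |est v| := (mem_filter.1 (hT'U hv.1)).2
            have h3 := abs_sub_abs_le_abs_sub (est v) (r v)
            linarith
        _ ≤ Z := by
            refine sum_le_sum_of_subset_of_nonneg (fun v hv => ?_) fun _ _ _ => abs_nonneg _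
            simp only [mem_sdiff, mem_union, not_or] at hv
            exact mem_compl.2 hv.2.1
    have hcardR : (s * a : ℝ) ≤ 2 * #(T' \ (S ∪ bad)) := by exact_mod_cast hcard
    have h4 : 2 * Z / (s * a) < τ - η := by linarith
    rw [div_lt_iff₀ (by positivity)] at h4
    nlinarith
  refine ⟨bad, hbadcard, ?_⟩
  have hκ0 : 0 ≤ 2 * η + 2 * Z / (s * a) := by positivity
  -- The bad set becomes the new head. Elsewhere a kept entry errs by at most `η`, an entry of `S`
  -- below the threshold is at most `τ + η`, and all others are unchanged. These parts sum to `Z/a`,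
  -- at most `4 Z/a`, and `Z`.
  have hpt : ∀ v ∈ badᶜ, |r v - if τ < |est v| then est v else 0| ≤
      ((if τ < |est v| then η else 0) + if v ∈ S then 2 * η + 2 * Z / (s * a) else 0) +
        if v ∈ Sᶜ then |r v| else 0 := by
    intro v hv
    have hvb : v ∉ bad := mem_compl.1 hv
    have h3 : 0 ≤ if v ∈ S then 2 * η + 2 * Z / (s * a) else 0 := by split_ifs <;> simp [hκ0]
    have h4 : 0 ≤ if v ∈ Sᶜ then |r v| else 0 := by split_ifs <;> simp
    by_cases hT : τ < |est v|
    · have := hgood v (mem_union_right _ (hTT' (by simpa using hT))) hvb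
      rw [abs_sub_comm] at this
      simp only [hT, if_true]
      linarith
    · by_cases hvS : v ∈ S
      · have h1 := hgood v (mem_union_left _ hvS) hvb
        rw [abs_sub_comm] at h1
        have h2 := abs_sub_abs_le_abs_sub (r v) (est v)
        simp only [hT, hvS, if_true, if_false, mem_compl, not_true, sub_zero]
        linarith
      · simp [hT, hvS]
  refine (sum_le_sum hpt).trans ((sum_le_sum_of_subset_of_nonneg (subset_univ _)
    fun v _ _ => ?_).trans ?_)
  · split_ifs <;> positivity
  rw [sum_add_distrib, sum_add_distrib, ← sum_filter, sum_const, nsmul_eq_mul, sum_ite_mem,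
    sum_ite_mem, univ_inter, univ_inter, sum_const, nsmul_eq_mul, ← hZdef]
  have hT1 : (#{v | τ < |est v|} : ℝ) * η ≤ (s * a) * η :=
    mul_le_mul_of_nonneg_right (by exact_mod_cast hτ₁) hη0
  have hS1 : (#S : ℝ) * (2 * η + 2 * Z / (s * a)) ≤ s * (2 * η + 2 * Z / (s * a)) :=
    mul_le_mul_of_nonneg_right (by exact_mod_cast hS) hκ0
  have e1 : (s * a) * η = Z / a := by rw [hη]; field_simp
  have e2 : s * (2 * η + 2 * Z / (s * a)) = 2 * Z / a ^ 2 + 2 * (Z / a) := by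
    rw [hη]; field_simp
  have e3 : 2 * Z / a ^ 2 ≤ 2 * (Z / a) := by
    rw [mul_div_assoc]
    have : Z / a ^ 2 ≤ Z / a := div_le_div_of_nonneg_left hZ0 haR0 (by nlinarith)
    linarith
  have e4 : (1 + 5 / a) * Z = Z + 5 * (Z / a) := by ring
  rw [e4]
  linarith

/-- The median computed by sorting is correct if most entries are. -/
theorem abs_oddEvenSort_sub_le {X : Type*} (k : ℕ) (u : ℕ → X → ℝ) (x : X) {ρ η : ℝ}
    (h : 2 * #{i ∈ range (2 ^ k) | η < |u i x - ρ|} < 2 ^ k) :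
    |oddEvenSort k u (2 ^ k / 2) x - ρ| ≤ η := by
  have hp : 2 ^ k / 2 < 2 ^ k := Nat.div_lt_self (by positivity) (by norm_num)
  have hsplit := card_filter_add_card_filter_not (s := range (2 ^ k)) (fun i => η < |u i x - ρ|)
  rw [card_range] at hsplit
  rw [abs_le]
  constructor
  · by_contra! hlt
    have h1 := (not_congr (lt_oddEvenSort_iff k u x (oddEvenSort k u (2 ^ k / 2) x) hp)).1
      (lt_irrefl _)
    have h2 : #{i ∈ range (2 ^ k) | u i x ≤ oddEvenSort k u (2 ^ k / 2) x} ≤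
        #{i ∈ range (2 ^ k) | η < |u i x - ρ|} := by
      refine card_le_card fun i hi => ?_
      simp only [mem_filter] at hi ⊢
      exact ⟨hi.1, lt_of_lt_of_le (by linarith [hi.2]) (neg_le_abs _)⟩
    omega
  · by_contra! hlt
    have h1 := (lt_oddEvenSort_iff k u x (ρ + η) hp).1 (by linarith)
    have h2 : #{i ∈ range (2 ^ k) | ¬ η < |u i x - ρ|} ≤
        #{i ∈ range (2 ^ k) | u i x ≤ ρ + η} := by
      refine card_le_card fun i hi => ?_
      simp only [mem_filter, not_lt] at hi ⊢
      exact ⟨hi.1, by linarith [(abs_le.1 hi.2).2]⟩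
    omega

/-- The threshold computed by sorting separates the `M` largest entries. -/
theorem oddEvenSort_threshold {X : Type*} (t : ℕ) (u : ℕ → X → ℝ) (x : X) {M : ℕ} (hM : 0 < M)
    (hMt : M ≤ 2 ^ t) :
    #{i ∈ range (2 ^ t) | oddEvenSort t u (2 ^ t - M) x < u i x} ≤ M ∧
      M ≤ #{i ∈ range (2 ^ t) | oddEvenSort t u (2 ^ t - M) x ≤ u i x} := by
  have hp : 2 ^ t - M < 2 ^ t := Nat.sub_lt (by positivity) hM
  set τ := oddEvenSort t u (2 ^ t - M) x with hτ
  constructor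
  · have h1 := (not_congr (lt_oddEvenSort_iff t u x τ hp)).1 (lt_irrefl _)
    have hsplit := card_filter_add_card_filter_not (s := range (2 ^ t)) (fun i => u i x ≤ τ)
    simp only [not_le, card_range] at hsplit
    omega
  · have hsplit := card_filter_add_card_filter_not (s := range (2 ^ t)) (fun i => τ ≤ u i x)
    simp only [not_le, card_range] at hsplit
    have h2 : #{i ∈ range (2 ^ t) | u i x < τ} ≤ 2 ^ t - M := by
      rcases ({i ∈ range (2 ^ t) | u i x < τ} : Finset ℕ).eq_empty_or_nonempty with he | hne
      · simp [he]
      -- The largest value below the threshold is exceeded by this order statistic, which bounds the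
      -- number of entries up to it.
      · obtain ⟨j, hj, hmax⟩ := exists_max_image _ (fun i => u i x) hne
        have h3 := (lt_oddEvenSort_iff t u x (u j x) hp).1 (mem_filter.1 hj).2
        refine le_trans (card_le_card fun i hi => ?_) h3
        exact mem_filter.2 ⟨(mem_filter.1 hi).1, hmax i hi⟩
    omega

/-- Counting over `Fin n` and over `range n`. -/
theorem card_filter_range_eq_card_filter_fin {n : ℕ} (p : Fin n → Prop) [DecidablePred p] (p' : ℕ → Prop)
    [DecidablePred p'] (h : ∀ i : Fin n, p' i ↔ p i) :
    #{i ∈ range n | p' i} = #{i : Fin n | p i} := by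
  rw [card_filter, card_filter, sum_range]
  simp only [h]

end Round

open Finset in
/-- One round of decoding as a straight-line computation. -/
theorem IsExpanding.round_computes {X : Type*} {A : Set (X → ℝ)} (h0 : (0 : X → ℝ) ∈ A)
    {t k B g q s a : ℕ} {h : Fin (2 ^ k) → Fin (2 ^ t) → Fin B} (hexp : IsExpanding h g q)
    (hg : 0 < g) (hd : 2 ^ k = g * (16 * a ^ 2)) (ha : 4 ≤ a) (hs : 0 < s)
    (hq : 4 * s * a + 1 ≤ q) (hsa : s * a ≤ 2 ^ t) (y : X → Fin (2 ^ t) → ℝ)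
    (hy : ∀ l b, (fun x => bucket h (y x) l b) ∈ A) (cur : Fin (2 ^ t) → X → ℝ)
    (hcur : ∀ v, cur v ∈ A) :
    ∃ new : Fin (2 ^ t) → X → ℝ,
      Computes A (2 ^ k * B + 2 ^ t * (2 * 2 ^ k + k ^ 2 * 2 ^ (k + 1) + 2 * t ^ 2 + 5))
        (Set.range new) ∧
      ∀ x (S : Finset (Fin (2 ^ t))), #S ≤ s → ∃ S' : Finset (Fin (2 ^ t)), #S' ≤ s / 2 ∧
        ∑ v ∈ S'ᶜ, |y x v - new v x| ≤ (1 + 5 / a) * ∑ v ∈ Sᶜ, |y x v - cur v x| := by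
  classical
  -- residual buckets
  let res : Fin (2 ^ k) × Fin B → X → ℝ := fun e x =>
    bucket h (fun v => y x v - cur v x) e.1 e.2
  have hres : Computes A (2 ^ k * B + 2 * 2 ^ k * 2 ^ t) (Set.range res) := by
    have h1 := Computes.family (A := A) (univ : Finset (Fin (2 ^ k) × Fin B)) (f := res)
      (τ := fun e => 2 * #{v | h e.1 v = e.2} + 1) fun e _ => by
        refine ((Computes.sum h0 ({v | h e.1 v = e.2} : Finset (Fin (2 ^ t))) (f := cur)
          fun v _ => hcur v).trans (Computes.sub (Or.inl (hy e.1 e.2))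
            (Or.inr rfl))).mono_right ?_
        rintro _ rfl
        right
        rw [Set.mem_singleton_iff]
        funext x
        simp [res, bucket]
    rw [coe_univ, Set.image_univ] at h1
    refine h1.mono_time (le_of_eq ?_)
    rw [sum_add_distrib, ← mul_sum, Fintype.sum_prod_type]
    -- The buckets of one hash function partition the coordinates, so summing them all touches each
    -- coordinate once.
    have h2 : ∀ l : Fin (2 ^ k), ∑ b : Fin B, #{v | h l v = b} = 2 ^ t := fun l => by
      rw [← card_eq_sum_card_fiberwise (f := h l) (s := univ) (t := univ) (by simp)]
      simp
    simp only [h2]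
    simp
    ring
  set A₁ := A ∪ Set.range res with hA₁
  have h0₁ : (0 : X → ℝ) ∈ A₁ := Or.inl h0
  -- estimates
  let u : Fin (2 ^ t) → ℕ → X → ℝ := fun v i =>
    if hi : i < 2 ^ k then res (⟨i, hi⟩, h ⟨i, hi⟩ v) else 0
  let est : Fin (2 ^ t) → X → ℝ := fun v => oddEvenSort k (u v) (2 ^ k / 2)
  have hest : Computes A₁ (2 ^ t * (k ^ 2 * 2 ^ (k + 1))) (Set.range est) := by
    have h1 := Computes.family (A := A₁) (univ : Finset (Fin (2 ^ t))) (f := est)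
      (τ := fun _ => k ^ 2 * 2 ^ (k + 1)) fun v _ => by
        refine (Computes.oddEvenSort h0₁ k (u := u v) fun i hi => ?_).mono_right ?_
        · simp only [u, hi, dif_pos]
          exact Or.inr ⟨_, rfl⟩
        · rintro _ rfl
          exact ⟨2 ^ k / 2, Nat.div_lt_self (by positivity) (by norm_num), rfl⟩
    rw [coe_univ, Set.image_univ] at h1
    simpa using h1
  set A₂ := A₁ ∪ Set.range est with hA₂
  have h0₂ : (0 : X → ℝ) ∈ A₂ := Or.inl h0₁
  -- absolute values
  let w : ℕ → X → ℝ := fun i => if hi : i < 2 ^ t then fun x => |est ⟨i, hi⟩ x| else 0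
  have hw : Computes A₂ (2 ^ t * 2) (w '' Set.Iio (2 ^ t)) := by
    have h1 := Computes.family (A := A₂) (range (2 ^ t)) (f := w) (τ := fun _ => 2)
      fun i hi => by
        simp only [w, mem_range.1 hi, dif_pos]
        exact Computes.abs h0₂ (Or.inr ⟨_, rfl⟩)
    simpa using h1
  set A₃ := A₂ ∪ w '' Set.Iio (2 ^ t) with hA₃
  have h0₃ : (0 : X → ℝ) ∈ A₃ := Or.inl h0₂
  -- the threshold
  let τ : X → ℝ := oddEvenSort t w (2 ^ t - s * a)
  have hpos : 0 < s * a := by positivity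
  have hτ : Computes A₃ (t ^ 2 * 2 ^ (t + 1)) {τ} := by
    refine (Computes.oddEvenSort h0₃ t (u := w) fun i hi => Or.inr ⟨i, hi, rfl⟩).mono_right ?_
    rintro _ rfl
    exact ⟨_, Nat.sub_lt (by positivity) hpos, rfl⟩
  set A₄ := A₃ ∪ {τ} with hA₄
  have h0₄ : (0 : X → ℝ) ∈ A₄ := Or.inl h0₃
  -- the update
  let new : Fin (2 ^ t) → X → ℝ := fun v =>
    cur v + fun x => if τ x < |est v x| then est v x else 0
  have hnew : Computes A₄ (2 ^ t * 3) (Set.range new) := by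
    have h1 := Computes.family (A := A₄) (univ : Finset (Fin (2 ^ t))) (f := new)
      (τ := fun _ => 3) fun v _ => by
        have hwv : (fun x => |est v x|) ∈ A₄ :=
          Or.inl (Or.inr ⟨v, v.2, by simp [w]⟩)
        have hev : est v ∈ A₄ := Or.inl (Or.inl (Or.inr ⟨v, rfl⟩))
        have hcv : cur v ∈ A₄ := Or.inl (Or.inl (Or.inl (Or.inl (hcur v))))
        have h1 := Computes.ite h0₄ (f := τ) (Or.inr rfl) hwv hev h0₄
        exact ((h1.trans (Computes.add (Or.inl h0₄) (f := cur v) (Or.inl hcv)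
          (Or.inr rfl)))).mono_right Set.subset_union_right
    rw [coe_univ, Set.image_univ] at h1
    simpa using h1
  refine ⟨new, ?_, fun x S hS => ?_⟩
  · have h1 := (((hres.union_left.trans
      (hest.mono_left (Set.subset_union_right))).trans
      (hw.mono_left ?_)).trans (hτ.mono_left ?_)).trans (hnew.mono_left ?_)
    · refine (h1.mono_time (le_of_eq ?_)).mono_right Set.subset_union_right
      rw [pow_succ 2 t]
      ring
    · simp only [hA₂, hA₁]
      intro f; simp only [Set.mem_union]; tauto
    · simp only [hA₃, hA₂, hA₁]
      intro f; simp only [Set.mem_union]; tauto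
    · simp only [hA₄, hA₃, hA₂, hA₁]
      intro f; simp only [Set.mem_union]; tauto
  · have hthr := oddEvenSort_threshold t w x hpos hsa
    have hc : ∀ v : Fin (2 ^ t), w v x = |est v x| := fun v => by simp [w]
    have key := hexp.round_step hg hd ha hs hq (fun v => y x v - cur v x)
      (fun v => est v x) (τ x) (fun v η hη => ?_) ?_ ?_ S hS
    · obtain ⟨S', hS', hsum⟩ := key
      refine ⟨S', by omega, le_of_eq_of_le (sum_congr rfl fun v _ => ?_) hsum⟩
      simp only [new, Pi.add_apply]
      rw [sub_sub]
    · refine abs_oddEvenSort_sub_le k (u v) x ?_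
      rw [card_filter_range_eq_card_filter_fin
        (fun l => η < |bucket h (fun v => y x v - cur v x) l (h l v) - (y x v - cur v x)|)]
      · exact hη
      · intro l
        simp [u, res]
    · rw [← card_filter_range_eq_card_filter_fin _ (fun i => τ x < w i x)]
      · exact hthr.1
      · intro v; rw [hc]
    · rw [← card_filter_range_eq_card_filter_fin _ (fun i => τ x ≤ w i x)]
      · exact hthr.2
      · intro v; rw [hc]

/-! ### Existence of expanding hash families -/

/-- `r^r / r!` is a term of the series of `exp r`, hence at most `e^r ≤ 3^r`. -/
theorem choose_le_three_mul_div_pow (n : ℕ) {r : ℕ} (hr : 0 < r) :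
    (n.choose r : ℝ) ≤ (3 * n / r) ^ r := by
  have hrR : (0 : ℝ) < r := by exact_mod_cast hr
  have h1 : (n.choose r : ℝ) ≤ (n : ℝ) ^ r / r.factorial := Nat.choose_le_pow_div r n
  have h2 : (r : ℝ) ^ r / r.factorial ≤ 3 ^ r := by
    refine (Real.pow_div_factorial_le_exp (r : ℝ) hrR.le r).trans ?_
    rw [← mul_one (r : ℝ), Real.exp_nat_mul]
    exact pow_le_pow_left₀ (Real.exp_pos _).le (by linarith [Real.exp_one_lt_d9]) _
  have hf : (0 : ℝ) < r.factorial := by exact_mod_cast r.factorial_pos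
  refine h1.trans ?_
  rw [div_pow, mul_pow]
  rw [div_le_iff₀ hf] at h2 ⊢
  rw [div_mul_eq_mul_div, le_div_iff₀ (by positivity)]
  calc (n : ℝ) ^ r * r ^ r ≤ n ^ r * (3 ^ r * r.factorial) :=
        mul_le_mul_of_nonneg_left h2 (by positivity)
    _ = _ := by ring

section Existence

open Finset

/-- The number of functions with prescribed coincidences. -/
theorem card_filter_forall_eq_le {I β : Type*} [Fintype I] [DecidableEq I] [Fintype β]
    [DecidableEq β] (W : Finset I) (π : W → I) (hπ : ∀ e, π e ∉ W) :
    #{h : I → β | ∀ e : W, h e = h (π e)} ≤ Fintype.card β ^ (Fintype.card I - #W) := by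
  have h1 : Fintype.card ({e // e ∈ Wᶜ} → β) = Fintype.card β ^ (Fintype.card I - #W) := by
    rw [Fintype.card_fun, Fintype.card_coe, card_compl]
  rw [← h1, ← card_univ]
  -- The values on `W` are copies of values off `W`, so the latter determine the function.
  refine card_le_card_of_injOn (fun h e => h e) (fun _ _ => mem_coe.2 (mem_univ _)) ?_
  intro h hh h' hh' heq
  simp only [coe_filter, mem_univ, true_and, Set.mem_ofPred_eq] at hh hh'
  have hout : ∀ e, e ∉ W → h e = h' e := fun e he =>
    congrFun heq (⟨e, mem_compl.2 he⟩ : {e // e ∈ Wᶜ})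
  funext e
  by_cases he : e ∈ W
  · rw [hh ⟨e, he⟩, hh' ⟨e, he⟩, hout _ (hπ _)]
  · exact hout e he

/-- The number of hash families that lose many buckets on a given set. -/
theorem card_not_expanding_le {V β : Type*} [Fintype V] [DecidableEq V] [Fintype β]
    [DecidableEq β] (d c : ℕ) (Q : Finset V) :
    #{h : Fin d × V → β | #(nbr (fun l v => h (l, v)) Q) + c < d * #Q} ≤
      (d * #Q).choose c * #Q ^ c * Fintype.card β ^ (d * Fintype.card V - c) := by
  set E : Finset (Fin d × V) := univ ×ˢ Q with hE
  have hEcard : #E = d * #Q := by simp [hE]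
  let bad : Finset (Fin d × V) → Finset (Fin d × V → β) := fun W =>
    (univ : Finset (W → Q)).biUnion fun π =>
      if ∀ e : W, (e.1.1, (π e).1) ∉ W then
        ({h : Fin d × V → β | ∀ e : W, h e = h (e.1.1, (π e).1)} : Finset _) else ∅
  have hsub : ({h : Fin d × V → β | #(nbr (fun l v => h (l, v)) Q) + c < d * #Q} : Finset _) ⊆
      (powersetCard c E).biUnion bad := by
    intro h hh
    replace hh : #(nbr (fun l v => h (l, v)) Q) + c < d * #Q := (mem_filter.1 hh).2
    set φ : Fin d × V → Fin d × β := fun e => (e.1, h (e.1, e.2)) with hφ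
    have hnbr : nbr (fun l v => h (l, v)) Q = E.image φ := rfl
    -- `R` picks one pair per occupied bucket; each of the more than `c` remaining pairs repeats the
    -- value of a pair of `R` with the same hash index. Recording `c` of them (`W`) and the elements
    -- they repeat (`π`) makes `c` values of `h` redundant.
    obtain ⟨R, hRE, hRcard⟩ : ∃ R ⊆ E, R.image φ = E.image φ ∧ #R = #(E.image φ) := by
      have hex : ∀ b : E.image φ, ∃ e ∈ E, φ e = b := fun b => mem_image.1 b.2
      choose σ hσ hφσ using hex
      have hinj : Function.Injective σ := fun b b' hbb => Subtype.ext (by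
        rw [← hφσ b, ← hφσ b', hbb])
      refine ⟨univ.image σ, fun e he => ?_, ?_, ?_⟩
      · obtain ⟨b, -, rfl⟩ := mem_image.1 he
        exact hσ b
      · ext b
        rw [image_image, mem_image]
        constructor
        · rintro ⟨b', -, rfl⟩
          rw [Function.comp_apply, hφσ]
          exact b'.2
        · exact fun hb => ⟨⟨b, hb⟩, mem_univ _, hφσ _⟩
      · rw [card_image_of_injective _ hinj, card_univ, Fintype.card_coe]
    have hle : c ≤ #(E \ R) := by
      rw [card_sdiff_of_subset hRE, hRcard.2, ← hnbr, hEcard]; omega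
    obtain ⟨W, hW, hWc⟩ := exists_subset_card_eq hle
    have hrep : ∀ e : W, ∃ v : Q, (e.1.1, v.1) ∈ R ∧ h e = h (e.1.1, v.1) := fun e => by
      have he : e.1 ∈ E := (mem_sdiff.1 (hW e.2)).1
      have h1 : φ e ∈ R.image φ := hRcard.1 ▸ mem_image_of_mem φ he
      obtain ⟨⟨l, v⟩, hv, heq⟩ := mem_image.1 h1
      simp only [hφ, Prod.mk.injEq] at heq
      obtain ⟨rfl, h2⟩ := heq
      exact ⟨⟨v, (mem_product.1 (hRE hv)).2⟩, hv, h2.symm⟩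
    choose π hπ using hrep
    refine mem_biUnion.2 ⟨W, mem_powersetCard.2 ⟨hW.trans sdiff_subset, hWc⟩,
      mem_biUnion.2 ⟨π, mem_univ _, ?_⟩⟩
    rw [if_pos fun e he => (mem_sdiff.1 (hW he)).2 (hπ e).1]
    exact mem_filter.2 ⟨mem_univ _, fun e => (hπ e).2⟩
  refine (card_le_card hsub).trans ((card_biUnion_le_card_mul _ _
    (#Q ^ c * Fintype.card β ^ (d * Fintype.card V - c)) fun W hW => ?_).trans ?_)
  · have hWc : #W = c := (mem_powersetCard.1 hW).2
    refine (card_biUnion_le_card_mul _ _ (Fintype.card β ^ (d * Fintype.card V - c))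
      fun π _ => ?_).trans ?_
    · split_ifs with hπ
      · have := card_filter_forall_eq_le (β := β) W (fun e => (e.1.1, (π e).1)) hπ
        rwa [Fintype.card_prod, Fintype.card_fin, hWc] at this
      · simp
    · rw [card_univ, Fintype.card_fun, Fintype.card_coe, Fintype.card_coe, hWc]
  · rw [card_powersetCard, hEcard, mul_assoc]

theorem sum_range_quarter_pow_lt_one (n : ℕ) : ∑ u ∈ range n, (1 / 4 : ℝ) ^ (u + 1) < 1 := by
  have h : ∑ u ∈ range n, (1 / 4 : ℝ) ^ (u + 1) = (1 - (1 / 4) ^ n) / 3 := by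
    induction n with
    | zero => simp
    | succ n ih => rw [sum_range_succ, ih]; ring
  rw [h]
  have : (0 : ℝ) < (1 / 4) ^ n := by positivity
  linarith

/-- This bounds the expected number of failing sets of size `u` for range `8 D q`. The inner
binomial is at most `(3D)^(gu)`, so together with the range it leaves `(3u/(8q))^(gu)`. One factor
`u/q` per element turns `3N/u` into `3N/q`, and the factor `2^(-g)` per element beats that. -/
theorem union_bound_term_le {N g D q u : ℕ} (hg : 0 < g) (hD : 0 < D) (hu : 0 < u) (huq : u ≤ q)
    (hN : 12 * N ≤ 2 ^ g * q) :
    (N.choose u : ℝ) * ((g * D * u).choose (g * u) * ((u : ℝ) / (8 * D * q : ℕ)) ^ (g * u)) ≤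
      (1 / 4) ^ u := by
  have huR : (0 : ℝ) < u := by exact_mod_cast hu
  have hgR : (0 : ℝ) < g := by exact_mod_cast hg
  have hDR : (0 : ℝ) < D := by exact_mod_cast hD
  have huqR : (u : ℝ) ≤ q := by exact_mod_cast huq
  have hqR : (0 : ℝ) < q := huR.trans_le huqR
  have hNR : 12 * (N : ℝ) ≤ 2 ^ g * q := by exact_mod_cast hN
  have h1 := choose_le_three_mul_div_pow N hu
  have h2 := choose_le_three_mul_div_pow (g * D * u) (r := g * u) (by positivity)
  have e2 : 3 * ((g * D * u : ℕ) : ℝ) / ((g * u : ℕ) : ℝ) = 3 * D := by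
    push_cast; field_simp
  rw [e2] at h2
  have h3 : ((g * D * u).choose (g * u) : ℝ) * ((u : ℝ) / (8 * D * q : ℕ)) ^ (g * u) ≤
      ((1 / 2) ^ g * (u / q)) ^ u := by
    calc ((g * D * u).choose (g * u) : ℝ) * ((u : ℝ) / (8 * D * q : ℕ)) ^ (g * u)
        ≤ (3 * D) ^ (g * u) * ((u : ℝ) / (8 * D * q : ℕ)) ^ (g * u) :=
          mul_le_mul_of_nonneg_right h2 (by positivity)
      _ = (3 / 8 * (u / q)) ^ (g * u) := by
          rw [← mul_pow]; congr 1; push_cast; field_simp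
      _ = ((3 / 8 * (u / q)) ^ g) ^ u := by rw [pow_mul]
      _ ≤ ((1 / 2) ^ g * (u / q)) ^ u := by
          refine pow_le_pow_left₀ (by positivity) ?_ _
          rw [mul_pow]
          refine mul_le_mul (pow_le_pow_left₀ (by norm_num) (by norm_num) _) ?_ (by positivity)
            (by positivity)
          exact pow_le_of_le_one (by positivity) (by rw [div_le_one hqR]; exact huqR) hg.ne'
  calc _ ≤ (3 * N / u : ℝ) ^ u * ((1 / 2) ^ g * (u / q)) ^ u :=
        mul_le_mul h1 h3 (by positivity) (by positivity)
    _ = (3 * N / (2 ^ g * q)) ^ u := by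
        rw [← mul_pow]; congr 1
        rw [one_div, inv_pow]
        field_simp
    _ ≤ (1 / 4) ^ u := by
        refine pow_le_pow_left₀ (by positivity) ?_ _
        rw [div_le_iff₀ (by positivity)]
        linarith

/-- The probabilistic method as a count of functions: by a union bound over the sets of size `u ≤
q`, the failing fraction is at most `∑ 4^(-u)` over `u ≥ 1`, which is below one. -/
theorem exists_isExpanding {N g D q : ℕ} (hg : 0 < g) (hD : 0 < D) (hq : 0 < q)
    (hN : 12 * N ≤ 2 ^ g * q) :
    ∃ h : Fin (g * D) → Fin N → Fin (8 * D * q), IsExpanding h g q := by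
  by_contra! hno
  set B := 8 * D * q with hB
  set d := g * D with hd
  have hBpos : 0 < B := by positivity
  let bad : Finset (Fin N) → Finset (Fin d × Fin N → Fin B) := fun Q =>
    if #Q ≤ q then
      ({h : Fin d × Fin N → Fin B | #(nbr (fun l v => h (l, v)) Q) + g * #Q < d * #Q} : Finset _)
    else ∅
  let F : ℕ → ℝ := fun u =>
    if 0 < u ∧ u ≤ q then (d * u).choose (g * u) * ((u : ℝ) / B) ^ (g * u) else 0
  have hcover : (univ : Finset (Fin d × Fin N → Fin B)) ⊆
      (univ : Finset (Fin N)).powerset.biUnion bad := by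
    intro h _
    have h1 := hno fun l v => h (l, v)
    simp only [IsExpanding, not_forall, not_le] at h1
    obtain ⟨Q, hQ, hlt⟩ := h1
    refine mem_biUnion.2 ⟨Q, by simp, ?_⟩
    simp only [bad, hQ, if_true]
    exact mem_filter.2 ⟨mem_univ _, hlt⟩
  have hcardbad : ∀ Q : Finset (Fin N), (#(bad Q) : ℝ) ≤ F #Q * (B : ℝ) ^ (d * N) := by
    intro Q
    have hF0 : 0 ≤ F #Q * (B : ℝ) ^ (d * N) := by
      simp only [F]; split_ifs <;> positivity
    by_cases hQ : #Q ≤ q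
    · rcases Nat.eq_zero_or_pos #Q with h0 | hpos
      · have : bad Q = ∅ := by simp [bad, h0]
        rw [this]; simpa using hF0
      · simp only [bad, hQ, if_true, F, hpos, true_and]
        have h1 := card_not_expanding_le (β := Fin B) d (g * #Q) Q
        rw [Fintype.card_fin, Fintype.card_fin] at h1
        by_cases hle : g * #Q ≤ d * N
        · calc ((#{h : Fin d × Fin N → Fin B |
                #(nbr (fun l v => h (l, v)) Q) + g * #Q < d * #Q} : ℕ) : ℝ)
              ≤ ((d * #Q).choose (g * #Q) * #Q ^ (g * #Q) * B ^ (d * N - g * #Q) : ℕ) := by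
                exact_mod_cast h1
            _ = _ := by
                have : (B : ℝ) ^ (d * N) = B ^ (d * N - g * #Q) * B ^ (g * #Q) := by
                  rw [← pow_add, Nat.sub_add_cancel hle]
                rw [this, div_pow]
                push_cast
                field_simp
        · have hQN : #Q ≤ N := by simpa using card_le_univ Q
          exact absurd ((Nat.mul_le_mul_left g hQN).trans
            (Nat.mul_le_mul_right N (Nat.le_mul_of_pos_right g hD))) hle
    · have : bad Q = ∅ := by simp [bad, hQ]
      rw [this]; simpa using hF0
  have h1 : ((B ^ (d * N) : ℕ) : ℝ) ≤ (∑ Q ∈ (univ : Finset (Fin N)).powerset, F #Q) *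
      (B : ℝ) ^ (d * N) := by
    have h2 := (card_le_card hcover).trans card_biUnion_le
    rw [card_univ, Fintype.card_fun, Fintype.card_prod, Fintype.card_fin, Fintype.card_fin,
      Fintype.card_fin] at h2
    calc ((B ^ (d * N) : ℕ) : ℝ) ≤ ((∑ Q ∈ (univ : Finset (Fin N)).powerset, #(bad Q) : ℕ) : ℝ) := by
          exact_mod_cast h2
      _ ≤ _ := by
          rw [Nat.cast_sum, sum_mul]
          exact sum_le_sum fun Q _ => hcardbad Q
  have h2 : ∑ Q ∈ (univ : Finset (Fin N)).powerset, F #Q < 1 := by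
    rw [sum_powerset_apply_card, card_univ, Fintype.card_fin, sum_range_succ']
    have : F 0 = 0 := by simp [F]
    rw [this, smul_zero, add_zero]
    refine lt_of_le_of_lt (sum_le_sum fun u _ => ?_) (sum_range_quarter_pow_lt_one N)
    rw [nsmul_eq_mul]
    by_cases hu : u + 1 ≤ q
    · simp only [F, hu, Nat.succ_pos, true_and, if_true]
      exact union_bound_term_le hg hD (Nat.succ_pos u) hu hN
    · simp only [F, hu, and_false, if_false, mul_zero]
      positivity
  have hBR : (0 : ℝ) < (B : ℝ) ^ (d * N) := by positivity
  push_cast at h1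
  nlinarith

end Existence

/-! ### Deterministic sparse recovery in the `ℓ₁` norm -/

namespace Recovery

/-- The scale of the parameters of round `j`: a power of two between `j + 1` and `2 (j + 1)`. -/
def scale (j : ℕ) : ℕ := 2 ^ Nat.clog 2 (j + 1)

/-- The inverse accuracy of round `j`. -/
def acc (j : ℕ) : ℕ := 4 * scale j ^ 2

/-- The inverse expansion loss of round `j`. -/
def loss (j : ℕ) : ℕ := 16 * acc j ^ 2

/-- The size up to which the hash family of round `j` expands. -/
def reach (K j : ℕ) : ℕ := 8 * (K / 2 ^ j) * acc j

/-- The number of buckets of a hash function of round `j`. -/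
def buckets (K j : ℕ) : ℕ := 8 * loss j * reach K j

/-- The binary logarithm of the number of hash functions of round `j`. -/
def logHashes (γ j : ℕ) : ℕ := γ + 5 * Nat.clog 2 (j + 1) + 8

/-- The number of gates of round `j`. -/
def roundTime (t K γ j : ℕ) : ℕ :=
  2 ^ logHashes γ j * buckets K j + 2 ^ t * (2 * 2 ^ logHashes γ j +
    logHashes γ j ^ 2 * 2 ^ (logHashes γ j + 1) + 2 * t ^ 2 + 5)

theorem le_scale (j : ℕ) : j + 1 ≤ scale j := Nat.le_pow_clog (by norm_num) _

theorem scale_pos (j : ℕ) : 0 < scale j := by unfold scale; positivity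

theorem two_pow_clog_le {e : ℕ} (he : 0 < e) : 2 ^ Nat.clog 2 e ≤ 2 * e := by
  rcases Nat.lt_or_ge 1 e with h | h
  · have h1 := Nat.pow_pred_clog_lt_self (b := 2) (by norm_num) h
    have h2 : 0 < Nat.clog 2 e := Nat.clog_pos (by norm_num) h
    obtain ⟨c, hc⟩ := Nat.exists_eq_succ_of_ne_zero h2.ne'
    rw [hc] at h1 ⊢
    simp only [Nat.pred_succ] at h1
    rw [pow_succ]; omega
  · obtain rfl : e = 1 := by omega
    simp

theorem scale_le (j : ℕ) : scale j ≤ 2 * (j + 1) := two_pow_clog_le (Nat.succ_pos j)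

theorem acc_ge (j : ℕ) : 4 * (j + 1) ^ 2 ≤ acc j :=
  Nat.mul_le_mul_left 4 (Nat.pow_le_pow_left (le_scale j) 2)

theorem four_le_acc (j : ℕ) : 4 ≤ acc j := by
  have h1 := acc_ge j
  have h2 : 1 ≤ (j + 1) ^ 2 := Nat.one_le_pow _ _ (Nat.succ_pos j)
  omega

/-- The factorization `d = g D` with `g = 2^γ scale j` and `D = loss j`. As `scale` is a power of
two, so is `d`, as the sorting network for the median requires. -/
theorem two_pow_logHashes (γ j : ℕ) : 2 ^ logHashes γ j = 2 ^ γ * scale j * loss j := by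
  simp only [logHashes, loss, acc, scale, pow_add, mul_pow, ← pow_mul]
  rw [show 5 * Nat.clog 2 (j + 1) = Nat.clog 2 (j + 1) + Nat.clog 2 (j + 1) * (2 * 2) by ring,
    pow_add]
  ring

theorem sq_succ_le (j : ℕ) : (j + 1) ^ 2 ≤ 4 * 2 ^ j := by
  induction j with
  | zero => norm_num
  | succ j ih =>
    rcases Nat.lt_or_ge j 2 with h | h
    · interval_cases j <;> norm_num
    · rw [pow_succ 2 j]; nlinarith

/-- Round `j` keeps `s a` entries, `s = K/2^j`, `a = acc j`, so there must be that many coordinates.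
-/
theorem head_mul_acc_le {t K : ℕ} (j : ℕ) (hK : 64 * K ≤ 2 ^ t) : K / 2 ^ j * acc j ≤ 2 ^ t := by
  have h1 : acc j ≤ 64 * 2 ^ j := by
    have := Nat.pow_le_pow_left (scale_le j) 2
    have := sq_succ_le j
    unfold acc
    nlinarith
  calc K / 2 ^ j * acc j ≤ K / 2 ^ j * (64 * 2 ^ j) := Nat.mul_le_mul_left _ h1
    _ = 64 * (K / 2 ^ j * 2 ^ j) := by ring
    _ ≤ 64 * K := Nat.mul_le_mul_left _ (Nat.div_mul_le_self _ _)
    _ ≤ 2 ^ t := hK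

/-- Since round `j` has sparsity `K/2^j`, the union bound needs `g` of order `log(N/K) + j`. The
factor `2^γ` supplies the first term, and `scale j ≥ j + 1` the second. -/
theorem exists_hash {t K γ j : ℕ} (hj : 0 < K / 2 ^ j) (hG : 2 ^ t ≤ 2 ^ 2 ^ γ * K) :
    ∃ h : Fin (2 ^ logHashes γ j) → Fin (2 ^ t) → Fin (buckets K j),
      IsExpanding h (2 ^ γ * scale j) (reach K j) := by
  have hacc := four_le_acc j
  have hscale := scale_pos j
  have hloss : 0 < loss j := by unfold loss; positivity
  have hreach : 0 < reach K j := by unfold reach; positivity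
  rw [two_pow_logHashes]
  refine exists_isExpanding (by positivity) hloss hreach ?_
  have h1 : 2 ^ (2 ^ γ + j) ≤ 2 ^ (2 ^ γ * scale j) := by
    refine Nat.pow_le_pow_right (by norm_num) ?_
    have h2 := Nat.mul_le_mul_left (2 ^ γ) (le_scale j)
    have h3 : 1 ≤ 2 ^ γ := Nat.one_le_two_pow
    nlinarith
  have h4 : K ≤ 2 ^ j * (2 * (K / 2 ^ j)) := by
    have := Nat.lt_mul_div_succ K (show 0 < 2 ^ j by positivity)
    nlinarith [show 0 < 2 ^ j by positivity]
  have h5 : 32 * (K / 2 ^ j) ≤ reach K j := by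
    unfold reach; nlinarith
  calc 12 * 2 ^ t ≤ 12 * (2 ^ 2 ^ γ * K) := Nat.mul_le_mul_left _ hG
    _ ≤ 12 * (2 ^ 2 ^ γ * (2 ^ j * (2 * (K / 2 ^ j)))) := by gcongr
    _ = 2 ^ (2 ^ γ + j) * (24 * (K / 2 ^ j)) := by rw [pow_add]; ring
    _ ≤ 2 ^ (2 ^ γ * scale j) * reach K j := Nat.mul_le_mul h1 (by omega)

/-- The iteration of the decoding rounds. -/
theorem exists_iterate {X : Type*} {A : Set (X → ℝ)} (h0 : (0 : X → ℝ) ∈ A) {t K γ : ℕ}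
    (hK : 64 * K ≤ 2 ^ t)
    (y : X → Fin (2 ^ t) → ℝ) (J : ℕ) (hJ : ∀ j < J, 0 < K / 2 ^ j)
    (hy : ∀ j < J, ∃ h : Fin (2 ^ logHashes γ j) → Fin (2 ^ t) → Fin (buckets K j),
      IsExpanding h (2 ^ γ * scale j) (reach K j) ∧
        ∀ l b, (fun x => bucket h (y x) l b) ∈ A) :
    ∃ cur : Fin (2 ^ t) → X → ℝ,
      Computes A (∑ j ∈ Finset.range J, roundTime t K γ j) (Set.range cur) ∧
      ∀ x (S : Finset (Fin (2 ^ t))), S.card ≤ K → ∃ S' : Finset (Fin (2 ^ t)),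
        S'.card ≤ K / 2 ^ J ∧ ∑ v ∈ S'ᶜ, |y x v - cur v x| ≤
          (∏ j ∈ Finset.range J, (1 + 5 / (acc j : ℝ))) * ∑ v ∈ Sᶜ, |y x v| := by
  induction J with
  | zero =>
    refine ⟨fun _ => 0, Computes.of_subset ?_, fun x S hS => ⟨S, by simpa using hS, by simp⟩⟩
    rintro _ ⟨v, rfl⟩
    exact h0
  | succ J ih =>
    obtain ⟨cur, hcur, hrec⟩ := ih (fun j hj => hJ j (by omega)) (fun j hj => hy j (by omega))
    have hacc := four_le_acc J
    have hpos := hJ J (by omega)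
    obtain ⟨h, hexp, hmem⟩ := hy J (by omega)
    obtain ⟨new, hnew, hstep⟩ := hexp.round_computes (A := A ∪ Set.range cur) (Or.inl h0)
      (by have := scale_pos J; positivity) (two_pow_logHashes γ J) hacc hpos
      (by unfold reach; nlinarith [Nat.mul_le_mul hpos hacc])
      (head_mul_acc_le J hK) y (fun l b => Or.inl (hmem l b)) cur
      (fun v => Or.inr ⟨v, rfl⟩)
    refine ⟨new, ?_, fun x S hS => ?_⟩
    · rw [Finset.sum_range_succ]
      exact (hcur.trans hnew).mono_right Set.subset_union_right
    · obtain ⟨S₁, hS₁, h₁⟩ := hrec x S hS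
      obtain ⟨S₂, hS₂, h₂⟩ := hstep x S₁ hS₁
      refine ⟨S₂, ?_, h₂.trans ?_⟩
      · rwa [Nat.div_div_eq_div_mul, ← pow_succ] at hS₂
      · rw [Finset.prod_range_succ, mul_comm _ (1 + 5 / (acc J : ℝ)), mul_assoc]
        exact mul_le_mul_of_nonneg_left h₁ (by positivity)

/-- As `acc j ≥ 4 (j+1)²`, the exponents are summable, by telescoping `1/(4 (j+1)²) ≤ (1/(j+1) -
1/(j+2))/2`. -/
theorem prod_le_exp (J : ℕ) : ∏ j ∈ Finset.range J, (1 + 5 / (acc j : ℝ)) ≤ Real.exp (5 / 2) := by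
  have h1 : ∀ J : ℕ, ∑ j ∈ Finset.range J, 5 / (acc j : ℝ) ≤ 5 / 2 - 5 / (2 * (J + 1)) := by
    intro J
    induction J with
    | zero => norm_num
    | succ J ih =>
      rw [Finset.sum_range_succ]
      have hJ : (0 : ℝ) < (J : ℝ) + 1 := by positivity
      have h2 : (4 * ((J : ℝ) + 1) ^ 2) ≤ acc J := by exact_mod_cast acc_ge J
      have h3 : 5 / (acc J : ℝ) ≤ 5 / (4 * ((J : ℝ) + 1) ^ 2) :=
        div_le_div_of_nonneg_left (by norm_num) (by positivity) h2
      have h4 : 5 / (4 * ((J : ℝ) + 1) ^ 2) ≤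
          5 / (2 * ((J : ℝ) + 1)) - 5 / (2 * ((J : ℝ) + 1 + 1)) := by
        rw [div_sub_div _ _ (by positivity) (by positivity),
          div_le_div_iff₀ (by positivity) (by positivity)]
        nlinarith [mul_nonneg (Nat.cast_nonneg (α := ℝ) J) hJ.le]
      push_cast
      linarith
  calc ∏ j ∈ Finset.range J, (1 + 5 / (acc j : ℝ))
      ≤ ∏ j ∈ Finset.range J, Real.exp (5 / (acc j : ℝ)) := by
        refine Finset.prod_le_prod (fun j _ => by positivity) fun j _ => ?_
        rw [add_comm]
        exact Real.add_one_le_exp _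
    _ = Real.exp (∑ j ∈ Finset.range J, 5 / (acc j : ℝ)) := (Real.exp_sum _ _).symm
    _ ≤ Real.exp (5 / 2) := by
        refine Real.exp_le_exp.2 ((h1 J).trans ?_)
        have : (0 : ℝ) ≤ 5 / (2 * (J + 1)) := by positivity
        linarith

/-- Round `j` uses a constant times `2^γ (scale j)^11 (K/2^j)` measurements; the halving beats the
polynomial growth. -/
theorem exists_sum_measurements_le :
    ∃ C : ℝ, 0 < C ∧ ∀ K γ J : ℕ,
      ((∑ j ∈ Finset.range J, 2 ^ logHashes γ j * buckets K j : ℕ) : ℝ) ≤ C * (2 ^ γ * K) := by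
  have hsum : Summable fun j : ℕ => ((j + 1 : ℕ) : ℝ) ^ 11 * (1 / 2) ^ (j + 1) :=
    (summable_nat_add_iff (f := fun j : ℕ => (j : ℝ) ^ 11 * (1 / 2 : ℝ) ^ j) 1).2
      (summable_pow_mul_geometric_of_norm_lt_one 11 (by norm_num))
  set c₀ : ℝ := 64 * 65536 * 4 * 2048 * 2 with hc₀
  refine ⟨c₀ * ∑' j : ℕ, ((j + 1 : ℕ) : ℝ) ^ 11 * (1 / 2) ^ (j + 1), ?_, fun K γ J => ?_⟩
  · refine mul_pos (by norm_num [hc₀]) (hsum.tsum_pos (fun j => by positivity) 0 (by norm_num))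
  have hterm : ∀ j, ((2 ^ logHashes γ j * buckets K j : ℕ) : ℝ) ≤
      c₀ * (2 ^ γ * K) * (((j + 1 : ℕ) : ℝ) ^ 11 * (1 / 2) ^ (j + 1)) := by
    intro j
    have e : 2 ^ logHashes γ j * buckets K j =
        64 * 65536 * 4 * 2 ^ γ * scale j ^ 11 * (K / 2 ^ j) := by
      rw [two_pow_logHashes]
      unfold buckets reach loss acc
      ring
    have h1 : (scale j : ℝ) ^ 11 ≤ (2 * ((j + 1 : ℕ) : ℝ)) ^ 11 :=
      pow_le_pow_left₀ (Nat.cast_nonneg _) (by exact_mod_cast scale_le j) _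
    have h2 : ((K / 2 ^ j : ℕ) : ℝ) ≤ K * (1 / 2) ^ j := by
      refine Nat.cast_div_le.trans (le_of_eq ?_)
      push_cast
      rw [one_div, inv_pow, div_eq_mul_inv]
    rw [e]
    calc ((64 * 65536 * 4 * 2 ^ γ * scale j ^ 11 * (K / 2 ^ j) : ℕ) : ℝ)
        = 64 * 65536 * 4 * 2 ^ γ * (scale j : ℝ) ^ 11 * ((K / 2 ^ j : ℕ) : ℝ) := by
          push_cast; ring
      _ ≤ 64 * 65536 * 4 * 2 ^ γ * (2 * ((j + 1 : ℕ) : ℝ)) ^ 11 * (K * (1 / 2) ^ j) := by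
          gcongr
      _ = _ := by rw [hc₀]; ring
  rw [Nat.cast_sum]
  calc _ ≤ ∑ j ∈ Finset.range J,
        c₀ * (2 ^ γ * K) * (((j + 1 : ℕ) : ℝ) ^ 11 * (1 / 2) ^ (j + 1)) :=
        Finset.sum_le_sum fun j _ => hterm j
    _ = c₀ * (2 ^ γ * K) * ∑ j ∈ Finset.range J,
        (((j + 1 : ℕ) : ℝ) ^ 11 * (1 / 2) ^ (j + 1)) := (Finset.mul_sum _ _ _).symm
    _ ≤ c₀ * (2 ^ γ * K) * ∑' j : ℕ, ((j + 1 : ℕ) : ℝ) ^ 11 * (1 / 2) ^ (j + 1) :=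
        mul_le_mul_of_nonneg_left (hsum.sum_le_tsum _ fun j _ => by positivity) (by
          rw [hc₀]; positivity)
    _ = _ := by ring

/-- A round uses `d ≤ 2^14 (t+1)^6` hash functions, and sorting `d` values costs at most `2 d³`
gates per coordinate. The number of rounds adds the last factor `t + 1`. -/
theorem exists_sum_overhead_le :
    ∃ C : ℕ, 0 < C ∧ ∀ t γ J : ℕ, J ≤ t + 1 → 2 ^ γ ≤ 2 * (t + 1) →
      ∑ j ∈ Finset.range J, 2 ^ t * (2 * 2 ^ logHashes γ j +
        logHashes γ j ^ 2 * 2 ^ (logHashes γ j + 1) + 2 * t ^ 2 + 5) ≤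
          C * (2 ^ t * (t + 1) ^ 19) := by
  refine ⟨2 ^ 48, by norm_num, fun t γ J hJ hγ => ?_⟩
  have hterm : ∀ j ∈ Finset.range J, 2 ^ t * (2 * 2 ^ logHashes γ j +
      logHashes γ j ^ 2 * 2 ^ (logHashes γ j + 1) + 2 * t ^ 2 + 5) ≤
      2 ^ t * (2 ^ 48 * (t + 1) ^ 18) := by
    intro j hj
    refine Nat.mul_le_mul_left _ ?_
    have hjt : j + 1 ≤ t + 1 := by have := Finset.mem_range.1 hj; omega
    set d := 2 ^ logHashes γ j with hd
    have hd1 : d ≤ 2 ^ 14 * (t + 1) ^ 6 := by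
      have hsc : scale j ≤ 2 * (t + 1) := (scale_le j).trans (by omega)
      have e : d = 256 * 2 ^ γ * scale j ^ 5 := by
        rw [hd, two_pow_logHashes]; unfold loss acc; ring
      rw [e]
      calc 256 * 2 ^ γ * scale j ^ 5 ≤ 256 * (2 * (t + 1)) * (2 * (t + 1)) ^ 5 := by gcongr
        _ = 2 ^ 14 * (t + 1) ^ 6 := by ring
    have hk : logHashes γ j ≤ d := Nat.lt_two_pow_self.le
    have h1 : logHashes γ j ^ 2 * 2 ^ (logHashes γ j + 1) ≤ 2 * d ^ 3 := by
      calc logHashes γ j ^ 2 * 2 ^ (logHashes γ j + 1) ≤ d ^ 2 * (d * 2) := by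
            rw [pow_succ 2]; gcongr
        _ = 2 * d ^ 3 := by ring
    have h2 : d ^ 3 ≤ 2 ^ 42 * (t + 1) ^ 18 := by
      calc d ^ 3 ≤ (2 ^ 14 * (t + 1) ^ 6) ^ 3 := Nat.pow_le_pow_left hd1 3
        _ = 2 ^ 42 * (t + 1) ^ 18 := by ring
    have h3 : d ≤ d ^ 3 := Nat.le_self_pow (by norm_num) d
    have h4 : t ^ 2 ≤ (t + 1) ^ 18 := (Nat.pow_le_pow_left (Nat.le_succ t) 2).trans
      (Nat.pow_le_pow_right (Nat.succ_pos t) (by norm_num))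
    have h5 : 1 ≤ (t + 1) ^ 18 := Nat.one_le_pow _ _ (Nat.succ_pos t)
    omega
  calc _ ≤ ∑ _j ∈ Finset.range J, 2 ^ t * (2 ^ 48 * (t + 1) ^ 18) := Finset.sum_le_sum hterm
    _ = J * (2 ^ t * (2 ^ 48 * (t + 1) ^ 18)) := by simp
    _ ≤ (t + 1) * (2 ^ t * (2 ^ 48 * (t + 1) ^ 18)) := Nat.mul_le_mul_right _ hJ
    _ = _ := by ring

theorem sum_roundTime_le {C₁ : ℝ} {C₂ : ℕ} (hC₁ : 0 < C₁)
    (hT : ∀ t γ J : ℕ, J ≤ t + 1 → 2 ^ γ ≤ 2 * (t + 1) →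
      ∑ j ∈ Finset.range J, 2 ^ t * (2 * 2 ^ logHashes γ j +
        logHashes γ j ^ 2 * 2 ^ (logHashes γ j + 1) + 2 * t ^ 2 + 5) ≤
          C₂ * (2 ^ t * (t + 1) ^ 19)) {t K γ J e m : ℕ} (hK : K ≤ 2 ^ t) (het : e ≤ t + 1)
    (hJ : J ≤ t + 1) (hγ : 2 ^ γ ≤ 2 * e)
    (hm : m = ∑ j ∈ Finset.range J, 2 ^ logHashes γ j * buckets K j)
    (hmle : (m : ℝ) ≤ C₁ * (2 * e * K)) :
    ((∑ j ∈ Finset.range J, roundTime t K γ j : ℕ) : ℝ) ≤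
      (2 * C₁ + C₂) * (2 ^ t * (t + 1) ^ 19) := by
  simp only [roundTime]
  rw [Finset.sum_add_distrib, ← hm, Nat.cast_add, add_mul]
  refine add_le_add (hmle.trans ?_) (by exact_mod_cast hT t γ J hJ (hγ.trans (by omega)))
  have h4 : (K : ℝ) ≤ 2 ^ t := by exact_mod_cast hK
  have h5 : (e : ℝ) ≤ (t + 1) ^ 19 := by
    exact_mod_cast het.trans (Nat.le_self_pow (by norm_num) _)
  have h6 : (e : ℝ) * K ≤ (t + 1) ^ 19 * 2 ^ t :=
    mul_le_mul h5 h4 (Nat.cast_nonneg _) (by positivity)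
  calc C₁ * (2 * e * K) = 2 * C₁ * (e * K) := by ring
    _ ≤ 2 * C₁ * ((t + 1) ^ 19 * 2 ^ t) := mul_le_mul_of_nonneg_left h6 (by positivity)
    _ = 2 * C₁ * (2 ^ t * (t + 1) ^ 19) := by rw [mul_comm ((2 : ℝ) ^ t)]

end Recovery

/-- The contents of the buckets of several hash families are linear measurements. -/
theorem exists_bucket_matrix {V : Type*} [Fintype V] {J m : ℕ} (d B : Fin J → ℕ)
    (hm : m = ∑ j, d j * B j) (h : ∀ j, Fin (d j) → V → Fin (B j)) :
    ∃ A : Matrix (Fin m) V ℝ, ∀ j l b, ∃ i, ∀ y : V → ℝ,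
      A.mulVec y i = bucket (h j) y l b := by
  let ι := Σ j : Fin J, Fin (d j) × Fin (B j)
  have hcard : Fintype.card ι = m := by simp [ι, hm]
  let eq : ι ≃ Fin m := Fintype.equivFinOfCardEq hcard
  refine ⟨fun i v => if h (eq.symm i).1 (eq.symm i).2.1 v = (eq.symm i).2.2 then 1 else 0,
    fun j l b => ⟨eq ⟨j, l, b⟩, fun y => ?_⟩⟩
  simp only [Matrix.mulVec, dotProduct, bucket, Finset.sum_filter, ite_mul, one_mul, zero_mul]
  rw [Equiv.symm_apply_apply]

open Recovery in
/-- Deterministic sparse recovery: with `O(K log (N / K))` measurements and nearly linear time,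
the `ℓ₁` error of the best `K`-sparse approximation is attained up to a constant factor. -/
theorem exists_sparse_recovery :
    ∃ C : ℝ, 0 < C ∧ ∀ t K : ℕ, 0 < K → 64 * K ≤ 2 ^ t →
      ∃ (m : ℕ) (A : Matrix (Fin m) (Fin (2 ^ t)) ℝ) (T : ℕ),
        (m : ℝ) ≤ C * (K * (t - Nat.log 2 K + 1 : ℕ)) ∧ (T : ℝ) ≤ C * (2 ^ t * (t + 1) ^ 19) ∧
        ∀ {X : Type} (y : X → Fin (2 ^ t) → ℝ), ∃ z : Fin (2 ^ t) → X → ℝ,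
          Computes (insert 0 (Set.range fun i x => A.mulVec (y x) i)) T (Set.range z) ∧
          ∀ x (S : Finset (Fin (2 ^ t))), S.card ≤ K →
            ∑ v, |y x v - z v x| ≤ C * ∑ v ∈ Sᶜ, |y x v| := by
  obtain ⟨C₁, hC₁, hm⟩ := exists_sum_measurements_le
  obtain ⟨C₂, hC₂, hT⟩ := exists_sum_overhead_le
  refine ⟨2 * C₁ + C₂ + Real.exp (5 / 2), by positivity, fun t K hK hKt => ?_⟩
  -- `e` is about `log₂(N/K)` and `2^γ` lies between `e` and `2e`. `J` is chosen so that `K / 2^J =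
  -- 0`, that is, no head is left.
  set e := t - Nat.log 2 K + 1 with he
  set γ := Nat.clog 2 e with hγ
  set J := Nat.log 2 K + 1 with hJ
  have hγe : 2 ^ γ ≤ 2 * e := two_pow_clog_le (Nat.succ_pos _)
  have hlog : Nat.log 2 K ≤ t := by
    have := Nat.log_mono_right (b := 2) (show K ≤ 2 ^ t by omega)
    rwa [Nat.log_pow (by norm_num)] at this
  have hG : 2 ^ t ≤ 2 ^ 2 ^ γ * K := by
    calc 2 ^ t = 2 ^ (t - Nat.log 2 K) * 2 ^ Nat.log 2 K := by
          rw [← pow_add, Nat.sub_add_cancel hlog]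
      _ ≤ 2 ^ 2 ^ γ * K := by
          refine Nat.mul_le_mul (Nat.pow_le_pow_right (by norm_num) ?_) (Nat.pow_log_le_self 2 hK.ne')
          exact (Nat.le_succ _).trans (Nat.le_pow_clog (by norm_num) e)
  have hJpos : ∀ j < J, 0 < K / 2 ^ j := fun j hj =>
    Nat.div_pos ((Nat.pow_le_pow_right (by norm_num) (by omega)).trans
      (Nat.pow_log_le_self 2 hK.ne')) (by positivity)
  have hhash : ∀ j : Fin J, ∃ h : Fin (2 ^ logHashes γ j) → Fin (2 ^ t) → Fin (buckets K j),
      IsExpanding h (2 ^ γ * scale j) (reach K j) := fun j => exists_hash (hJpos j j.2) hG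
  choose h hexp using hhash
  obtain ⟨m, hcard⟩ : ∃ m, m = ∑ j ∈ Finset.range J, 2 ^ logHashes γ j * buckets K j := ⟨_, rfl⟩
  obtain ⟨A, hA⟩ := exists_bucket_matrix (m := m) (fun j : Fin J => 2 ^ logHashes γ j)
    (fun j => buckets K j) (hcard.trans (Finset.sum_range _)) h
  have hmle : (m : ℝ) ≤ C₁ * (2 * e * K) := by
    rw [hcard]
    refine (hm K γ J).trans ?_
    gcongr
    exact_mod_cast hγe
  refine ⟨_, A, ∑ j ∈ Finset.range J, roundTime t K γ j, ?_, ?_, fun {X} y => ?_⟩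
  · refine hmle.trans ?_
    have h1 : (0 : ℝ) ≤ (K : ℝ) * (e : ℕ) := by positivity
    have h2 := Real.exp_pos (5 / 2)
    have h3 : (0 : ℝ) ≤ (C₂ : ℝ) := Nat.cast_nonneg _
    nlinarith [mul_nonneg h2.le h1, mul_nonneg h3 h1]
  · refine (sum_roundTime_le hC₁ hT (by omega) (by omega) (by omega) hγe hcard hmle).trans ?_
    exact mul_le_mul_of_nonneg_right (by linarith [Real.exp_pos (5 / 2)]) (by positivity)
  · obtain ⟨z, hz, hrec⟩ := exists_iterate (A := insert 0 (Set.range fun i x => A.mulVec (y x) i))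
      (Set.mem_insert _ _) hKt y J hJpos (fun j hj => ⟨h ⟨j, hj⟩, hexp ⟨j, hj⟩, fun l b => by
        obtain ⟨i, hi⟩ := hA ⟨j, hj⟩ l b
        exact Or.inr ⟨i, funext fun x => hi (y x)⟩⟩)
    refine ⟨z, hz, fun x S hS => ?_⟩
    obtain ⟨S', hS', hle⟩ := hrec x S hS
    have : K / 2 ^ J = 0 := Nat.div_eq_of_lt (Nat.lt_pow_succ_log_self (by norm_num) K)
    rw [this, Nat.le_zero, Finset.card_eq_zero] at hS'
    subst hS'
    rw [Finset.compl_empty] at hle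
    refine hle.trans (mul_le_mul_of_nonneg_right ((prod_le_exp J).trans ?_)
      (Finset.sum_nonneg fun _ _ => abs_nonneg _))
    have : (0 : ℝ) ≤ (C₂ : ℝ) := Nat.cast_nonneg _
    linarith

/-! ### Duality for the Earth-Mover norm -/

section EMD

variable {Δ : ℕ}

theorem pixelDist_nonneg (p q : Pixel Δ) : 0 ≤ pixelDist p q := by unfold pixelDist; positivity

theorem pixelDist_comm (p q : Pixel Δ) : pixelDist p q = pixelDist q p := by
  unfold pixelDist
  rw [abs_sub_comm, abs_sub_comm (((p.2 : ℕ) : ℝ))]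

theorem pixelDist_triangle (p q r : Pixel Δ) : pixelDist p r ≤ pixelDist p q + pixelDist q r := by
  unfold pixelDist
  have h1 := abs_sub_le (((p.1 : ℕ) : ℝ)) ((q.1 : ℕ) : ℝ) ((r.1 : ℕ) : ℝ)
  have h2 := abs_sub_le (((p.2 : ℕ) : ℝ)) ((q.2 : ℕ) : ℝ) ((r.2 : ℕ) : ℝ)
  linarith

theorem pixelDist_le (p q : Pixel Δ) : pixelDist p q ≤ 2 * Δ := by
  have h : ∀ i j : Fin Δ, |((i : ℕ) : ℝ) - ((j : ℕ) : ℝ)| ≤ Δ := fun i j => by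
    have hi : ((i : ℕ) : ℝ) ≤ Δ := by exact_mod_cast i.2.le
    have hj : ((j : ℕ) : ℝ) ≤ Δ := by exact_mod_cast j.2.le
    rw [abs_le]
    constructor <;> linarith [Nat.cast_nonneg (α := ℝ) (i : ℕ), Nat.cast_nonneg (α := ℝ) (j : ℕ)]
  unfold pixelDist
  linarith [h p.1 q.1, h p.2 q.2]

/-- The product coupling; when the total mass is zero all entries vanish and division by zero gives
the right value. It makes the set defining `emdStar` nonempty, without which its infimum would be a
default value. -/
theorem exists_isFlow {x y : Pixel Δ → ℝ} (hx : ∀ p, 0 ≤ x p) (hy : ∀ p, 0 ≤ y p)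
    (h : l1Norm x = l1Norm y) : ∃ γ, IsFlow x y γ := by
  simp only [l1Norm, abs_of_nonneg (hx _), abs_of_nonneg (hy _)] at h
  have hz : ∀ {u : Pixel Δ → ℝ}, (∀ p, 0 ≤ u p) → ∀ p, u p * (∑ q, u q) / (∑ q, u q) = u p := by
    intro u hu p
    by_cases h0 : ∑ q, u q = 0
    · rw [h0, (Finset.sum_eq_zero_iff_of_nonneg fun q _ => hu q).1 h0 p (Finset.mem_univ _)]
      simp
    · rw [mul_div_assoc, div_self h0, mul_one]
  refine ⟨fun p q => x p * y q / ∑ q, y q, fun p q => ?_, fun p => ?_, fun q => ?_⟩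
  · exact div_nonneg (mul_nonneg (hx p) (hy q)) (Finset.sum_nonneg fun q _ => hy q)
  · rw [← Finset.sum_div, ← Finset.mul_sum, ← h, hz hx]
  · rw [← Finset.sum_div, ← Finset.sum_mul, ← h, mul_comm, h, hz hy]

theorem flowCost_nonneg {x y : Pixel Δ → ℝ} {γ : Pixel Δ → Pixel Δ → ℝ} (h : IsFlow x y γ) :
    0 ≤ flowCost γ :=
  Finset.sum_nonneg fun p _ => Finset.sum_nonneg fun q _ =>
    mul_nonneg (h.nonneg p q) (pixelDist_nonneg p q)

theorem emdStar_nonneg (x y : Pixel Δ → ℝ) : 0 ≤ emdStar x y := by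
  refine Real.sInf_nonneg ?_
  rintro r ⟨γ, hγ, rfl⟩
  exact flowCost_nonneg hγ

theorem l1Norm_nonneg (x : Pixel Δ → ℝ) : 0 ≤ l1Norm x :=
  Finset.sum_nonneg fun _ _ => abs_nonneg _

/-- A `1`-Lipschitz function bounded by `2 Δ` bounds the norm from below. -/
theorem sum_mul_le_emdNorm {f : Pixel Δ → ℝ} (hf : ∀ p q, f p - f q ≤ pixelDist p q)
    (hb : ∀ p, |f p| ≤ 2 * Δ) (w : Pixel Δ → ℝ) : ∑ p, w p * f p ≤ emdNorm w := by
  refine le_csInf ⟨_, 0, 0, w, by simp, rfl, fun _ => le_rfl, fun _ => le_rfl, rfl⟩ ?_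
  rintro r ⟨x, y, z, rfl, hxy, hx, hy, rfl⟩
  have h1 : ∑ p, x p * f p - ∑ p, y p * f p ≤ emdStar x y := by
    obtain ⟨γ₀, hγ₀⟩ := exists_isFlow hx hy hxy
    refine le_csInf ⟨_, γ₀, hγ₀, rfl⟩ ?_
    rintro r ⟨γ, hγ, rfl⟩
    have e1 : ∑ p, x p * f p = ∑ p, ∑ q, γ p q * f p := by
      refine Finset.sum_congr rfl fun p _ => ?_
      rw [← hγ.out_eq, Finset.sum_mul]
    have e2 : ∑ q, y q * f q = ∑ p, ∑ q, γ p q * f q := by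
      rw [Finset.sum_comm]
      refine Finset.sum_congr rfl fun q _ => ?_
      rw [← hγ.in_eq, Finset.sum_mul]
    rw [e1, e2, ← Finset.sum_sub_distrib, flowCost]
    refine Finset.sum_le_sum fun p _ => ?_
    rw [← Finset.sum_sub_distrib]
    refine Finset.sum_le_sum fun q _ => ?_
    rw [← mul_sub]
    exact mul_le_mul_of_nonneg_left (hf p q) (hγ.nonneg p q)
  have h2 : ∑ p, z p * f p ≤ 2 * Δ * l1Norm z := by
    rw [l1Norm, Finset.mul_sum]
    refine Finset.sum_le_sum fun p _ => ?_
    calc z p * f p ≤ |z p * f p| := le_abs_self _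
      _ = |f p| * |z p| := by rw [abs_mul, mul_comm]
      _ ≤ 2 * Δ * |z p| := mul_le_mul_of_nonneg_right (hb p) (abs_nonneg _)
  have e : ∑ p, (x - y + z) p * f p =
      ∑ p, x p * f p - ∑ p, y p * f p + ∑ p, z p * f p := by
    rw [← Finset.sum_sub_distrib, ← Finset.sum_add_distrib]
    refine Finset.sum_congr rfl fun p _ => ?_
    simp only [Pi.add_apply, Pi.sub_apply]
    ring
  rw [e]
  linarith

/-- The moves form an explicit flow between their two marginals, and the rest `z` is paid for at
price `2Δ`. -/
theorem emdNorm_le_of_nonneg {ι : Type*} [Fintype ι] (e : ι → ℝ) (he : ∀ i, 0 ≤ e i)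
    (a b : ι → Pixel Δ) (z w : Pixel Δ → ℝ)
    (hw : ∀ p, w p = ∑ i, e i * ((if a i = p then 1 else 0) - if b i = p then 1 else 0) + z p) :
    emdNorm w ≤ ∑ i, e i * pixelDist (a i) (b i) + 2 * Δ * l1Norm z := by
  set x : Pixel Δ → ℝ := fun p => ∑ i, if a i = p then e i else 0 with hx
  set y : Pixel Δ → ℝ := fun p => ∑ i, if b i = p then e i else 0 with hy
  have hx0 : ∀ p, 0 ≤ x p := fun p => Finset.sum_nonneg fun i _ => by split_ifs <;> simp [he]
  have hy0 : ∀ p, 0 ≤ y p := fun p => Finset.sum_nonneg fun i _ => by split_ifs <;> simp [he]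
  have hflow : IsFlow x y fun p q => ∑ i, if a i = p then if b i = q then e i else 0 else 0 := by
    refine ⟨fun p q => Finset.sum_nonneg fun i _ => by split_ifs <;> simp [he],
      fun p => ?_, fun q => ?_⟩
    · rw [Finset.sum_comm]
      refine Finset.sum_congr rfl fun i _ => ?_
      split_ifs <;> simp
    · rw [Finset.sum_comm]
      refine Finset.sum_congr rfl fun i _ => ?_
      simp
  have hcost : flowCost (fun p q => ∑ i, if a i = p then if b i = q then e i else 0 else 0) =
      ∑ i, e i * pixelDist (a i) (b i) := by
    simp only [flowCost, Finset.sum_mul]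
    have : ∀ p : Pixel Δ, ∑ q, ∑ i, (if a i = p then if b i = q then e i else 0 else 0) *
        pixelDist p q = ∑ i, if a i = p then e i * pixelDist p (b i) else 0 := fun p => by
      rw [Finset.sum_comm]
      refine Finset.sum_congr rfl fun i _ => ?_
      split_ifs <;> simp [ite_mul]
    simp only [this]
    rw [Finset.sum_comm]
    refine Finset.sum_congr rfl fun i _ => ?_
    simp
  have hstar : emdStar x y ≤ ∑ i, e i * pixelDist (a i) (b i) := by
    rw [← hcost]
    refine csInf_le ⟨0, ?_⟩ ⟨_, hflow, rfl⟩
    rintro r ⟨γ, hγ, rfl⟩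
    exact flowCost_nonneg hγ
  refine le_trans (b := emdStar x y + 2 * Δ * l1Norm z)
    (csInf_le ⟨0, ?_⟩ ⟨x, y, z, ?_, ?_, hx0, hy0, rfl⟩) (add_le_add hstar le_rfl)
  · rintro r ⟨x, y, z, -, -, -, -, rfl⟩
    exact add_nonneg (emdStar_nonneg x y) (mul_nonneg (by positivity) (l1Norm_nonneg z))
  · funext p
    simp only [Pi.add_apply, Pi.sub_apply, hw, hx, hy, ← Finset.sum_sub_distrib]
    congr 1
    refine Finset.sum_congr rfl fun i _ => ?_
    split_ifs <;> simp
  · have h1 : l1Norm x = ∑ p, x p := Finset.sum_congr rfl fun p _ => abs_of_nonneg (hx0 p)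
    have h2 : l1Norm y = ∑ p, y p := Finset.sum_congr rfl fun p _ => abs_of_nonneg (hy0 p)
    rw [h1, h2, hx, hy, Finset.sum_comm, Finset.sum_comm (s := Finset.univ (α := Pixel Δ))]
    simp

/-- Moving mass `e i` from `a i` to `b i` bounds the norm from above. -/
theorem emdNorm_le {ι : Type*} [Fintype ι] (e : ι → ℝ) (a b : ι → Pixel Δ) (z w : Pixel Δ → ℝ)
    (hw : ∀ p, w p = ∑ i, e i * ((if a i = p then 1 else 0) - if b i = p then 1 else 0) + z p) :
    emdNorm w ≤ ∑ i, |e i| * pixelDist (a i) (b i) + 2 * Δ * l1Norm z := by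
  -- A negative amount is moved in the opposite direction.
  refine (emdNorm_le_of_nonneg (fun i => |e i|) (fun i => abs_nonneg _)
    (fun i => if 0 ≤ e i then a i else b i) (fun i => if 0 ≤ e i then b i else a i) z w
    fun p => ?_).trans (le_of_eq ?_)
  · rw [hw]
    congr 1
    refine Finset.sum_congr rfl fun i _ => ?_
    by_cases h : 0 ≤ e i
    · simp [h, abs_of_nonneg h]
    · simp only [h, if_false, abs_of_neg (not_le.1 h)]
      ring
  · congr 1
    refine Finset.sum_congr rfl fun i _ => ?_
    by_cases h : 0 ≤ e i
    · simp [h]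
    · simp [h, pixelDist_comm]

/-- The distance to a non-empty set of pixels. -/
noncomputable def distTo (S : Finset (Pixel Δ)) (hS : S.Nonempty) (p : Pixel Δ) : ℝ :=
  S.inf' hS fun s => pixelDist p s

theorem distTo_nonneg (S : Finset (Pixel Δ)) (hS : S.Nonempty) (p : Pixel Δ) :
    0 ≤ distTo S hS p :=
  Finset.le_inf' _ _ fun _ _ => pixelDist_nonneg _ _

/-- The distances to the support of a sparse approximation bound its error from below. -/
theorem sum_mul_distTo_le_emdNorm (S : Finset (Pixel Δ)) (hS : S.Nonempty) (x x' : Pixel Δ → ℝ)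
    (hx' : ∀ p ∉ S, x' p = 0) : ∑ p, x p * distTo S hS p ≤ emdNorm (x - x') := by
  -- The distance to `S` vanishes wherever `x'` does not, so `x'` drops out of the pairing.
  have h := sum_mul_le_emdNorm (f := distTo S hS) (fun p q => ?_) (fun p => ?_) (x - x')
  · refine le_of_eq_of_le (Finset.sum_congr rfl fun p _ => ?_) h
    by_cases hp : p ∈ S
    · have : distTo S hS p = 0 := by
        refine le_antisymm ((Finset.inf'_le _ hp).trans (le_of_eq ?_)) (distTo_nonneg S hS p)
        simp [pixelDist]
      rw [this, mul_zero, mul_zero]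
    · simp [hx' p hp]
  · obtain ⟨s, hs, hsq⟩ := Finset.exists_mem_eq_inf' hS fun s => pixelDist q s
    have h1 : distTo S hS p ≤ pixelDist p s := Finset.inf'_le _ hs
    have h2 : distTo S hS q = pixelDist q s := hsq
    have := pixelDist_triangle p q s
    linarith
  · rw [abs_of_nonneg (distTo_nonneg S hS p)]
    obtain ⟨s, hs⟩ := hS
    exact (Finset.inf'_le _ hs).trans (pixelDist_le p s)

end EMD

/-! ### The pyramid of dyadic cells -/

/-- The dyadic cells of depth at most `L`; those of depth `g` have side `2 ^ (L - g)`. -/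
abbrev DyadicCell (L : ℕ) : Type := Σ g : Fin (L + 1), Fin (2 ^ (g : ℕ)) × Fin (2 ^ (g : ℕ))

namespace DyadicCell

open Finset

variable {Δ L : ℕ}

/-- The cell of depth `g` that contains a pixel. -/
def at_ (hL : Δ ≤ 2 ^ L) (g : Fin (L + 1)) (p : Pixel Δ) : Fin (2 ^ (g : ℕ)) × Fin (2 ^ (g : ℕ)) :=
  have h : ∀ i : Fin Δ, (i : ℕ) / 2 ^ (L - g) < 2 ^ (g : ℕ) := fun i =>
    Nat.div_lt_of_lt_mul (by
      rw [← pow_add, Nat.sub_add_cancel (Nat.lt_succ_iff.1 g.2)]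
      exact i.2.trans_le hL)
  (⟨p.1 / 2 ^ (L - g), h _⟩, ⟨p.2 / 2 ^ (L - g), h _⟩)

/-- The total mass of an image in a cell. -/
def mass (hL : Δ ≤ 2 ^ L) (x : Pixel Δ → ℝ) (v : DyadicCell L) : ℝ :=
  ∑ p, if at_ hL v.1 p = v.2 then x p else 0

/-- The pixel nearest to a point of the plane. -/
def snap (hΔ : 0 < Δ) (i j : ℕ) : Pixel Δ :=
  (⟨min i (Δ - 1), by omega⟩, ⟨min j (Δ - 1), by omega⟩)

/-- The corner of a cell. -/
def corner (hΔ : 0 < Δ) (v : DyadicCell L) : Pixel Δ :=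
  snap hΔ (v.2.1 * 2 ^ (L - v.1)) (v.2.2 * 2 ^ (L - v.1))

/-- The corner of the parent of a cell. -/
def parentCorner (hΔ : 0 < Δ) (v : DyadicCell L) : Pixel Δ :=
  snap hΔ (v.2.1 / 2 * (2 * 2 ^ (L - v.1))) (v.2.2 / 2 * (2 * 2 ^ (L - v.1)))

/-- The contribution of a cell to the decoded image. -/
def weight (hΔ : 0 < Δ) (v : DyadicCell L) (p : Pixel Δ) : ℝ :=
  (if corner hΔ v = p then 1 else 0) -
    if 0 < (v.1 : ℕ) ∧ parentCorner hΔ v = p then 1 else 0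

/-- The image with given masses of the cells. -/
def decode (hΔ : 0 < Δ) (μ : DyadicCell L → ℝ) (p : Pixel Δ) : ℝ := ∑ v, μ v * weight hΔ v p

/-- In each coordinate the two corners differ by zero or one side, and clipping to the image does
not increase distances. -/
theorem pixelDist_corner_le (hΔ : 0 < Δ) (v : DyadicCell L) :
    pixelDist (corner hΔ v) (parentCorner hΔ v) ≤ 2 * 2 ^ (L - v.1) := by
  have key : ∀ a h : ℕ,
      |((min (a * h) (Δ - 1) : ℕ) : ℝ) - ((min (a / 2 * (2 * h)) (Δ - 1) : ℕ) : ℝ)| ≤ h := by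
    intro a h
    have h1 : a / 2 * (2 * h) ≤ a * h := by
      rw [← mul_assoc]
      exact Nat.mul_le_mul_right h (Nat.div_mul_le_self a 2)
    have h2 : a * h ≤ a / 2 * (2 * h) + h := by
      calc a * h ≤ (a / 2 * 2 + 1) * h := Nat.mul_le_mul_right h (by omega)
        _ = _ := by ring
    generalize a * h = A at *
    generalize a / 2 * (2 * h) = B at *
    have h3 : min B (Δ - 1) ≤ min A (Δ - 1) := by omega
    have h4 : min A (Δ - 1) ≤ min B (Δ - 1) + h := by omega
    have h3' : ((min B (Δ - 1) : ℕ) : ℝ) ≤ ((min A (Δ - 1) : ℕ) : ℝ) := by exact_mod_cast h3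
    have h4' : ((min A (Δ - 1) : ℕ) : ℝ) ≤ ((min B (Δ - 1) : ℕ) : ℝ) + h := by exact_mod_cast h4
    rw [abs_le]
    constructor <;> linarith
  have k1 := key v.2.1 (2 ^ (L - v.1))
  have k2 := key v.2.2 (2 ^ (L - v.1))
  push_cast at k1 k2
  simp only [pixelDist, corner, parentCorner, snap]
  push_cast
  linarith

/-- The image with the true masses is the original one. -/
theorem decode_mass (hΔ : 0 < Δ) (hL : Δ ≤ 2 ^ L) (x : Pixel Δ → ℝ) :
    decode hΔ (mass hL x) = x := by
  funext p
  have h1 : ∀ q : Pixel Δ, ∑ v : DyadicCell L, (if at_ hL v.1 q = v.2 then weight hΔ v p else 0) =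
      if q = p then 1 else 0 := by
    intro q
    -- `c g` tests whether `p` is the corner of the depth-`g` cell of `q`. The weights along this
    -- chain of cells telescope and leave the depth-`L` cell, which is the pixel `q` itself.
    let c : ℕ → ℝ := fun g =>
      if snap hΔ (q.1 / 2 ^ (L - g) * 2 ^ (L - g)) (q.2 / 2 ^ (L - g) * 2 ^ (L - g)) = p
        then 1 else 0
    have h2 : ∀ g : Fin (L + 1), ∑ v, (if at_ hL g q = v then weight hΔ ⟨g, v⟩ p else 0) =
        if (g : ℕ) = 0 then c 0 else c g - c (g - 1) := by
      intro g
      rw [sum_ite_eq, if_pos (mem_univ _)]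
      by_cases hg : (g : ℕ) = 0
      · simp [weight, hg, c, corner, at_]
      · have hpow : 2 ^ (L - ((g : ℕ) - 1)) = 2 * 2 ^ (L - (g : ℕ)) := by
          rw [← pow_succ']; congr 1; omega
        have hdiv : ∀ i : ℕ, i / 2 ^ (L - (g : ℕ)) / 2 = i / (2 * 2 ^ (L - (g : ℕ))) := fun i => by
          rw [Nat.div_div_eq_div_mul, mul_comm]
        simp [weight, hg, c, corner, parentCorner, at_, hpow, hdiv, Nat.pos_of_ne_zero hg]
        congr
    rw [Fintype.sum_sigma]
    simp only [h2]
    rw [Fin.sum_univ_succ]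
    simp only [Fin.val_zero, if_true, Fin.val_succ, Nat.succ_ne_zero, if_false,
      Nat.add_sub_cancel]
    rw [Fin.sum_univ_eq_sum_range (fun g => c (g + 1) - c g), sum_range_sub]
    have hq : snap hΔ (q.1 : ℕ) (q.2 : ℕ) = q := by
      ext
      · simp only [snap]; omega
      · simp only [snap]; omega
    simp [c, hq]
  simp only [decode, mass, sum_mul]
  rw [sum_comm]
  calc _ = ∑ q, x q * ∑ v : DyadicCell L, (if at_ hL v.1 q = v.2 then weight hΔ v p else 0) := by
        refine sum_congr rfl fun q _ => ?_
        rw [mul_sum]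
        refine sum_congr rfl fun v _ => ?_
        split_ifs <;> simp
    _ = x p := by simp [h1]

/-- The error of a decoded image is bounded by the weighted errors of the masses. -/
theorem emdNorm_sub_decode_le (hΔ : 0 < Δ) (hL : Δ ≤ 2 ^ L) (x : Pixel Δ → ℝ)
    (μ : DyadicCell L → ℝ) :
    emdNorm (x - decode hΔ μ) ≤ 2 * ∑ v : DyadicCell L, 2 ^ (L - v.1) * |mass hL x v - μ v| := by
  set e : DyadicCell L → ℝ := fun v => mass hL x v - μ v with he
  -- Errors below the root are moved from the corner of the cell to that of its parent. The error of
  -- the root goes into `z`, at price `2Δ ≤ 2 · 2^L`.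
  have h := emdNorm_le (Δ := Δ) (fun v : DyadicCell L => if 0 < (v.1 : ℕ) then e v else 0)
    (corner hΔ) (parentCorner hΔ)
    (fun p => ∑ v : DyadicCell L, if 0 < (v.1 : ℕ) then 0 else if corner hΔ v = p then e v else 0)
    (x - decode hΔ μ) (fun p => by
      rw [← sum_add_distrib, Pi.sub_apply, ← congrFun (decode_mass hΔ hL x) p]
      simp only [decode]
      rw [← sum_sub_distrib]
      refine sum_congr rfl fun v _ => ?_
      rw [← sub_mul]
      by_cases hv : 0 < (v.1 : ℕ)
      · simp [weight, hv, he]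
      · simp [weight, hv, he])
  refine h.trans ?_
  rw [mul_sum]
  have hz : l1Norm (fun p : Pixel Δ => ∑ v : DyadicCell L,
      if 0 < (v.1 : ℕ) then 0 else if corner hΔ v = p then e v else 0) ≤
      ∑ v : DyadicCell L, if 0 < (v.1 : ℕ) then 0 else |e v| := by
    calc _ ≤ ∑ p : Pixel Δ, ∑ v : DyadicCell L,
          |if 0 < (v.1 : ℕ) then 0 else if corner hΔ v = p then e v else 0| :=
          sum_le_sum fun p _ => abs_sum_le_sum_abs _ _
      _ = _ := by
          rw [sum_comm]
          refine sum_congr rfl fun v _ => ?_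
          by_cases hv : 0 < (v.1 : ℕ)
          · simp [hv]
          · simp only [hv, if_false, apply_ite abs, abs_zero]
            simp
  have hΔL : (Δ : ℝ) ≤ 2 ^ L := by exact_mod_cast hL
  calc _ ≤ ∑ v : DyadicCell L, |if 0 < (v.1 : ℕ) then e v else 0| * (2 * 2 ^ (L - v.1)) +
        2 * 2 ^ L * ∑ v : DyadicCell L, (if 0 < (v.1 : ℕ) then 0 else |e v|) := by
        refine add_le_add (sum_le_sum fun v _ =>
          mul_le_mul_of_nonneg_left (pixelDist_corner_le hΔ v) (abs_nonneg _)) ?_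
        exact mul_le_mul (by linarith) hz (l1Norm_nonneg _) (by positivity)
    _ = _ := by
        rw [mul_sum, ← sum_add_distrib]
        refine sum_congr rfl fun v _ => ?_
        by_cases hv : 0 < (v.1 : ℕ)
        · simp only [hv, if_true]; ring
        · have hv0 : (v.1 : ℕ) = 0 := by omega
          simp [hv0]; ring

/-- The cells of relative distance less than `R` from a set of pixels. -/
noncomputable def near (hL : Δ ≤ 2 ^ L) (S : Finset (Pixel Δ)) (hS : S.Nonempty) (R : ℕ) :
    Finset (DyadicCell L) := by
  classical
  exact {v | ∃ p, at_ hL v.1 p = v.2 ∧ distTo S hS p < R * 2 ^ (L - v.1)}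

theorem sum_two_pow_le {I : Finset ℕ} {M : ℝ} (hM : 0 ≤ M) (h : ∀ i ∈ I, (2 : ℝ) ^ i ≤ M) :
    ∑ i ∈ I, (2 : ℝ) ^ i ≤ 2 * M := by
  rcases I.eq_empty_or_nonempty with rfl | hI
  · simpa using hM
  · have h1 : ∑ i ∈ I, 2 ^ i < 2 ^ (I.max' hI + 1) :=
      Nat.geomSum_lt le_rfl fun k hk => Nat.lt_succ_of_le (I.le_max' k hk)
    have h2 : ∑ i ∈ I, (2 : ℝ) ^ i ≤ 2 ^ (I.max' hI + 1) := by exact_mod_cast h1.le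
    rw [pow_succ'] at h2
    linarith [h _ (I.max'_mem hI)]

/-- The masses of the cells far from a set are small. -/
theorem sum_mass_compl_near_le (hL : Δ ≤ 2 ^ L) (S : Finset (Pixel Δ)) (hS : S.Nonempty) {R : ℕ}
    (hR : 0 < R) (x : Pixel Δ → ℝ) (hx : ∀ p, 0 ≤ x p) :
    ∑ v ∈ (near hL S hS R)ᶜ, 2 ^ (L - v.1) * mass hL x v ≤
      2 / R * ∑ p, x p * distTo S hS p := by
  have hR' : (0 : ℝ) < R := by exact_mod_cast hR
  simp only [mass, mul_sum]
  rw [sum_comm]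
  refine sum_le_sum fun p _ => ?_
  have e1 : ∑ v ∈ (near hL S hS R)ᶜ, (2 : ℝ) ^ (L - v.1) * (if at_ hL v.1 p = v.2 then x p else 0) =
      x p * ∑ g : Fin (L + 1), if (⟨g, at_ hL g p⟩ : DyadicCell L) ∈ (near hL S hS R)ᶜ
        then (2 : ℝ) ^ (L - g) else 0 := by
    rw [← univ_inter (near hL S hS R)ᶜ, ← sum_ite_mem, Fintype.sum_sigma, mul_sum]
    refine sum_congr rfl fun g _ => ?_
    rw [sum_eq_single (at_ hL g p)]
    · rw [if_pos rfl, mul_ite, mul_zero, mul_comm, univ_inter]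
    · intro v _ hv
      simp [hv.symm]
    · simp
  rw [e1, ← sum_filter]
  -- Far cells over `p` have side at most `d(p, S)/R`, and their sides are distinct powers of two.
  have e2 : ∑ g : Fin (L + 1) with (⟨g, at_ hL g p⟩ : DyadicCell L) ∈ (near hL S hS R)ᶜ,
      (2 : ℝ) ^ (L - g) ≤ 2 * (distTo S hS p / R) := by
    set G : Finset (Fin (L + 1)) := {g | (⟨g, at_ hL g p⟩ : DyadicCell L) ∈ (near hL S hS R)ᶜ}
    have hinj : Set.InjOn (fun g : Fin (L + 1) => L - (g : ℕ)) G := by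
      intro g _ g' _ h
      simp only at h
      exact Fin.ext (by omega)
    have h1 := sum_two_pow_le (I := G.image fun g : Fin (L + 1) => L - (g : ℕ))
      (M := distTo S hS p / R) (div_nonneg (distTo_nonneg S hS p) hR'.le) (fun i hi => by
        obtain ⟨g, hg, rfl⟩ := mem_image.1 hi
        have h2 := (mem_filter.1 hg).2
        simp only [near, mem_compl, mem_filter, mem_univ, true_and, not_exists, not_and,
          not_lt] at h2
        rw [le_div_iff₀ hR', mul_comm]
        exact h2 p rfl)
    rwa [sum_image hinj] at h1
  calc _ ≤ x p * (2 * (distTo S hS p / R)) := mul_le_mul_of_nonneg_left e2 (hx p)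
    _ = _ := by ring

/-- There are few cells near a small set. -/
theorem card_near_le (hL : Δ ≤ 2 ^ L) (S : Finset (Pixel Δ)) (hS : S.Nonempty) (R : ℕ) :
    #(near hL S hS R) ≤ ∑ g ∈ range (L + 1), min (4 ^ g) (#S * (2 * R + 1) ^ 2) := by
  classical
  rw [← Fin.sum_univ_eq_sum_range (fun g => min (4 ^ g) (#S * (2 * R + 1) ^ 2))]
  have h1 : #(near hL S hS R) = ∑ g : Fin (L + 1),
      #{c | ∃ p, at_ hL g p = c ∧ distTo S hS p < R * 2 ^ (L - (g : ℕ))} := by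
    rw [near, card_filter, Fintype.sum_sigma]
    refine sum_congr rfl fun g _ => ?_
    rw [card_filter]
  rw [h1]
  refine sum_le_sum fun g _ => le_min ?_ ?_
  · refine (card_le_univ _).trans ?_
    simp only [Fintype.card_prod, Fintype.card_fin, ← mul_pow]
    norm_num
  · set h := 2 ^ (L - (g : ℕ)) with hh
    have hpos : 0 < h := by positivity
    -- Each coordinate difference is at most the ℓ₁ distance, so the index of a near cell differs by
    -- at most `R` from that of the cell of `s`. Truncated subtraction only shrinks the box.
    let box : Pixel Δ → Finset (ℕ × ℕ) := fun s =>
      Icc ((s.1 : ℕ) / h - R) ((s.1 : ℕ) / h + R) ×ˢ Icc ((s.2 : ℕ) / h - R) ((s.2 : ℕ) / h + R)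
    have hbox : ∀ s ∈ S, #(box s) ≤ (2 * R + 1) ^ 2 := fun s _ => by
      simp only [box, card_product, Nat.card_Icc]
      rw [sq]
      exact Nat.mul_le_mul (by omega) (by omega)
    refine le_trans ?_ (card_biUnion_le_card_mul S box _ hbox)
    refine card_le_card_of_injOn (fun c => ((c.1 : ℕ), (c.2 : ℕ))) ?_ ?_
    · rintro c hc
      obtain ⟨p, rfl, hlt⟩ := (mem_filter.1 (mem_coe.1 hc)).2
      obtain ⟨s, hs, hmin⟩ := exists_mem_eq_inf' hS fun s => pixelDist p s
      have hd : pixelDist p s < ((R * h : ℕ) : ℝ) := by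
        have : distTo S hS p = pixelDist p s := hmin
        rw [← this]; push_cast [hh]; exact hlt
      have key : ∀ i j : ℕ, |(i : ℝ) - j| < ((R * h : ℕ) : ℝ) →
          i / h ∈ Icc (j / h - R) (j / h + R) := by
        intro i j hij
        obtain ⟨h1, h2⟩ := abs_lt.1 hij
        have h3 : j ≤ i + h * R := by
          have : (j : ℝ) ≤ ((i + h * R : ℕ) : ℝ) := by push_cast at h1 ⊢; linarith
          exact_mod_cast this
        have h4 : i ≤ j + h * R := by
          have : (i : ℝ) ≤ ((j + h * R : ℕ) : ℝ) := by push_cast at h2 ⊢; linarith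
          exact_mod_cast this
        have h5 := Nat.div_le_div_right (c := h) h3
        have h6 := Nat.div_le_div_right (c := h) h4
        rw [Nat.add_mul_div_left _ _ hpos] at h5 h6
        exact mem_Icc.2 ⟨Nat.sub_le_iff_le_add.2 h5, h6⟩
      refine mem_coe.2 (mem_biUnion.2 ⟨s, hs, mem_product.2 ⟨key _ _ ?_, key _ _ ?_⟩⟩)
      · exact lt_of_le_of_lt (le_add_of_nonneg_right (abs_nonneg _)) hd
      · exact lt_of_le_of_lt (le_add_of_nonneg_left (abs_nonneg _)) hd
    · intro c _ c' _ hcc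
      simp only [Prod.mk.injEq] at hcc
      exact Prod.ext (Fin.ext hcc.1) (Fin.ext hcc.2)

theorem card_le (L : ℕ) : 3 * Fintype.card (DyadicCell L) ≤ 4 ^ (L + 1) := by
  have h : ∀ n : ℕ, 3 * ∑ g ∈ range n, 4 ^ g + 1 = 4 ^ n := fun n => by
    induction n with
    | zero => simp
    | succ n ih => rw [sum_range_succ, pow_succ]; omega
  have h2 : Fintype.card (DyadicCell L) = ∑ g ∈ range (L + 1), 4 ^ g := by
    rw [Fintype.card_sigma, ← Fin.sum_univ_eq_sum_range (fun g => 4 ^ g)]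
    refine sum_congr rfl fun g _ => ?_
    simp only [Fintype.card_prod, Fintype.card_fin, ← mul_pow]
    norm_num
  rw [h2]
  have := h (L + 1)
  omega

end DyadicCell

/-! ### Recovery of images -/

/-- Gates cannot multiply, so the scaling is done by doubling, two gates each time. -/
theorem Computes.two_pow_mul {X : Type*} {A : Set (X → ℝ)} (h0 : (0 : X → ℝ) ∈ A) {f : X → ℝ}
    (hf : f ∈ A) (g : ℕ) : Computes A (2 * g) {fun x => 2 ^ g * f x} := by
  induction g with
  | zero => exact of_subset (by simpa using hf)
  | succ g ih =>
    refine (ih.trans (add (Or.inl h0) (f := fun x => 2 ^ g * f x) (g := fun x => 2 ^ g * f x)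
      (Or.inr rfl) (Or.inr rfl))).mono_right ?_
    rintro _ rfl
    right
    rw [Set.mem_singleton_iff]
    funext x
    simp only [Pi.add_apply]
    ring

/-! ### Gate count of the pyramid decoder and number of near cells -/

namespace DyadicCell

open Finset

variable {Δ L : ℕ}

/-- A pixel is a sum over the cells with that corner minus a sum over the cells with that parent
corner. Each cell enters at most one sum of either kind, so the total is linear in the number of
cells. -/
theorem computes_decode (hΔ : 0 < Δ) {X : Type*} {A : Set (X → ℝ)} (h0 : (0 : X → ℝ) ∈ A)
    (f : DyadicCell L → X → ℝ) (hf : ∀ v, f v ∈ A) :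
    Computes A (Fintype.card (DyadicCell L) * (2 * L + 4) + Δ * Δ)
      (Set.range fun p x => decode hΔ (fun v => 2 ^ (v.1 : ℕ) * f v x) p) := by
  let f' : DyadicCell L → X → ℝ := fun v x => 2 ^ (v.1 : ℕ) * f v x
  have h1 := Computes.family (A := A) (univ : Finset (DyadicCell L)) (f := f')
    (τ := fun _ => 2 * L) fun v _ =>
      (Computes.two_pow_mul h0 (hf v) v.1).mono_time (by have := v.1.2; omega)
  rw [coe_univ, Set.image_univ] at h1
  have h0' : (0 : X → ℝ) ∈ A ∪ Set.range f' := Or.inl h0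
  have hf' : ∀ v, f' v ∈ A ∪ Set.range f' := fun v => Or.inr ⟨v, rfl⟩
  have h2 := Computes.family (A := A ∪ Set.range f') (univ : Finset (Pixel Δ))
    (f := fun p x => decode hΔ (fun v => f' v x) p)
    (τ := fun p => 2 * #{v : DyadicCell L | corner hΔ v = p} +
      2 * #{v : DyadicCell L | 0 < (v.1 : ℕ) ∧ parentCorner hΔ v = p} + 1) fun p _ => by
      have h3 := (Computes.sum h0' {v : DyadicCell L | corner hΔ v = p} fun v _ => hf' v).union
        (Computes.sum h0' {v : DyadicCell L | 0 < (v.1 : ℕ) ∧ parentCorner hΔ v = p}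
          fun v _ => hf' v)
      refine (h3.trans (Computes.sub (Or.inr (Or.inl rfl)) (Or.inr (Or.inr rfl)))).mono_right ?_
      rintro _ rfl
      right
      rw [Set.mem_singleton_iff]
      funext x
      simp only [decode, weight, Pi.sub_apply, sum_filter, ← sum_sub_distrib]
      refine sum_congr rfl fun v _ => ?_
      rw [mul_sub, mul_ite, mul_ite, mul_one, mul_zero]
  rw [coe_univ, Set.image_univ] at h2
  refine ((h1.trans h2).mono_time ?_).mono_right Set.subset_union_right
  have e1 : ∑ p : Pixel Δ, #{v : DyadicCell L | corner hΔ v = p} =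
      Fintype.card (DyadicCell L) := by
    rw [← card_eq_sum_card_fiberwise (f := corner hΔ) (t := univ) (by simp), card_univ]
  have e2 : ∑ p : Pixel Δ, #{v : DyadicCell L | 0 < (v.1 : ℕ) ∧ parentCorner hΔ v = p} ≤
      Fintype.card (DyadicCell L) := by
    rw [← card_univ, card_eq_sum_card_fiberwise (f := parentCorner hΔ) (t := univ) (by simp)]
    refine sum_le_sum fun p _ => card_le_card fun v hv => ?_
    simp only [mem_filter, mem_univ, true_and] at hv ⊢
    exact hv.2
  simp only [sum_add_distrib, ← mul_sum, e1, sum_const, card_univ, Fintype.card_prod,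
    Fintype.card_fin, smul_eq_mul]
  nlinarith

/-- The bound on the number of cells near `k` pixels. -/
def nearBound (L k R : ℕ) : ℕ := ∑ g ∈ range (L + 1), min (4 ^ g) (k * (2 * R + 1) ^ 2)

theorem nearBound_pos {k : ℕ} (L R : ℕ) (hk : 0 < k) : 0 < nearBound L k R :=
  sum_pos (fun g _ => by positivity) ⟨0, by simp⟩

theorem nearBound_le (L k R : ℕ) : 64 * nearBound L k R ≤ 2 ^ (2 * L + 8) := by
  have h1 : nearBound L k R ≤ ∑ g ∈ range (L + 1), 4 ^ g :=
    sum_le_sum fun g _ => min_le_left _ _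
  have h2 : ∑ g ∈ range (L + 1), 4 ^ g < 4 ^ (L + 1) := Nat.geomSum_lt (by norm_num) (by simp)
  have h3 : 2 ^ (2 * L + 8) = 64 * 4 ^ (L + 1) := by
    rw [pow_add, pow_mul]; ring
  omega

/-- The finest level alone suffices. This lower bound is what turns `log(N/K)` into `O(log(n/k))`.
-/
theorem le_nearBound {L k : ℕ} (R : ℕ) (hk : k ≤ 4 ^ L) : k ≤ nearBound L k R := by
  refine le_trans ?_ (single_le_sum (f := fun g => min (4 ^ g) (k * (2 * R + 1) ^ 2))
    (fun _ _ => Nat.zero_le _) (mem_range.2 (Nat.lt_succ_self L)))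
  exact le_min hk (Nat.le_mul_of_pos_right k (by positivity))

/-- The levels up to depth `log₄ k` have fewer than `4k` cells altogether; only the `L - log₄ k`
deeper ones are charged `k (2R+1)²` each. This gives `log(n/k)` instead of `log n`. -/
theorem nearBound_le_mul {k : ℕ} (L R : ℕ) (hk : 0 < k) :
    nearBound L k R ≤ k * (2 * R + 1) ^ 2 * (4 + (L - Nat.log 4 k)) := by
  set κ := k * (2 * R + 1) ^ 2 with hκ
  have hkκ : k ≤ κ := Nat.le_mul_of_pos_right k (by positivity)
  set g₀ := Nat.log 4 k + 1 with hg₀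
  have h1 : nearBound L k R ≤ ∑ g ∈ range (L + 1), ((if g < g₀ then 4 ^ g else 0) +
      if g < g₀ then 0 else κ) := by
    refine sum_le_sum fun g _ => ?_
    split_ifs
    · exact min_le_left _ _
    · rw [zero_add]; exact min_le_right _ _
  refine h1.trans ?_
  rw [sum_add_distrib, mul_add]
  refine add_le_add ?_ ?_
  · rw [← sum_filter]
    have h2 : ∑ g ∈ range (L + 1) with g < g₀, 4 ^ g < 4 ^ g₀ :=
      Nat.geomSum_lt (by norm_num) fun g hg => (mem_filter.1 hg).2
    have h3 : 4 ^ g₀ ≤ 4 * k := by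
      rw [hg₀, pow_succ, mul_comm]
      exact Nat.mul_le_mul_left 4 (Nat.pow_log_le_self 4 hk.ne')
    omega
  · rw [sum_congr rfl (g := fun g => if g₀ ≤ g then κ else 0) (fun g _ => by
      by_cases h : g < g₀
      · simp [h, not_le.2 h]
      · simp [h, not_lt.1 h]), ← sum_filter, sum_const, smul_eq_mul, mul_comm]
    refine Nat.mul_le_mul_left κ ?_
    have : ({g ∈ range (L + 1) | g₀ ≤ g} : Finset ℕ) ⊆ Ico g₀ (L + 1) := fun g hg => by
      simp only [mem_filter, mem_range] at hg
      exact mem_Ico.2 ⟨hg.2, hg.1⟩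
    refine (card_le_card this).trans ?_
    rw [Nat.card_Ico]
    omega

end DyadicCell

open Finset DyadicCell in
/-- Recovery of images by straight-line computations. -/
theorem exists_recovery_circuit :
    ∃ C : ℝ, 0 < C ∧ ∀ (Δ L R k : ℕ), 0 < Δ → Δ ≤ 2 ^ L → 0 < R → 0 < k →
      ∃ (m : ℕ) (A : Matrix (Fin m) (Pixel Δ) ℝ) (T : ℕ) (z : Pixel Δ → (Pixel Δ → ℝ) → ℝ),
        (m : ℝ) ≤ C * (nearBound L k R * (2 * L + 8 - Nat.log 2 (nearBound L k R) + 1 : ℕ)) ∧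
        (T : ℝ) ≤ (C + 2) * (2 ^ (2 * L + 8) * (2 * L + 9) ^ 19) ∧
        Computes (insert 0 (Set.range fun i x => A.mulVec x i)) T (Set.range z) ∧
        ∀ x, (∀ p, 0 ≤ x p) → ∀ (S : Finset (Pixel Δ)) (hS : S.Nonempty), #S ≤ k →
          emdNorm (x - fun p => z p x) ≤ 4 * C / R * ∑ p, x p * distTo S hS p := by
  obtain ⟨C, hC, hrec⟩ := exists_sparse_recovery
  refine ⟨C, hC, fun Δ L R k hΔ hL hR hk => ?_⟩
  set K := nearBound L k R with hK
  obtain ⟨m, A, T, hm, hT, hdec⟩ := hrec (2 * L + 8) K (nearBound_pos L R hk) (nearBound_le L k R)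
  have hcard := DyadicCell.card_le L
  have hpow : 2 ^ (2 * L + 8) = 64 * 4 ^ (L + 1) := by
    rw [pow_add, pow_mul]; ring
  obtain ⟨φ⟩ := Function.Embedding.nonempty_of_card_le
    (show Fintype.card (DyadicCell L) ≤ Fintype.card (Fin (2 ^ (2 * L + 8))) by
      rw [Fintype.card_fin]; omega)
  -- The masses scaled by `2^(-depth)`, proportional to the sides, and padded with zeros. The ℓ₁
  -- error of this vector times `2^L` is the weighted error of `emdNorm_sub_decode_le`.
  let Y : Matrix (Fin (2 ^ (2 * L + 8))) (Pixel Δ) ℝ := fun i p =>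
    ∑ v, if φ v = i then if at_ hL v.1 p = v.2 then (1 / 2) ^ (v.1 : ℕ) else 0 else 0
  have hY : ∀ x i, Y.mulVec x i = ∑ v, if φ v = i then (1 / 2) ^ (v.1 : ℕ) * mass hL x v else 0 := by
    intro x i
    simp only [Y, Matrix.mulVec, dotProduct, sum_mul, mass, mul_sum]
    rw [sum_comm]
    refine sum_congr rfl fun v _ => ?_
    split_ifs
    · refine sum_congr rfl fun p _ => ?_
      split_ifs <;> simp
    · simp
  have hYφ : ∀ x v, Y.mulVec x (φ v) = (1 / 2) ^ (v.1 : ℕ) * mass hL x v := by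
    intro x v
    rw [hY, sum_eq_single v]
    · simp
    · intro w _ hw
      rw [if_neg fun h => hw (φ.injective h)]
    · simp
  have hY0 : ∀ x i, i ∉ univ.map φ → Y.mulVec x i = 0 := by
    intro x i hi
    rw [hY]
    refine sum_eq_zero fun v _ => if_neg fun h => hi ?_
    exact mem_map.2 ⟨v, mem_univ _, h⟩
  obtain ⟨z, hz, hzle⟩ := hdec (X := Pixel Δ → ℝ) fun x => Y.mulVec x
  have hmul : ∀ x, A.mulVec (Y.mulVec x) = (A * Y).mulVec x := fun x => by
    rw [Matrix.mulVec_mulVec]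
  simp only [hmul] at hz
  refine ⟨m, A * Y, T + (Fintype.card (DyadicCell L) * (2 * L + 4) + Δ * Δ),
    fun p x => decode hΔ (fun v => 2 ^ (v.1 : ℕ) * z (φ v) x) p, hm, ?_, ?_, ?_⟩
  · have h1 : Fintype.card (DyadicCell L) * (2 * L + 4) + Δ * Δ ≤
        2 * (2 ^ (2 * L + 8) * (2 * L + 9) ^ 19) := by
      have h2 : 2 * L + 4 ≤ (2 * L + 9) ^ 19 :=
        (show 2 * L + 4 ≤ 2 * L + 9 by omega).trans (Nat.le_self_pow (by norm_num) _)
      have h3 : Δ * Δ ≤ 2 ^ (2 * L + 8) := by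
        refine (Nat.mul_le_mul hL hL).trans ?_
        rw [← pow_add]
        exact Nat.pow_le_pow_right (by norm_num) (by omega)
      have h4 : 1 ≤ (2 * L + 9) ^ 19 := Nat.one_le_pow _ _ (by omega)
      have h5 := Nat.mul_le_mul (show Fintype.card (DyadicCell L) ≤ 2 ^ (2 * L + 8) by omega) h2
      have h6 := Nat.mul_le_mul h3 h4
      omega
    have h1R : ((Fintype.card (DyadicCell L) * (2 * L + 4) + Δ * Δ : ℕ) : ℝ) ≤
        2 * (2 ^ (2 * L + 8) * (2 * L + 9) ^ 19) := by exact_mod_cast h1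
    have hT' : (T : ℝ) ≤ C * (2 ^ (2 * L + 8) * (2 * L + 9) ^ 19) := by
      refine hT.trans (le_of_eq ?_)
      push_cast
      rw [show (2 * (L : ℝ) + 8 + 1) = 2 * L + 9 by ring]
    rw [Nat.cast_add, add_mul]
    exact add_le_add hT' h1R
  · exact (hz.trans (computes_decode hΔ (Or.inl (Set.mem_insert _ _)) (fun v => z (φ v))
      fun v => Or.inr ⟨φ v, rfl⟩)).mono_right Set.subset_union_right
  · intro x hx S hS hSk
    have hnear : #((near hL S hS R).map φ) ≤ K := by
      rw [card_map]
      refine (card_near_le hL S hS R).trans (sum_le_sum fun g _ => ?_)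
      exact min_le_min_left _ (Nat.mul_le_mul_right _ hSk)
    have h1 := hzle x _ hnear
    have h2 : ∑ v, |(1 / 2) ^ (v.1 : ℕ) * mass hL x v - z (φ v) x| ≤
        ∑ i, |Y.mulVec x i - z i x| := by
      calc _ = ∑ i ∈ univ.map φ, |Y.mulVec x i - z i x| := by
            rw [sum_map]
            simp only [hYφ]
        _ ≤ _ := sum_le_sum_of_subset_of_nonneg (subset_univ _) fun _ _ _ => abs_nonneg _
    have hmass : ∀ v, 0 ≤ mass hL x v := fun v => sum_nonneg fun p _ => by
      split_ifs <;> simp [hx]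
    have h3 : ∑ i ∈ ((near hL S hS R).map φ)ᶜ, |Y.mulVec x i| =
        ∑ v ∈ (near hL S hS R)ᶜ, (1 / 2) ^ (v.1 : ℕ) * mass hL x v := by
      have e1 : ∑ v ∈ (near hL S hS R)ᶜ, (1 / 2) ^ (v.1 : ℕ) * mass hL x v =
          ∑ i ∈ ((near hL S hS R)ᶜ).map φ, |Y.mulVec x i| := by
        rw [sum_map]
        refine sum_congr rfl fun v _ => ?_
        rw [hYφ, abs_of_nonneg (mul_nonneg (by positivity) (hmass v))]
      rw [e1]
      symm
      refine sum_subset (fun i hi => ?_) fun i hi hi' => ?_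
      · obtain ⟨v, hv, rfl⟩ := mem_map.1 hi
        rw [mem_compl, mem_map']
        exact mem_compl.1 hv
      · rw [hY0, abs_zero]
        intro hmem
        obtain ⟨v, -, rfl⟩ := mem_map.1 hmem
        rw [mem_compl, mem_map'] at hi
        exact hi' (mem_map_of_mem φ (mem_compl.2 hi))
    have hscale : ∀ v : DyadicCell L, (2 : ℝ) ^ (L - v.1) = 2 ^ L * (1 / 2) ^ (v.1 : ℕ) := fun v => by
      have : (2 : ℝ) ^ L = 2 ^ (L - v.1) * 2 ^ (v.1 : ℕ) := by
        rw [← pow_add, Nat.sub_add_cancel (Nat.lt_succ_iff.1 v.1.2)]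
      rw [this, one_div, inv_pow, mul_assoc, mul_inv_cancel₀ (by positivity), mul_one]
    have h4 := sum_mass_compl_near_le hL S hS hR x hx
    have h5 := emdNorm_sub_decode_le hΔ hL x fun v => 2 ^ (v.1 : ℕ) * z (φ v) x
    have e5 : ∑ v : DyadicCell L, (2 : ℝ) ^ (L - v.1) * |mass hL x v - 2 ^ (v.1 : ℕ) * z (φ v) x| =
        2 ^ L * ∑ v : DyadicCell L, |(1 / 2) ^ (v.1 : ℕ) * mass hL x v - z (φ v) x| := by
      rw [mul_sum]
      refine sum_congr rfl fun v _ => ?_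
      have : (1 / 2 : ℝ) ^ (v.1 : ℕ) * mass hL x v - z (φ v) x =
          (1 / 2) ^ (v.1 : ℕ) * (mass hL x v - 2 ^ (v.1 : ℕ) * z (φ v) x) := by
        rw [mul_sub, ← mul_assoc, ← mul_pow]
        norm_num
      rw [this, abs_mul, abs_of_pos (show (0 : ℝ) < (1 / 2) ^ (v.1 : ℕ) by positivity), hscale,
        mul_assoc]
    have e4 : ∑ v ∈ (near hL S hS R)ᶜ, (2 : ℝ) ^ (L - v.1) * mass hL x v =
        2 ^ L * ∑ v ∈ (near hL S hS R)ᶜ, (1 / 2) ^ (v.1 : ℕ) * mass hL x v := by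
      rw [mul_sum]
      refine sum_congr rfl fun v _ => ?_
      rw [hscale, mul_assoc]
    rw [e5] at h5
    rw [e4] at h4
    rw [h3] at h1
    -- The factor `4C/R` collects `2` from decoding, `C` from ℓ₁ recovery and `2/R` from the far
    -- cells.
    refine h5.trans ?_
    calc 2 * ((2 : ℝ) ^ L * ∑ v : DyadicCell L, |(1 / 2) ^ (v.1 : ℕ) * mass hL x v - z (φ v) x|)
        ≤ 2 * (2 ^ L * (C * ∑ v ∈ (near hL S hS R)ᶜ, (1 / 2) ^ (v.1 : ℕ) * mass hL x v)) := by
          have := h2.trans h1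
          have h6 : (0 : ℝ) ≤ 2 * 2 ^ L := by positivity
          rw [← mul_assoc, ← mul_assoc]
          exact mul_le_mul_of_nonneg_left this h6
      _ = 2 * C * (2 ^ L * ∑ v ∈ (near hL S hS R)ᶜ, (1 / 2) ^ (v.1 : ℕ) * mass hL x v) := by ring
      _ ≤ 2 * C * (2 / R * ∑ p, x p * distTo S hS p) :=
          mul_le_mul_of_nonneg_left h4 (by positivity)
      _ = _ := by ring

open Finset

/-! ### The size of the parameters -/

/-- Passage from binary to natural logarithms, with `1 / log 2 < 2`. -/
theorem natCast_le_of_two_pow_mul_le {e a : ℕ} {k N : ℝ} (hk : 0 < k) (hkN : k ≤ N)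
    (h : 2 ^ e * k ≤ 2 ^ a * N) : (e : ℝ) ≤ a + 2 * Real.log (N / k) := by
  have hN : 0 < N := hk.trans_le hkN
  have h1 := Real.log_le_log (by positivity) h
  rw [Real.log_mul (by positivity) hk.ne', Real.log_mul (by positivity) hN.ne', Real.log_pow,
    Real.log_pow] at h1
  have h2 : 0 ≤ Real.log (N / k) := Real.log_nonneg (by rwa [one_le_div hk])
  rw [Real.log_div hN.ne' hk.ne'] at h2 ⊢
  have h3 := Real.log_two_gt_d9
  by_contra! h4
  nlinarith

namespace DyadicCell

/-- As `k < Δ²/2`, the logarithm `l` of `Δ²/k` is at least `1/2` and absorbs additive constants: `12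
+ 2l ≤ 26l` and `6 + l ≤ 13l`. -/
theorem nearBound_mul_le {Δ L k : ℕ} (R : ℕ) (hL : Δ ≤ 2 ^ L) (hL' : 2 ^ L ≤ 2 * Δ) (hk : 0 < k)
    (hkΔ : (k : ℝ) < (Δ : ℝ) ^ 2 / 2) :
    ((nearBound L k R * (2 * L + 8 - Nat.log 2 (nearBound L k R) + 1) : ℕ) : ℝ) ≤
      k * (2 * R + 1) ^ 2 * (13 * 26) * Real.log ((Δ : ℝ) ^ 2 / k) ^ 2 := by
  have hk0 : (0 : ℝ) < k := by exact_mod_cast hk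
  have hkΔ' : (k : ℝ) ≤ (Δ : ℝ) ^ 2 := by nlinarith
  have hl : 1 / 2 ≤ Real.log ((Δ : ℝ) ^ 2 / k) := by
    have h1 : Real.log 2 ≤ Real.log ((Δ : ℝ) ^ 2 / k) := by
      refine Real.log_le_log two_pos ?_
      rw [le_div_iff₀ hk0]
      linarith
    have := Real.log_two_gt_d9
    linarith
  have hkN : k ≤ Δ ^ 2 := by exact_mod_cast hkΔ'
  have hk4 : k ≤ 4 ^ L := by
    refine hkN.trans ((Nat.pow_le_pow_left hL 2).trans (le_of_eq ?_))
    rw [← pow_mul, mul_comm, pow_mul]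
    norm_num
  have h4 : 4 ^ L ≤ 4 * Δ ^ 2 := by
    have := Nat.pow_le_pow_left hL' 2
    rw [← pow_mul, mul_comm, pow_mul] at this
    calc 4 ^ L ≤ (2 * Δ) ^ 2 := this
      _ = _ := by ring
  set K := nearBound L k R with hK
  set e := 2 * L + 8 - Nat.log 2 K + 1 with he
  have hK0 : 0 < K := nearBound_pos L R hk
  have hlogK : Nat.log 2 K ≤ 2 * L + 8 := by
    have h64 := nearBound_le L k R
    have h1 := Nat.pow_log_le_self 2 hK0.ne'
    exact (Nat.pow_le_pow_iff_right (a := 2) (by norm_num)).1 (h1.trans (by omega))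
  have he1 : 2 ^ e * k ≤ 2 ^ 12 * Δ ^ 2 := by
    have h1 : k ≤ 2 ^ (Nat.log 2 K + 1) :=
      (le_nearBound R hk4).trans (Nat.lt_pow_succ_log_self (by norm_num) K).le
    calc 2 ^ e * k ≤ 2 ^ e * 2 ^ (Nat.log 2 K + 1) := Nat.mul_le_mul_left _ h1
      _ = 2 ^ (2 * L) * 2 ^ 10 := by rw [← pow_add, ← pow_add]; congr 1; omega
      _ = 4 ^ L * 2 ^ 10 := by rw [pow_mul]; norm_num
      _ ≤ 4 * Δ ^ 2 * 2 ^ 10 := Nat.mul_le_mul_right _ h4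
      _ = _ := by ring
  have hf1 : 2 ^ (2 * (L - Nat.log 4 k)) * k ≤ 2 ^ 4 * Δ ^ 2 := by
    rcases le_total L (Nat.log 4 k) with h | h
    · rw [Nat.sub_eq_zero_of_le h]
      omega
    · have h1 : k ≤ 4 ^ (Nat.log 4 k + 1) := (Nat.lt_pow_succ_log_self (by norm_num) k).le
      rw [pow_mul]
      calc 4 ^ (L - Nat.log 4 k) * k ≤ 4 ^ (L - Nat.log 4 k) * 4 ^ (Nat.log 4 k + 1) :=
            Nat.mul_le_mul_left _ h1
        _ = 4 ^ L * 4 := by rw [← pow_add, ← pow_succ]; congr 1; omega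
        _ ≤ _ := by omega
  have he2 : (e : ℝ) ≤ 26 * Real.log ((Δ : ℝ) ^ 2 / k) := by
    have := natCast_le_of_two_pow_mul_le (e := e) (a := 12) hk0 hkΔ' (by exact_mod_cast he1)
    push_cast at this
    linarith
  have hf2 : ((4 + (L - Nat.log 4 k) : ℕ) : ℝ) ≤ 13 * Real.log ((Δ : ℝ) ^ 2 / k) := by
    have := natCast_le_of_two_pow_mul_le (e := 2 * (L - Nat.log 4 k)) (a := 4) hk0 hkΔ'
      (by exact_mod_cast hf1)
    rw [Nat.cast_mul] at this
    rw [Nat.cast_add]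
    push_cast at this ⊢
    linarith
  have hK2 : (K : ℝ) ≤ k * (2 * R + 1) ^ 2 * (13 * Real.log ((Δ : ℝ) ^ 2 / k)) := by
    have h1 : (K : ℝ) ≤ ((k * (2 * R + 1) ^ 2 * (4 + (L - Nat.log 4 k)) : ℕ) : ℝ) :=
      Nat.cast_le.2 (nearBound_le_mul L R hk)
    rw [Nat.cast_mul] at h1
    refine h1.trans ?_
    push_cast at hf2 ⊢
    gcongr
  rw [Nat.cast_mul]
  calc (K : ℝ) * e ≤ k * (2 * R + 1) ^ 2 * (13 * Real.log ((Δ : ℝ) ^ 2 / k)) *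
        (26 * Real.log ((Δ : ℝ) ^ 2 / k)) := by gcongr
    _ = _ := by ring

theorem nearBound_mul_le_two_pow (L k R : ℕ) :
    nearBound L k R * (2 * L + 8 - Nat.log 2 (nearBound L k R) + 1) ≤
      2 ^ (2 * L + 8) * (2 * L + 9) ^ 19 := by
  have h := nearBound_le L k R
  refine Nat.mul_le_mul (by omega) ?_
  calc _ ≤ 2 * L + 9 := by omega
    _ ≤ _ := Nat.le_self_pow (by norm_num) _

end DyadicCell

theorem natCast_le_mul_log {Δ L : ℕ} (hΔ : 2 ≤ Δ) (hL' : 2 ^ L ≤ 2 * Δ) :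
    (L : ℝ) ≤ 2 * Real.log ((Δ : ℝ) ^ 2) := by
  have h1 : 2 ^ L ≤ Δ ^ 2 := by nlinarith
  have h2 : (1 : ℝ) ≤ (Δ : ℝ) ^ 2 := by exact_mod_cast Nat.one_le_pow _ _ (by omega)
  have := natCast_le_of_two_pow_mul_le (e := L) (a := 0) (k := 1) (N := (Δ : ℝ) ^ 2) one_pos h2
    (by simpa using (by exact_mod_cast h1 : (2 : ℝ) ^ L ≤ (Δ : ℝ) ^ 2))
  simpa using this

theorem one_le_log_sq {Δ : ℕ} (hΔ : 2 ≤ Δ) : 1 ≤ Real.log ((Δ : ℝ) ^ 2) := by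
  have h1 : Real.log 2 ≤ Real.log Δ := Real.log_le_log two_pos (by exact_mod_cast hΔ)
  rw [Real.log_pow]
  have := Real.log_two_gt_d9
  push_cast
  linarith

theorem two_mul_add_nine_le {Δ L : ℕ} (hΔ : 2 ≤ Δ) (hL' : 2 ^ L ≤ 2 * Δ) :
    ((2 * L + 9 : ℕ) : ℝ) ≤ 13 * Real.log ((Δ : ℝ) ^ 2) := by
  have h1 := natCast_le_mul_log hΔ hL'
  have h2 := one_le_log_sq hΔ
  push_cast
  linarith

theorem two_pow_mul_pow_le {Δ L : ℕ} (hΔ : 2 ≤ Δ) (hL' : 2 ^ L ≤ 2 * Δ) (c : ℕ) :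
    ((2 ^ (2 * L + 8) * (2 * L + 9) ^ c : ℕ) : ℝ) ≤
      1024 * 13 ^ c * ((Δ : ℝ) ^ 2 * Real.log ((Δ : ℝ) ^ 2) ^ c) := by
  have h1 : ((2 ^ (2 * L + 8) : ℕ) : ℝ) ≤ 1024 * (Δ : ℝ) ^ 2 := by
    have : 2 ^ (2 * L + 8) ≤ 1024 * Δ ^ 2 := by
      calc 2 ^ (2 * L + 8) = 256 * (2 ^ L) ^ 2 := by ring
        _ ≤ 256 * (2 * Δ) ^ 2 := by gcongr
        _ = _ := by ring
    exact_mod_cast this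
  have h2 := pow_le_pow_left₀ (Nat.cast_nonneg _) (two_mul_add_nine_le hΔ hL') c
  rw [Nat.cast_mul, Nat.cast_pow (2 * L + 9)]
  calc _ ≤ 1024 * (Δ : ℝ) ^ 2 * (13 * Real.log ((Δ : ℝ) ^ 2)) ^ c := by gcongr
    _ = _ := by rw [mul_pow]; ring

theorem two_pow_mul_pow_le_two_pow (L c : ℕ) :
    2 ^ (2 * L + 8) * (2 * L + 9) ^ c ≤ 2 ^ ((c + 1) * (2 * L + 9)) := by
  calc _ ≤ 2 ^ (2 * L + 9) * (2 ^ (2 * L + 9)) ^ c := by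
        gcongr
        · norm_num
        · omega
        · exact Nat.lt_two_pow_self.le
    _ = _ := by rw [← pow_mul, ← pow_add]; congr 1; ring

/-- `W` dominates, up to constants, the numbers of measurements, gates and table entries; its bound
by a power of two determines the word length. -/
theorem exists_size_bound {Δ L : ℕ} (hΔ : 2 ≤ Δ) (hL : Δ ≤ 2 ^ L) (hL' : 2 ^ L ≤ 2 * Δ) (c : ℕ) :
    ∃ W : ℕ, W = 2 ^ (2 * L + 8) * (2 * L + 9) ^ c ∧ Δ * Δ ≤ W ∧ (1 : ℝ) ≤ W ∧
      W ≤ 2 ^ ((c + 1) * (2 * L + 9)) ∧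
      (W : ℝ) ≤ 1024 * 13 ^ c * ((Δ : ℝ) ^ 2 * Real.log ((Δ : ℝ) ^ 2) ^ c) := by
  refine ⟨_, rfl, ?_, ?_, two_pow_mul_pow_le_two_pow L c, two_pow_mul_pow_le hΔ hL' c⟩
  · calc Δ * Δ ≤ 2 ^ L * 2 ^ L := Nat.mul_le_mul hL hL
      _ = 2 ^ (2 * L) * 1 := by rw [← pow_add, mul_one, two_mul]
      _ ≤ _ := Nat.mul_le_mul (Nat.pow_le_pow_right (by norm_num) (by omega))
          (Nat.one_le_pow _ _ (by omega))
  · exact Nat.one_le_cast.2 (Nat.succ_le_of_lt (by positivity))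

/-- The constant is `C + 6 (C + 3) + 2 = 7C + 20`. -/
theorem add_lt_two_pow {m t W c₀ a : ℕ} {C : ℝ} (hc₀ : 7 * C + 20 < 2 ^ c₀) (hW1 : (1 : ℝ) ≤ W)
    (hWa : (W : ℝ) ≤ 2 ^ a) (hm : (m : ℝ) ≤ C * W) (ht : (t : ℝ) ≤ (C + 3) * W) :
    m + 6 * t + 2 < 2 ^ (c₀ + a) := by
  have h1 : ((m + 6 * t + 2 : ℕ) : ℝ) ≤ (7 * C + 20) * W := by
    push_cast
    linarith
  have h3 : ((m + 6 * t + 2 : ℕ) : ℝ) < ((2 ^ (c₀ + a) : ℕ) : ℝ) := by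
    calc _ ≤ (7 * C + 20) * (W : ℝ) := h1
      _ < 2 ^ c₀ * W := mul_lt_mul_of_pos_right hc₀ (by linarith)
      _ ≤ 2 ^ c₀ * 2 ^ a := by gcongr
      _ = _ := by rw [← pow_add]; norm_num
  exact Nat.cast_lt.1 h3

/-! ### Reading off the image and fixing the constants -/

theorem DyadicCell.snap_coe {Δ : ℕ} (hΔ : 0 < Δ) (p : Pixel Δ) : snap hΔ p.1 p.2 = p := by
  have h1 := p.1.2
  have h2 := p.2.2
  ext <;> simp only [snap] <;> omega

theorem DyadicCell.image_eq_of_snap {Δ : ℕ} (hΔ : 0 < Δ) {s : Store} (y : Pixel Δ → ℝ)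
    (h : ∀ i < Δ * Δ, s.rarr 1 i = y (snap hΔ (i / Δ) (i % Δ))) : s.image Δ = y := by
  funext p
  have h1 : (p.1 : ℕ) * Δ + p.2 < Δ * Δ := by
    have := p.1.2
    have := p.2.2
    nlinarith
  have h2 : ((p.1 : ℕ) * Δ + p.2) / Δ = p.1 := by
    rw [mul_comm, Nat.mul_add_div hΔ, Nat.div_eq_of_lt p.2.2, add_zero]
  have h3 : ((p.1 : ℕ) * Δ + p.2) % Δ = p.2 := by
    rw [mul_comm, Nat.mul_add_mod, Nat.mod_eq_of_lt p.2.2]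
  rw [Store.image, h _ h1, h2, h3, snap_coe]

/-- It suffices to bound the error by the cost of moving the image to `k` pixels. -/
theorem emdNorm_le_mul_of_isSparse {Δ k : ℕ} (hΔ : 0 < Δ) (hk : 0 < k) {x y : Pixel Δ → ℝ}
    (hx : ∀ p, 0 ≤ x p) {c ε : ℝ} (hc : 0 ≤ c) (hcε : c ≤ ε)
    (h : ∀ S (hS : S.Nonempty), #S ≤ k → emdNorm (x - y) ≤ c * ∑ p, x p * distTo S hS p)
    (x' : Pixel Δ → ℝ) (hx' : IsSparse k x') : emdNorm (x - y) ≤ ε * emdNorm (x - x') := by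
  classical
  have key (S : Finset (Pixel Δ)) (hS : S.Nonempty) (hSk : #S ≤ k) (h0 : ∀ p ∉ S, x' p = 0) :
      emdNorm (x - y) ≤ ε * emdNorm (x - x') := by
    have h1 := sum_mul_distTo_le_emdNorm S hS x x' h0
    have h2 : 0 ≤ ∑ p, x p * distTo S hS p :=
      sum_nonneg fun p _ => mul_nonneg (hx p) (distTo_nonneg _ _ _)
    exact (h S hS hSk).trans (mul_le_mul hcε h1 h2 (hc.trans hcε))
  by_cases hne : ({p | x' p ≠ 0} : Finset (Pixel Δ)).Nonempty
  · refine key _ hne ?_ (by simp)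
    rw [IsSparse, ← Set.ncard_coe_finset] at *
    simpa using hx'
  -- For `x' = 0` the support is empty, but `distTo` needs a nonempty set; any single pixel serves
  -- since `k ≥ 1`.
  · refine key {(⟨0, hΔ⟩, ⟨0, hΔ⟩)} (singleton_nonempty _) (by simpa using Nat.succ_le_of_lt hk) fun p _ => ?_
    rw [not_nonempty_iff_eq_empty, filter_eq_empty_iff] at hne
    simpa using hne (mem_univ p)

/-- With `a = 4C` this is the choice of `R`: large enough for the approximation factor `ε`, yet
`(2R+1)² = O(ε⁻²)`. The condition `ε ≤ 1` absorbs the rounding. -/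
theorem natCeil_div_bounds {a ε : ℝ} (ha : 0 < a) (hε : 0 < ε) (hε1 : ε ≤ 1) :
    0 < ⌈a / ε⌉₊ ∧ a / (⌈a / ε⌉₊ : ℝ) ≤ ε ∧
      (2 * (⌈a / ε⌉₊ : ℝ) + 1) ^ 2 ≤ (2 * a + 3) ^ 2 * (1 / ε ^ 2) := by
  have h0 : 0 < ⌈a / ε⌉₊ := Nat.ceil_pos.2 (by positivity)
  have h0' : (0 : ℝ) < (⌈a / ε⌉₊ : ℝ) := by exact_mod_cast h0
  refine ⟨h0, ?_, ?_⟩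
  · have := Nat.le_ceil (a / ε)
    rw [div_le_iff₀ hε] at this
    rw [div_le_iff₀ h0']
    linarith
  · have h1 : 2 * (⌈a / ε⌉₊ : ℝ) + 1 ≤ (2 * a + 3) / ε := by
      have h2 := (Nat.ceil_lt_add_one (show 0 ≤ a / ε by positivity)).le
      have h3 : 1 ≤ 1 / ε := by rwa [le_div_iff₀ hε, one_mul]
      calc _ ≤ 2 * (a / ε + 1) + 1 := by linarith
        _ = 2 * (a / ε) + 3 := by ring
        _ ≤ 2 * (a / ε) + 3 * (1 / ε) := by linarith
        _ = _ := by ring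
    calc _ ≤ ((2 * a + 3) / ε) ^ 2 := by gcongr
      _ = _ := by rw [div_pow]; ring

theorem mainTheorem2 :
    ∃ (C : ℝ) (c : ℕ) (P : Prog), 0 < C ∧
      ∀ (Δ k : ℕ) (ε : ℝ), 1 ≤ k → (k : ℝ) < (Δ : ℝ) ^ 2 / 2 → 0 < ε → ε ≤ 1 →
        ∃ (m : ℕ) (A : Matrix (Fin m) (Pixel Δ) ℝ) (b : ℕ) (table : List ℕ),
          (m : ℝ) ≤ C * (1 / ε ^ 2 * (k : ℝ) * Real.log ((Δ : ℝ) ^ 2 / (k : ℝ)) ^ 2) ∧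
          (b : ℝ) ≤ C * Real.log ((Δ : ℝ) ^ 2) ∧
          (table.length : ℝ) ≤ C * ((Δ : ℝ) ^ 2 * Real.log ((Δ : ℝ) ^ 2) ^ c) ∧
          (∀ a ∈ table, a < 2 ^ b) ∧
          IsEMDRecoveryScheme A P b table k ε
            (C * ((Δ : ℝ) ^ 2 * Real.log ((Δ : ℝ) ^ 2) ^ c)) := by
  obtain ⟨C, hC, hcirc⟩ := exists_recovery_circuit
  obtain ⟨c₀, hc₀⟩ := pow_unbounded_of_one_lt (7 * C + 20) one_lt_two
  -- The three constants pay for the measurements, for the word length, and for time and table. In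
  -- `C₃`, `23 (C + 3) + 6 = 23C + 75`.
  set C₁ := C * ((2 * (4 * C) + 3) ^ 2 * (13 * 26)) with hC₁
  set C₂ : ℝ := c₀ + 20 * 13 with hC₂
  set C₃ : ℝ := (23 * C + 75) * (1024 * 13 ^ 19) with hC₃
  have hC₁0 : 0 < C₁ := by positivity
  have hC₂0 : 0 < C₂ := by positivity
  have hC₃0 : 0 < C₃ := by positivity
  refine ⟨C₁ + C₂ + C₃, 19, Prog.interp, by positivity, fun Δ k ε hk hkΔ hε hε1 => ?_⟩
  have hk0 : (0 : ℝ) < k := by exact_mod_cast hk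
  -- `1 ≤ k < Δ²/2` rules out `Δ ≤ 1`, so `log(Δ²) ≥ 1`.
  have hΔ2 : 2 ≤ Δ := by
    by_contra! h
    have h1 : (Δ : ℝ) ≤ 1 := by exact_mod_cast Nat.lt_succ_iff.1 h
    have h2 : (1 : ℝ) ≤ k := by exact_mod_cast hk
    nlinarith [(Nat.cast_nonneg Δ : (0 : ℝ) ≤ Δ)]
  have hΔ : 0 < Δ := by omega
  set L := Nat.clog 2 Δ with hLdef
  have hL : Δ ≤ 2 ^ L := Nat.le_pow_clog (by norm_num) _
  have hL' : 2 ^ L ≤ 2 * Δ := Recovery.two_pow_clog_le hΔ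
  obtain ⟨hR0, hRε, hRsq⟩ := natCeil_div_bounds (show 0 < 4 * C by positivity) hε hε1
  set R := ⌈4 * C / ε⌉₊ with hR
  obtain ⟨m, A, T, z, hm, hT, hcomp, hz⟩ := hcirc Δ L R k hΔ hL hR0 hk
  obtain ⟨W, hW, hΔW, hW1, hWb, hWle⟩ := exists_size_bound hΔ2 hL hL' 19
  set Q := (Δ : ℝ) ^ 2 * Real.log ((Δ : ℝ) ^ 2) ^ 19 with hQ
  have hlog := one_le_log_sq hΔ2
  have hQ0 : 0 ≤ Q := by positivity
  have hmW : (m : ℝ) ≤ C * W := by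
    refine hm.trans (mul_le_mul_of_nonneg_left ?_ hC.le)
    rw [← Nat.cast_mul, hW]
    exact Nat.cast_le.2 (DyadicCell.nearBound_mul_le_two_pow L k R)
  have hTW : ((T + Δ * Δ : ℕ) : ℝ) ≤ (C + 3) * W := by
    have h2 : ((Δ * Δ : ℕ) : ℝ) ≤ W := by exact_mod_cast hΔW
    have h3 : (T : ℝ) ≤ (C + 2) * W := by
      rw [hW]
      push_cast
      exact hT
    rw [Nat.cast_add]
    linarith
  set b := c₀ + 20 * (2 * L + 9) with hb
  have hbig := add_lt_two_pow hc₀ hW1 (by exact_mod_cast hWb) hmW hTW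
  have hC₃W : ((23 * (T + Δ * Δ) + 6 : ℕ) : ℝ) ≤ (C₁ + C₂ + C₃) * Q := by
    calc _ ≤ (23 * C + 75) * (W : ℝ) := by
          rw [Nat.cast_add, Nat.cast_mul]
          push_cast at hTW ⊢
          linarith
      _ ≤ (23 * C + 75) * (1024 * 13 ^ 19 * Q) := by gcongr
      _ = C₃ * Q := by rw [hC₃]; ring
      _ ≤ _ := by
        refine mul_le_mul_of_nonneg_right ?_ hQ0
        linarith
  -- Pixels in row-major order; `snap` only serves to make the enumeration total on `ℕ`.
  let F : ℕ → (Pixel Δ → ℝ) → ℝ := fun i => z (DyadicCell.snap hΔ (i / Δ) (i % Δ))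
  have hcomp' : Computes (insert 0 (Set.range fun i x => A.mulVec x i)) T
      (F '' Set.Iio (Δ * Δ)) := by
    refine hcomp.mono_right ?_
    rintro _ ⟨i, -, rfl⟩
    exact ⟨_, rfl⟩
  obtain ⟨table, hlen, htab, hrun⟩ := hcomp'.exists_table hbig
  refine ⟨m, A, b, table, ?_, ?_, ?_, htab, fun x hx => ?_⟩
  · have h1 := DyadicCell.nearBound_mul_le R hL hL' hk hkΔ
    set l := Real.log ((Δ : ℝ) ^ 2 / k) with hl
    have h2 : (m : ℝ) ≤ C * (k * (2 * R + 1) ^ 2 * (13 * 26) * l ^ 2) := by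
      refine hm.trans (mul_le_mul_of_nonneg_left ?_ hC.le)
      rw [Nat.cast_mul] at h1
      exact h1
    calc (m : ℝ) ≤ C * (k * (2 * R + 1) ^ 2 * (13 * 26) * l ^ 2) := h2
      _ ≤ C * (k * ((2 * (4 * C) + 3) ^ 2 * (1 / ε ^ 2)) * (13 * 26) * l ^ 2) := by gcongr
      _ = C₁ * (1 / ε ^ 2 * k * l ^ 2) := by rw [hC₁]; ring
      _ ≤ _ := mul_le_mul_of_nonneg_right (by linarith) (by positivity)
  · have h1 := two_mul_add_nine_le hΔ2 hL'
    have h2 : (b : ℝ) = c₀ + 20 * ((2 * L + 9 : ℕ) : ℝ) := by rw [hb]; push_cast; ring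
    calc (b : ℝ) ≤ c₀ * Real.log ((Δ : ℝ) ^ 2) + 20 * (13 * Real.log ((Δ : ℝ) ^ 2)) := by
          rw [h2]
          have := le_mul_of_one_le_right (Nat.cast_nonneg c₀ : (0 : ℝ) ≤ c₀) hlog
          linarith
      _ = C₂ * Real.log ((Δ : ℝ) ^ 2) := by rw [hC₂]; ring
      _ ≤ _ := mul_le_mul_of_nonneg_right (by linarith) (by linarith)
  · refine le_trans (Nat.cast_le.2 (hlen.trans ?_)) hC₃W
    omega
  · obtain ⟨S, s, hS, hruns, hout⟩ := hrun x
    refine ⟨S, s, hruns, (Nat.cast_le.2 hS).trans hC₃W, ?_⟩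
    have himg := DyadicCell.image_eq_of_snap hΔ (fun p => z p x) hout
    rw [himg]
    exact emdNorm_le_mul_of_isSparse hΔ hk hx (by positivity) hRε (hz x hx)
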